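/- Let $\nu=\nu_\rho=\mu^{\otimes\mathbb Z}$ be a translation-invariant product probability measure on $\Omega=\mathbb N_0^{\mathbb Z}$ with mean $\rho=E_\nu[\eta(0)]$, with $0<\nu(\eta(0)=1)<1$, and such that for some $\lambda^*>0$ one has $E_\nu[e^{\lambda\eta(0)}]<\infty$ for all $|\lambda|\le\lambda^*$. Put $\sigma^2(\rho)=E_\nu[(\eta(0)-\rho)^2]$. For $|\lambda|<\lambda^*$ let $\nu^\lambda$ be the tilted measure, i.e. the product measure whose one-site marginal has density $k\mapsto e^{\lambda(k-\rho)}/E_\nu[e^{\lambda(\eta(0)-\rho)}]$ with respect to $\mu$. For $z$ in the range of $\lambda\mapsto E_{\nu^\lambda}[\eta(0)]$ on $(-\lambda^*,\lambda^*)$ let $\lambda(z)\in(-\lambda^*,\lambda^*)$ be the parameter with $E_{\nu^{\lambda(z)}}[\eta(0)]=z$, let $\nu_z=\nu^{\lambda(z)}$, and let $\varphi_f(z)=E_{\nu_z}[f]$. For $n\ge1$ let $y=\frac1n\sum_{x=1}^n\eta(x)-\rho$. **(a)** For every $\ell\ge 0$ there is a constant $C=C(\mu,\lambda^*,\ell)$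 such that the following holds for every $f\in L^5(\nu)$ that depends only on $\eta(1),\dots,\eta(\ell)$. The function $\varphi_f$ is twice continuously differentiable at $\rho$. If $\varphi_f(\rho)=0$, then for all $n\ge1$ $$\Big\|E_\nu[f\mid y]-y\,\varphi_f'(\rho)\Big\|_{L^4(\nu)}\le\frac{C\,\|f\|_{L^5(\nu)}}{n},$$ and if moreover $\varphi_f'(\rho)=0$, then for all $n\ge1$ $$\Big\|E_\nu[f\mid y]-\Big\{y^2-\frac{\sigma^2(\rho)}n\Big\}\frac{\varphi_f''(\rho)}2\Big\|_{L^4(\nu)}\le\frac{C\,\|f\|_{L^5(\nu)}}{n^{3/2}}.$$ **(b)** Consequently the equivalence-of-ensembles condition (EE) holds with $\alpha_0=1$. That is, let $\Lambda_\ell=\{-\ell,\dots,\ell\}$, $\eta^{(\ell)}=\frac1{2\ell+1}\sum_{x\in\Lambda_\ell}\eta(x)$, $\eta^c_\ell=(\eta(x))_{x\notin\Lambda_\ell}$ and $\sigma_\ell^2(\rho)=E_\nu\big[\big(\frac{1}{\sqrt{2\ell+1}}\sum_{x\in\Lambda_\ell}(\eta(x)-\rho)\big)^2\big]$. For every $\ell_0\ge0$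 there is a constant $C=C(\mu,\lambda^*,\ell_0)$ such that for every $f\in L^5(\nu)$ depending only on the sites in $\Lambda_{\ell_0}$ with $\varphi_f(\rho)=0$, and every $\ell\ge\max(\ell_0,1)$, $$\Big\|E_\nu[f\mid\eta^{(\ell)},\eta^c_\ell]-\varphi_f'(\rho)\,(\eta^{(\ell)}-\rho)\Big\|_{L^4(\nu)}\le\frac{C\,\|f\|_{L^5(\nu)}}{\ell^{1/2+\alpha_0/2}},$$ and if moreover $\varphi_f'(\rho)=0$, $$\Big\|E_\nu[f\mid\eta^{(\ell)},\eta^c_\ell]-\frac{\varphi_f''(\rho)}2\Big[(\eta^{(\ell)}-\rho)^2-\frac{\sigma_\ell^2(\rho)}{2\ell+1}\Big]\Big\|_{L^4(\nu)}\le\frac{C\,\|f\|_{L^5(\nu)}}{\ell^{1+\alpha_0/2}}.$$ -/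

import Mathlib

open MeasureTheory ProbabilityTheory
open scoped ENNReal

namespace EEns

/-- Particle configurations on `ℤ`: `η x` is the number of particles at site `x`. -/
abbrev Config : Type := ℤ → ℕ

/-- The translation-invariant product measure on configurations with one-site marginal `μ`. -/
noncomputable def prodMeasure (μ : Measure ℕ) : Measure Config :=
  Measure.infinitePi (fun _ : ℤ => μ)

/-- The density `E_κ[η(0)]` of a measure `κ` on configurations. -/
noncomputable def density (κ : Measure Config) : ℝ := ∫ η, (η 0 : ℝ) ∂κ

/-- The tilted measure `ν^λ`: every finite-volume marginal of the product measure `ν` is reweighted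
by `exp (λ ∑ₓ (η x - ρ))` and normalized. As `ν` is a product measure, this
is the product measure whose one-site marginal is the marginal of `ν` with the (normalized) density
`k ↦ exp (λ (k - ρ))`. -/
noncomputable def tiltedProd (μ : Measure ℕ) (lam : ℝ) : Measure Config :=
  prodMeasure (μ.tilted (fun k : ℕ => lam * ((k : ℝ) - density (prodMeasure μ))))

/-- The chemical potential `λ(z)`: the parameter `λ ∈ (-λ*, λ*)` for which `ν^λ` has density `z`
(an arbitrary value if there is none). -/
noncomputable def tiltParam (μ : Measure ℕ) (lamStar : ℝ) (z : ℝ) : ℝ :=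
  Function.invFunOn (fun lam : ℝ => density (tiltedProd μ lam)) (Set.Ioo (-lamStar) lamStar) z

/-- The tilted mean `φ_f(z) = E_{ν_z}[f]`, where `ν_z = ν^{λ(z)}` has density `z`. -/
noncomputable def tiltedMean (μ : Measure ℕ) (lamStar : ℝ) (f : Config → ℝ) (z : ℝ) : ℝ :=
  ∫ η, f η ∂(tiltedProd μ (tiltParam μ lamStar z))

/-- The one-site variance `σ²(ρ) = E_ν[(η(0) - ρ)²]`. -/
noncomputable def siteVar (μ : Measure ℕ) : ℝ :=
  ∫ η, ((η 0 : ℝ) - density (prodMeasure μ)) ^ 2 ∂(prodMeasure μ)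

/-- The sites `Λ⁺_n = {1, …, n}`. -/
noncomputable def boxPos (n : ℕ) : Finset ℤ := Finset.Icc 1 (n : ℤ)

/-- The sites `Λ_ℓ = {-ℓ, …, ℓ}`. -/
noncomputable def box (l : ℕ) : Finset ℤ := Finset.Icc (-(l : ℤ)) (l : ℤ)

/-- The centered empirical density `y = n⁻¹ ∑_{x ∈ Λ⁺_n} η(x) - ρ`. -/
noncomputable def yAvg (μ : Measure ℕ) (n : ℕ) (η : Config) : ℝ :=
  (∑ x ∈ boxPos n, (η x : ℝ)) / (n : ℝ) - density (prodMeasure μ)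

/-- The canonical expectation `E_ν[f | y]`. -/
noncomputable def canonicalExp (μ : Measure ℕ) (n : ℕ) (f : Config → ℝ) : Config → ℝ :=
  (prodMeasure μ)[f | MeasurableSpace.comap (yAvg μ n) inferInstance]

/-- The empirical average `η^{(ℓ)} = (2ℓ+1)⁻¹ ∑_{x ∈ Λ_ℓ} η(x)`. -/
noncomputable def boxAvg (l : ℕ) (η : Config) : ℝ :=
  (∑ x ∈ box l, (η x : ℝ)) / (2 * (l : ℝ) + 1)

/-- The outside variables `η^c_ℓ = (η(x))_{x ∉ Λ_ℓ}`. -/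
def outside (l : ℕ) (η : Config) : {x : ℤ // x ∉ box l} → ℕ := fun x => η x

/-- The expectation `E_ν[f | η^{(ℓ)}, η^c_ℓ]` given the empirical average in `Λ_ℓ` and the
configuration outside `Λ_ℓ`. -/
noncomputable def boxCanonicalExp (μ : Measure ℕ) (l : ℕ) (f : Config → ℝ) : Config → ℝ :=
  (prodMeasure μ)[f | MeasurableSpace.comap (fun η : Config => (boxAvg l η, outside l η))
    inferInstance]

/-- The variance `σ²_ℓ(ρ) = E_ν[((2ℓ+1)^{-1/2} ∑_{x ∈ Λ_ℓ} (η(x) - ρ))²]`. -/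
noncomputable def boxVar (μ : Measure ℕ) (l : ℕ) : ℝ :=
  ∫ η, ((∑ x ∈ box l, ((η x : ℝ) - density (prodMeasure μ))) / √(2 * (l : ℝ) + 1)) ^ 2
    ∂(prodMeasure μ)

/-- The equivalence-of-ensembles condition with exponent `α₀` for the product measure with marginal
`μ`. The constant `C` is uniform in the local function `f` supported on `Λ_{ℓ₀}` and in
`ℓ ≥ ℓ₀`. -/
def EquivalenceOfEnsembles (μ : Measure ℕ) (lamStar α₀ : ℝ) : Prop :=
  ∀ l₀ : ℕ, ∃ C : ℝ, ∀ f : Config → ℝ,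
    DependsOn f (box l₀ : Set ℤ) → MemLp f 5 (prodMeasure μ) →
    tiltedMean μ lamStar f (density (prodMeasure μ)) = 0 →
    ∀ l : ℕ, 1 ≤ l → l₀ ≤ l →
      (deriv (tiltedMean μ lamStar f) (density (prodMeasure μ)) = 0 →
        eLpNorm (fun η => boxCanonicalExp μ l f η
            - iteratedDeriv 2 (tiltedMean μ lamStar f) (density (prodMeasure μ)) / 2
              * ((boxAvg l η - density (prodMeasure μ)) ^ 2 - boxVar μ l / (2 * (l : ℝ) + 1)))
          4 (prodMeasure μ)
        ≤ ENNReal.ofReal (C / (l : ℝ) ^ (1 + α₀ / 2)) * eLpNorm f 5 (prodMeasure μ)) ∧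
      eLpNorm (fun η => boxCanonicalExp μ l f η
          - deriv (tiltedMean μ lamStar f) (density (prodMeasure μ))
            * (boxAvg l η - density (prodMeasure μ)))
        4 (prodMeasure μ)
      ≤ ENNReal.ofReal (C / (l : ℝ) ^ (1 / 2 + α₀ / 2)) * eLpNorm f 5 (prodMeasure μ)

end EEns

/-!
The proof avoids Fourier analysis and the local central limit theorem. Everything rests on one
estimate (`exists_canonical_bound`): if `f`, supported on a fixed finite set `Δ`, is orthogonal to
the polynomials of degree `< r ≤ 3` in the particle number of `Δ`, then the conditional
expectation of `f` given the particle number of `Λ ⊇ Δ` has `L⁴` norm `O (|Λ| ^ (-r / 2)) ‖f‖₅`.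

For this estimate the values of `η` are written as `k₀ + d ξ`, where `ξ` has a law `M` that
charges `0` and whose support has greatest common divisor `1`; laws are encoded as power series.
Some power of `M` then charges two consecutive integers, so it contains a multiple of a shifted
fair Bernoulli law (`exists_bernoulli_part`), and a high power of `M` is a mixture of laws with a
binomial component `(1 + X) ^ j`, where `j` is typically of the order of `|Λ|`. Given such a
component, the conditional expectation is a ratio of weighted sums of binomial coefficients,
shifted by the value `m` of the sum over `Δ`. In the central region the coefficients are
Newton-expanded in `m` (`abs_binShift_sub_newton_le`): the first `r` terms vanish by
orthogonality, and the remainder is smaller by the `r`-th power of (deviation + √j) / j. Outside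
the central region this power is bounded below and there is nothing to prove
(`abs_sum_mul_binShift_le`). Hölder's inequality over the mixture and moments and inverse moments
of binomial laws give the estimate (`exists_quartic_bound`).

The expansions follow by subtracting correctors. With `h x = η x - ρ`, exchangeability gives
`E[h x | ·] = y` exactly (`condExp_centred`), and `E[h x * h y | ·]` equals `y² - σ² / |Λ|` up to
`O (|Λ| ^ (-3 / 2))` (`exists_pair_bound`), because `y²` is a convex combination of it and of
`E[(h x)² | ·]`. The functions `f - φ'(ρ) h x` and, if `φ'(ρ) = 0`, `f - (φ''(ρ) / 2) h x * h y` are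
orthogonal to the polynomials of degree `≤ 1` and `≤ 2`, respectively, since the first moment of
`f` against the centred particle number is `φ'(ρ) σ²` and, if it vanishes, the second one is
`φ''(ρ) σ⁴`. These formulas, and the regularity of `φ`, come from writing `φ` along the tilted
family as a quotient of moment generating functions, with the chemical potential as the local
inverse of the derivative of the cumulant generating function (`tiltedMean_regular`).

All conditionings that occur are treated at once through the notion of a canonical field
(`IsCanonicalField`): additional information that is independent of the configuration in `Λ` does
not change the conditional expectation.
-/

namespace EEns

/-! ### Newton expansion of shifted binomial weights -/

/-- The discrete Newton expansion of order `r` at the origin, with its remainder bounded by the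
largest `r`-th forward difference on the way. -/
lemma abs_sub_newton_le (r : ℕ) : ∀ (D : ℕ → ℝ) (m : ℕ) (B : ℝ),
    (∀ t ≤ m, |(fwdDiff 1)^[r] D t| ≤ B) →
    |D m - ∑ i ∈ Finset.range r, (m.choose i : ℝ) * (fwdDiff 1)^[i] D 0| ≤ (m : ℝ) ^ r * B := by
  induction r with
  | zero => intro D m B h; simpa using h m le_rfl
  | succ r ih =>
    intro D m B h
    have hB : 0 ≤ B := (abs_nonneg _).trans (h 0 (Nat.zero_le _))
    have key : ∀ k : ℕ, D k - ∑ i ∈ Finset.range (r + 1), (k.choose i : ℝ) * (fwdDiff 1)^[i] D 0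
        = ∑ t ∈ Finset.range k, (fwdDiff 1 D t
          - ∑ i ∈ Finset.range r, (t.choose i : ℝ) * (fwdDiff 1)^[i] (fwdDiff 1 D) 0) := by
      intro k
      induction k with
      | zero => simp [Finset.sum_range_succ']
      | succ k ihk =>
        rw [Finset.sum_range_succ _ k, ← ihk]
        simp only [Finset.sum_range_succ' _ r, Nat.choose_succ_succ, Function.iterate_succ_apply,
          Nat.cast_add, add_mul, Finset.sum_add_distrib, fwdDiff]
        simp
        ring
    rw [key m]
    calc _ ≤ ∑ t ∈ Finset.range m, |fwdDiff 1 D t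
          - ∑ i ∈ Finset.range r, (t.choose i : ℝ) * (fwdDiff 1)^[i] (fwdDiff 1 D) 0| :=
          Finset.abs_sum_le_sum_abs _ _
      _ ≤ ∑ _t ∈ Finset.range m, (m : ℝ) ^ r * B := by
          refine Finset.sum_le_sum fun t ht => ?_
          have htm : t < m := Finset.mem_range.1 ht
          refine (ih (fwdDiff 1 D) t B fun u hu => ?_).trans ?_
          · exact h u (hu.trans htm.le)
          · gcongr
      _ = _ := by simp [pow_succ]; ring

/-- The coefficient of `x ^ s` in `x ^ m * (1 + x) ^ j`, that is, the number of subsets of size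
`s - m` of a set of size `j`; the truncated subtraction is guarded. -/
def binShift (j s m : ℕ) : ℝ := if m ≤ s then (j.choose (s - m) : ℝ) else 0

lemma binShift_nonneg (j s m : ℕ) : 0 ≤ binShift j s m := by
  unfold binShift; split_ifs <;> positivity

lemma binShift_of_lt {j s m : ℕ} (h : s < m) : binShift j s m = 0 := by
  simp [binShift, h]

/-- The ratio of consecutive values of `binShift`. -/
lemma binShift_succ_mul {j s : ℕ} (hs : s ≤ j) (m : ℕ) :
    binShift j s (m + 1) * ((j : ℝ) + 1 - s + m) = binShift j s m * ((s : ℝ) - m) := by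
  rcases lt_trichotomy m s with h | h | h
  · obtain ⟨k, rfl⟩ : ∃ k, s = m + 1 + k := ⟨s - (m + 1), by omega⟩
    have h1 := Nat.choose_succ_right_eq j k
    have h2 : ((j - k : ℕ) : ℝ) = (j : ℝ) - k := by rw [Nat.cast_sub (by omega)]
    have h3 : (j.choose (k + 1) : ℝ) * ((k : ℝ) + 1) = j.choose k * ((j : ℝ) - k) := by
      rw [← h2]; exact_mod_cast h1
    simp only [binShift, show m + 1 ≤ m + 1 + k by omega, show m ≤ m + 1 + k by omega, if_true,
      show m + 1 + k - (m + 1) = k by omega, show m + 1 + k - m = k + 1 by omega]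
    push_cast
    linear_combination -h3
  · subst h; simp [binShift]
  · rw [binShift_of_lt h, binShift_of_lt (by omega)]; simp

section Central

variable {j s : ℕ} {δ : ℝ}

/-- In the central region, shifting the binomial weights costs at most a geometric factor. -/
lemma binShift_le_geom (hδ : δ ≤ 1 / 2)
    (hc : |2 * (s : ℝ) - (j + 1)| ≤ δ * (j + 1)) (hs : s ≤ j) (m : ℕ) :
    binShift j s m ≤ ((1 + δ) / (1 - δ)) ^ m * binShift j s 0 := by
  have hj : (0 : ℝ) < (j : ℝ) + 1 := by positivity
  have hδ0 : 0 ≤ δ := by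
    have := (abs_nonneg _).trans hc
    exact nonneg_of_mul_nonneg_left this hj
  have h1 := (abs_le.1 hc).2
  induction m with
  | zero => simp
  | succ m ih =>
    have hq : 0 < (j : ℝ) + 1 - s + m := by
      have : (s : ℝ) ≤ j := by exact_mod_cast hs
      linarith [show (0 : ℝ) ≤ (m : ℝ) by positivity]
    have hr := binShift_succ_mul hs m
    have hle : binShift j s (m + 1) ≤ (1 + δ) / (1 - δ) * binShift j s m := by
      have e : binShift j s (m + 1)
          = ((s : ℝ) - m) / ((j : ℝ) + 1 - s + m) * binShift j s m := by
        field_simp; linarith [hr]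
      rw [e]
      refine mul_le_mul_of_nonneg_right ?_ (binShift_nonneg _ _ _)
      rw [div_le_div_iff₀ hq (by linarith)]
      have hm : (0 : ℝ) ≤ m := by positivity
      nlinarith
    calc _ ≤ (1 + δ) / (1 - δ) * binShift j s m := hle
      _ ≤ (1 + δ) / (1 - δ) * (((1 + δ) / (1 - δ)) ^ m * binShift j s 0) := by
          refine mul_le_mul_of_nonneg_left ih (div_nonneg (by linarith) (by linarith))
      _ = _ := by ring

/-- In the central region the forward differences of the binomial weights of order `r ≤ 3` are
smaller than the weights by the `r`-th power of (deviation + √j) / j. They satisfy the three-term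
recursion that comes from differencing `q Δ D = (j + 1 - 2 q) D`; each of its steps costs a factor
that is collected in the constant `2080 = 4 * 520`. -/
lemma abs_fwdDiff_binShift_le (hδ : δ ≤ 1 / 2)
    (hc : |2 * (s : ℝ) - (j + 1)| ≤ δ * (j + 1)) (hs : s ≤ j) (m r : ℕ) (hr : r ≤ 3) :
    |(fwdDiff 1)^[r] (binShift j s) m| ≤
      2080 * ((|2 * (s : ℝ) - (j + 1)| + 2 * m + √(j + 1)) / (j + 1)) ^ r * binShift j s m := by
  set J : ℝ := (j : ℝ) + 1 with hJ
  have hJ1 : 1 ≤ J := by rw [hJ]; linarith [show (0 : ℝ) ≤ (j : ℝ) by positivity]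
  have hJ0 : 0 < J := by linarith
  set v := |2 * (s : ℝ) - J| with hv
  set T := (v + 2 * m + √J) / J with hT
  have hm : (0 : ℝ) ≤ m := by positivity
  have hv0 : 0 ≤ v := abs_nonneg _
  have hsq1 : 1 ≤ √J := by rw [Real.one_le_sqrt]; exact hJ1
  have hT0 : 0 ≤ T := by positivity
  have hTJ : J * T = v + 2 * m + √J := by rw [hT]; field_simp
  have hT2 : 1 ≤ J * T ^ 2 := by
    have h1 : √J ≤ J * T := by rw [hTJ]; linarith
    have h2 : J ≤ (J * T) ^ 2 := by
      calc J = √J ^ 2 := (Real.sq_sqrt hJ0.le).symm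
        _ ≤ _ := by gcongr
    have : J * 1 ≤ J * (J * T ^ 2) := by nlinarith
    exact le_of_mul_le_mul_left this hJ0
  have h1 := (abs_le.1 hc).2
  set q : ℝ := J - s + m with hq
  have hqJ : J / 4 ≤ q := by rw [hq]; nlinarith
  have hq0 : 0 < q := by linarith
  set D := binShift j s with hD
  have hD0 : 0 ≤ D m := binShift_nonneg _ _ _
  have r0 : D (m + 1) * q = D m * (s - m) := binShift_succ_mul hs m
  have r1 : D (m + 2) * (q + 1) = D (m + 1) * (s - (m + 1)) := by
    have := binShift_succ_mul hs (m + 1); push_cast at this; rw [hq]; linear_combination this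
  have r2 : D (m + 3) * (q + 2) = D (m + 2) * (s - (m + 2)) := by
    have := binShift_succ_mul hs (m + 2); push_cast at this; rw [hq]; linear_combination this
  set d1 := D (m + 1) - D m with hd1
  set d2 := D (m + 2) - 2 * D (m + 1) + D m with hd2
  set d3 := D (m + 3) - 3 * D (m + 2) + 3 * D (m + 1) - D m with hd3
  have e1 : q * d1 = (J - 2 * q) * D m := by
    rw [hd1]; linear_combination r0 + D m * hq
  have e2 : (q + 1) * d2 = (J - 2 * q - 3) * d1 - 2 * D m := by
    rw [hd1, hd2]; linear_combination r1 - r0 + (D (m+1) - D m) * hq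
  have e3 : (q + 2) * d3 = (J - 2 * q - 6) * d2 - 4 * d1 := by
    rw [hd1, hd2, hd3]
    linear_combination r2 - 2 * r1 + r0 + (D (m + 2) - 2 * D (m+1) + D m) * hq
  have hJq : |J - 2 * q| ≤ v + 2 * m := by
    have : J - 2 * q = (2 * s - J) - 2 * m := by rw [hq]; ring
    rw [this]
    exact (abs_sub _ _).trans (by rw [abs_of_nonneg (by positivity : (0 : ℝ) ≤ 2 * m)])
  have aux : ∀ (a x y : ℝ), q ≤ a → 0 ≤ y → |a * x| ≤ J * y → |x| ≤ 4 * y := by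
    intro a x y ha hy h
    rw [abs_mul, abs_of_pos (by linarith)] at h
    have : J / 4 * |x| ≤ J * y :=
      (mul_le_mul_of_nonneg_right (hqJ.trans ha) (abs_nonneg _)).trans h
    have : J * |x| ≤ J * (4 * y) := by linarith
    exact le_of_mul_le_mul_left this hJ0
  have b1 : |d1| ≤ 4 * (T * D m) := by
    refine aux q d1 _ le_rfl (by positivity) ?_
    rw [e1, abs_mul, abs_of_nonneg hD0, ← mul_assoc, hTJ]
    refine mul_le_mul_of_nonneg_right ?_ hD0
    linarith
  have b2 : |d2| ≤ 4 * (18 * T ^ 2 * D m) := by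
    refine aux (q + 1) d2 _ (by linarith) (by positivity) ?_
    rw [e2]
    have hc3 : |J - 2 * q - 3| ≤ 4 * (J * T) := by
      refine (abs_sub _ _).trans ?_
      rw [hTJ, abs_of_pos (by norm_num : (0 : ℝ) < 3)]; linarith
    calc _ ≤ |(J - 2 * q - 3) * d1| + |2 * D m| := abs_sub _ _
      _ ≤ 4 * (J * T) * (4 * (T * D m)) + 2 * (J * T ^ 2 * D m) := by
          rw [abs_mul, abs_of_nonneg (by positivity : 0 ≤ 2 * D m)]
          have : D m ≤ J * T ^ 2 * D m := by nlinarith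
          gcongr
      _ = _ := by ring
  have b3 : |d3| ≤ 4 * (520 * T ^ 3 * D m) := by
    refine aux (q + 2) d3 _ (by linarith) (by positivity) ?_
    rw [e3]
    have hc6 : |J - 2 * q - 6| ≤ 7 * (J * T) := by
      refine (abs_sub _ _).trans ?_
      rw [hTJ, abs_of_pos (by norm_num : (0 : ℝ) < 6)]; linarith
    calc _ ≤ |(J - 2 * q - 6) * d2| + |4 * d1| := abs_sub _ _
      _ ≤ 7 * (J * T) * (4 * (18 * T ^ 2 * D m)) + 4 * (4 * (T * (J * T ^ 2 * D m))) := by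
          rw [abs_mul, abs_mul, abs_of_pos (by norm_num : (0 : ℝ) < 4)]
          have : D m ≤ J * T ^ 2 * D m := by nlinarith
          have : |d1| ≤ 4 * (T * (J * T ^ 2 * D m)) := b1.trans (by gcongr)
          gcongr
      _ = _ := by ring
  have fin : ∀ (x : ℝ) (k : ℕ) (c : ℝ), c ≤ 2080 → |x| ≤ c * (T ^ k * D m) →
      |x| ≤ 2080 * T ^ k * D m := fun x k c hc2 h => by
    rw [mul_assoc]
    exact h.trans (mul_le_mul_of_nonneg_right hc2 (by positivity))
  clear_value T q d1 d2 d3 v J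
  interval_cases r
  · refine fin _ 0 1 (by norm_num) ?_
    simp only [Function.iterate_zero, id, pow_zero, one_mul]
    rw [abs_of_nonneg hD0]
  · have : (fwdDiff 1)^[1] D m = d1 := by simp [fwdDiff, hd1]
    rw [this]
    exact fin _ 1 4 (by norm_num) (by rw [pow_one]; exact b1)
  · have : (fwdDiff 1)^[2] D m = d2 := by
      simp only [Function.iterate_succ, Function.iterate_zero, Function.comp, id, fwdDiff, hd2,
        add_assoc, Nat.reduceAdd]
      ring
    rw [this]
    exact fin _ 2 72 (by norm_num) (b2.trans_eq (by ring))
  · have : (fwdDiff 1)^[3] D m = d3 := by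
      simp only [Function.iterate_succ, Function.iterate_zero, Function.comp, id, fwdDiff, hd3,
        add_assoc, Nat.reduceAdd]
      ring
    rw [this]
    exact fin _ 3 2080 le_rfl (b3.trans_eq (by ring))

/-- Newton expansion of the shifted binomial weights in the central region. -/
lemma abs_binShift_sub_newton_le (hδ : δ ≤ 1 / 2)
    (hc : |2 * (s : ℝ) - (j + 1)| ≤ δ * (j + 1)) (hs : s ≤ j) (m r : ℕ) (hr : r ≤ 3) :
    |binShift j s m
        - ∑ i ∈ Finset.range r, (m.choose i : ℝ) * (fwdDiff 1)^[i] (binShift j s) 0| ≤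
      2080 * ((|2 * (s : ℝ) - (j + 1)| + √(j + 1)) / (j + 1)) ^ r * binShift j s 0
        * ((1 + 2 * m) ^ (2 * r) * ((1 + δ) / (1 - δ)) ^ m) := by
  have hδ0 : 0 ≤ δ := by
    have := (abs_nonneg _).trans hc
    exact nonneg_of_mul_nonneg_left this (by positivity)
  have hρ : 1 ≤ (1 + δ) / (1 - δ) := by rw [le_div_iff₀ (by linarith)]; linarith
  have hD := binShift_nonneg j s 0
  have hsq1 : 1 ≤ √((j : ℝ) + 1) := by
    rw [Real.one_le_sqrt]; linarith [show (0 : ℝ) ≤ (j : ℝ) by positivity]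
  refine (abs_sub_newton_le r _ m (2080 * ((|2 * (s : ℝ) - (j + 1)| + √(j + 1)) / (j + 1)) ^ r
    * binShift j s 0 * ((1 + 2 * m) ^ r * ((1 + δ) / (1 - δ)) ^ m)) fun t ht => ?_).trans ?_
  · refine (abs_fwdDiff_binShift_le hδ hc hs t r hr).trans ?_
    have h1 : (|2 * (s : ℝ) - (j + 1)| + 2 * t + √(j + 1)) / (j + 1)
        ≤ (|2 * (s : ℝ) - (j + 1)| + √(j + 1)) / (j + 1) * (1 + 2 * m) := by
      rw [div_mul_eq_mul_div]
      have htm : (t : ℝ) ≤ m := by exact_mod_cast ht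
      have := abs_nonneg (2 * (s : ℝ) - (j + 1))
      have hm : (0 : ℝ) ≤ m := by positivity
      gcongr
      nlinarith
    have h2 : binShift j s t ≤ ((1 + δ) / (1 - δ)) ^ m * binShift j s 0 :=
      (binShift_le_geom hδ hc hs t).trans
        (mul_le_mul_of_nonneg_right (pow_le_pow_right₀ hρ ht) hD)
    calc _ ≤ 2080 * ((|2 * (s : ℝ) - (j + 1)| + √(j + 1)) / (j + 1) * (1 + 2 * m)) ^ r
          * (((1 + δ) / (1 - δ)) ^ m * binShift j s 0) := by
          have := binShift_nonneg j s t
          gcongr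
      _ = _ := by rw [mul_pow]; ring
  · have hm : (m : ℝ) ^ r ≤ (1 + 2 * m) ^ r := by
      gcongr; linarith [show (0 : ℝ) ≤ (m : ℝ) by positivity]
    calc _ ≤ (1 + 2 * (m : ℝ)) ^ r * (2080 * ((|2 * (s : ℝ) - (j + 1)| + √(j + 1)) / (j + 1)) ^ r
        * binShift j s 0 * ((1 + 2 * m) ^ r * ((1 + δ) / (1 - δ)) ^ m)) := by
          gcongr
      _ = _ := by rw [two_mul r, pow_add]; ring

end Central

/-- Pointwise bound for the numerator of the conditional expectation given a sum with a binomial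
component: if the signed weights `κ m * g m` annihilate the polynomials of degree `< r`, the
numerator gains the `r`-th power of (deviation + √j) / j. -/
lemma abs_sum_mul_binShift_le {κ : ℕ → ℝ} (hκ : ∀ m, 0 ≤ κ m) (hκ0 : 0 < κ 0) {r : ℕ} (hr : r ≤ 3)
    {δ : ℝ} (hδ0 : 0 < δ) (hδ : δ ≤ 1 / 2) (A : ℝ) {g : ℕ → ℝ} {G : ℝ} (hG : 0 < G)
    (hs : Summable fun m => κ m * |g m| * ((1 + 2 * m) ^ (2 * r) * ((1 + δ) / (1 - δ)) ^ m))
    (hA : ∑' m, κ m * |g m| * ((1 + 2 * m) ^ (2 * r) * ((1 + δ) / (1 - δ)) ^ m) ≤ A * G)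
    (hz : ∀ i < r, ∑' m, κ m * g m * (m.choose i : ℝ) = 0) (j s : ℕ) :
    |∑ m ∈ Finset.range (s + 1), κ m * g m * binShift j s m| ≤
      (2080 * A / κ 0 + (1 / δ) ^ r) * ((|2 * (s : ℝ) - (j + 1)| + √(j + 1)) / (j + 1)) ^ r
        * ∑ m ∈ Finset.range (s + 1), κ m * binShift j s m * (G + |g m|) := by
  set T := (|2 * (s : ℝ) - (j + 1)| + √(j + 1)) / (j + 1) with hT
  have hJ : (0 : ℝ) < (j : ℝ) + 1 := by positivity
  have hT0 : 0 ≤ T := by positivity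
  set S := ∑ m ∈ Finset.range (s + 1), κ m * binShift j s m * (G + |g m|) with hS
  have hSt : ∀ m, 0 ≤ κ m * binShift j s m * (G + |g m|) := fun m =>
    mul_nonneg (mul_nonneg (hκ m) (binShift_nonneg _ _ _)) (by positivity)
  have hS0 : 0 ≤ S := Finset.sum_nonneg fun m _ => hSt m
  have hρ : 1 ≤ (1 + δ) / (1 - δ) := by rw [le_div_iff₀ (by linarith)]; linarith
  have hA0 : 0 ≤ A := nonneg_of_mul_nonneg_left (le_trans (tsum_nonneg fun m => by
    have := hκ m; positivity) hA) hG
  by_cases hc : |2 * (s : ℝ) - (j + 1)| ≤ δ * (j + 1)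
  · have hsj : s ≤ j := by
      have h1 := (abs_le.1 hc).2
      have : (s : ℝ) < j + 1 := by nlinarith
      exact Nat.lt_succ_iff.1 (by exact_mod_cast this)
    set w : ℕ → ℝ := fun m => (1 + 2 * (m : ℝ)) ^ (2 * r) * ((1 + δ) / (1 - δ)) ^ m with hw
    set N : ℕ → ℝ := fun m =>
      ∑ i ∈ Finset.range r, (m.choose i : ℝ) * (fwdDiff 1)^[i] (binShift j s) 0 with hN
    have hsc : ∀ i < r, Summable fun m => κ m * g m * (m.choose i : ℝ) := by
      intro i hi
      refine Summable.of_norm_bounded hs fun m => ?_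
      rw [Real.norm_eq_abs, abs_mul, abs_mul, abs_of_nonneg (hκ m), Nat.abs_cast]
      refine mul_le_mul_of_nonneg_left ?_ (mul_nonneg (hκ m) (abs_nonneg _))
      have hm : (0 : ℝ) ≤ m := by positivity
      calc (m.choose i : ℝ) ≤ (m : ℝ) ^ i := by exact_mod_cast Nat.choose_le_pow m i
        _ ≤ (1 + 2 * (m : ℝ)) ^ i := by gcongr; linarith
        _ ≤ (1 + 2 * (m : ℝ)) ^ (2 * r) := pow_le_pow_right₀ (by linarith) (by omega)
        _ ≤ _ := le_mul_of_one_le_right (by positivity) (one_le_pow₀ hρ)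
    -- The Newton polynomial in `m` does not contribute, by orthogonality.
    have hzN : HasSum (fun m => κ m * g m * N m) 0 := by
      have h1 : HasSum (fun m => ∑ i ∈ Finset.range r,
          κ m * g m * (m.choose i : ℝ) * (fwdDiff 1)^[i] (binShift j s) 0)
          (∑ i ∈ Finset.range r, 0 * (fwdDiff 1)^[i] (binShift j s) 0) := by
        refine hasSum_sum fun i hi => ?_
        have hi := Finset.mem_range.1 hi
        have := (hsc i hi).hasSum
        rw [hz i hi] at this
        exact this.mul_right _
      simp only [zero_mul, Finset.sum_const_zero] at h1
      convert! h1 using 2 with m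
      rw [hN, Finset.mul_sum]
      exact Finset.sum_congr rfl fun i _ => by ring
    have hfin : HasSum (fun m => κ m * g m * binShift j s m)
        (∑ m ∈ Finset.range (s + 1), κ m * g m * binShift j s m) := by
      refine hasSum_sum_of_ne_finset_zero fun m hm => ?_
      rw [binShift_of_lt (by simpa [Nat.lt_succ_iff] using hm), mul_zero]
    have hdiff := hfin.sub hzN
    rw [sub_zero] at hdiff
    have hbd : |∑ m ∈ Finset.range (s + 1), κ m * g m * binShift j s m|
        ≤ 2080 * T ^ r * binShift j s 0 * (A * G) := by
      rw [← hdiff.tsum_eq]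
      have hb : ∀ m, ‖κ m * g m * binShift j s m - κ m * g m * N m‖
          ≤ 2080 * T ^ r * binShift j s 0 * (κ m * |g m| * w m) := by
        intro m
        rw [← mul_sub, Real.norm_eq_abs, abs_mul, abs_mul, abs_of_nonneg (hκ m)]
        calc _ ≤ κ m * |g m| * (2080 * T ^ r * binShift j s 0 * w m) :=
              mul_le_mul_of_nonneg_left (abs_binShift_sub_newton_le hδ hc hsj m r hr)
                (mul_nonneg (hκ m) (abs_nonneg _))
          _ = _ := by ring
      have hB0 := binShift_nonneg j s 0
      calc _ ≤ ∑' m, 2080 * T ^ r * binShift j s 0 * (κ m * |g m| * w m) :=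
            tsum_of_norm_bounded (hs.mul_left _).hasSum hb
        _ = 2080 * T ^ r * binShift j s 0 * ∑' m, κ m * |g m| * w m := tsum_mul_left
        _ ≤ _ := mul_le_mul_of_nonneg_left hA (by positivity)
    -- The prefactor is bounded by the term `m = 0` of `S`.
    have hP : κ 0 * binShift j s 0 * G ≤ S := by
      refine le_trans ?_ (Finset.single_le_sum (fun m _ => hSt m) (Finset.mem_range.2 s.succ_pos))
      refine mul_le_mul_of_nonneg_left ?_ (mul_nonneg hκ0.le (binShift_nonneg _ _ _))
      linarith [abs_nonneg (g 0)]
    calc _ ≤ 2080 * T ^ r * binShift j s 0 * (A * G) := hbd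
      _ = 2080 * A / κ 0 * T ^ r * (κ 0 * binShift j s 0 * G) := by field_simp
      _ ≤ 2080 * A / κ 0 * T ^ r * S := by gcongr
      _ ≤ _ := by
        gcongr
        have : 0 ≤ (1 / δ) ^ r := by positivity
        linarith
  · -- Away from the centre the gain `T ^ r` is bounded below.
    push Not at hc
    have hT1 : 1 ≤ (1 / δ) ^ r * T ^ r := by
      rw [← mul_pow]
      refine one_le_pow₀ ?_
      rw [hT, one_div_mul_eq_div, div_div, le_div_iff₀ (by positivity), one_mul]
      have := Real.sqrt_nonneg ((j : ℝ) + 1)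
      linarith
    have h1 : |∑ m ∈ Finset.range (s + 1), κ m * g m * binShift j s m| ≤ S := by
      refine (Finset.abs_sum_le_sum_abs _ _).trans (Finset.sum_le_sum fun m _ => ?_)
      rw [abs_mul, abs_mul, abs_of_nonneg (hκ m), abs_of_nonneg (binShift_nonneg j s m),
        mul_right_comm]
      refine mul_le_mul_of_nonneg_left ?_ (mul_nonneg (hκ m) (binShift_nonneg _ _ _))
      linarith
    have hA' : 0 ≤ 2080 * A / κ 0 * T ^ r * S := by
      positivity
    calc _ ≤ S := h1
      _ ≤ ((1 / δ) ^ r * T ^ r) * S := le_mul_of_one_le_left hS0 hT1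
      _ ≤ _ := by rw [add_mul, add_mul]; linarith

/-! ### Elementary inequalities and moments of binomial laws -/

section Elementary

/-- Hölder's inequality with exponents `4/3` and `4`, in division-free form. -/
lemma sum_pow_four_le {ι : Type*} (s : Finset ι) {w V P U : ι → ℝ}
    (hw : ∀ i ∈ s, 0 ≤ w i) (hP : ∀ i ∈ s, 0 ≤ P i) (hU : ∀ i ∈ s, 0 ≤ U i)
    (h : ∀ i ∈ s, V i ^ 4 ≤ P i ^ 3 * U i) :
    (∑ i ∈ s, w i * V i) ^ 4 ≤ (∑ i ∈ s, w i * P i) ^ 3 * ∑ i ∈ s, w i * U i := by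
  -- Two applications of Cauchy-Schwarz, with `V ^ 2 / P` as the intermediate quantity.
  have hSP : 0 ≤ ∑ i ∈ s, w i * P i := Finset.sum_nonneg fun i hi => mul_nonneg (hw i hi) (hP i hi)
  have h1 : (∑ i ∈ s, w i * V i) ^ 2 ≤ (∑ i ∈ s, w i * P i) * ∑ i ∈ s, w i * (V i ^ 2 / P i) := by
    refine Finset.sum_sq_le_sum_mul_sum_of_sq_le_mul s (fun i hi => mul_nonneg (hw i hi) (hP i hi))
      (fun i hi => mul_nonneg (hw i hi) (div_nonneg (sq_nonneg _) (hP i hi))) fun i hi => ?_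
    rcases (hP i hi).eq_or_lt with h0 | h0
    · have := h i hi
      rw [← h0] at this
      have hV : V i = 0 := by
        have h4 : V i ^ 4 = 0 := le_antisymm (by simpa using this) (by positivity)
        simpa using h4
      simp [hV]
    · apply le_of_eq; field_simp
  have h2 : (∑ i ∈ s, w i * (V i ^ 2 / P i)) ^ 2 ≤ (∑ i ∈ s, w i * P i) * ∑ i ∈ s, w i * U i := by
    refine Finset.sum_sq_le_sum_mul_sum_of_sq_le_mul s (fun i hi => mul_nonneg (hw i hi) (hP i hi))
      (fun i hi => mul_nonneg (hw i hi) (hU i hi)) fun i hi => ?_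
    rcases (hP i hi).eq_or_lt with h0 | h0
    · simp [← h0]
    · have := h i hi
      have e : (w i * (V i ^ 2 / P i)) ^ 2 = w i ^ 2 * (V i ^ 4 / P i ^ 2) := by ring
      rw [e, show w i * P i * (w i * U i) = w i ^ 2 * (P i * U i) by ring]
      refine mul_le_mul_of_nonneg_left ?_ (sq_nonneg _)
      rw [div_le_iff₀ (by positivity)]
      linarith
  have hQ : 0 ≤ ∑ i ∈ s, w i * (V i ^ 2 / P i) :=
    Finset.sum_nonneg fun i hi => mul_nonneg (hw i hi) (div_nonneg (sq_nonneg _) (hP i hi))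
  calc _ = ((∑ i ∈ s, w i * V i) ^ 2) ^ 2 := by ring
    _ ≤ ((∑ i ∈ s, w i * P i) * ∑ i ∈ s, w i * (V i ^ 2 / P i)) ^ 2 := by gcongr
    _ = (∑ i ∈ s, w i * P i) ^ 2 * (∑ i ∈ s, w i * (V i ^ 2 / P i)) ^ 2 := by ring
    _ ≤ (∑ i ∈ s, w i * P i) ^ 2 * ((∑ i ∈ s, w i * P i) * ∑ i ∈ s, w i * U i) := by gcongr
    _ = _ := by ring

/-- Even moments of the fair binomial law, centred and on the scale `√(j + 1)`. -/
lemma sum_choose_mul_pow_le (j p : ℕ) :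
    ∑ b ∈ Finset.range (j + 1), (j.choose b : ℝ) * (2 * (b : ℝ) - j) ^ (2 * p) ≤
      2 * (2 * p).factorial * 2 ^ j * ((j : ℝ) + 1) ^ p := by
  set t : ℝ := 1 / √((j : ℝ) + 1) with ht
  have hJ : (0 : ℝ) < (j : ℝ) + 1 := by positivity
  have ht2 : t ^ 2 = 1 / ((j : ℝ) + 1) := by rw [ht, div_pow, one_pow, Real.sq_sqrt hJ.le]
  have hexp : ∀ u : ℝ, ∑ b ∈ Finset.range (j + 1), (j.choose b : ℝ)
      * Real.exp (u * (2 * (b : ℝ) - j)) = (Real.exp u + Real.exp (-u)) ^ j := by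
    intro u
    rw [add_pow]
    refine Finset.sum_congr rfl fun b hb => ?_
    have hb : b ≤ j := Nat.lt_succ_iff.1 (Finset.mem_range.1 hb)
    rw [← Real.exp_nat_mul, ← Real.exp_nat_mul, ← Real.exp_add, mul_comm]
    congr 2
    rw [Nat.cast_sub hb]; ring
  have hcosh : ∑ b ∈ Finset.range (j + 1), (j.choose b : ℝ) * Real.cosh (t * (2 * (b : ℝ) - j))
      = 2 ^ j * Real.cosh t ^ j := by
    have h1 := hexp t
    have h2 := hexp (-t)
    have h3 : (Real.exp t + Real.exp (-t)) = 2 * Real.cosh t := by rw [Real.cosh_eq]; ring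
    rw [neg_neg, add_comm (Real.exp (-t)), h3] at h2
    rw [h3] at h1
    simp only [Real.cosh_eq (t * _), mul_div_assoc', mul_add, add_div, Finset.sum_add_distrib]
    rw [← Finset.sum_div, ← Finset.sum_div, h1]
    simp only [← neg_mul]
    rw [h2, mul_pow]; ring
  have hcj : Real.cosh t ^ j ≤ 2 := by
    calc Real.cosh t ^ j ≤ Real.exp (t ^ 2 / 2) ^ j := by
          gcongr
          exact Real.cosh_le_exp_half_sq t
      _ = Real.exp (j * (t ^ 2 / 2)) := by rw [← Real.exp_nat_mul]
      _ ≤ Real.exp (1 / 2) := by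
          apply Real.exp_le_exp.2
          rw [ht2, ← mul_div_assoc, mul_one_div]
          gcongr
          rw [div_le_one hJ]; linarith
      _ ≤ 2 := by
          have h4 : Real.exp (1 / 2) ^ 2 ≤ 2 ^ 2 := by
            rw [← Real.exp_nat_mul]
            norm_num
            linarith [Real.exp_one_lt_d9]
          exact le_of_sq_le_sq h4 (by norm_num)
  have hpow : ∀ x : ℝ, x ^ (2 * p) ≤ (2 * p).factorial * ((j : ℝ) + 1) ^ p * Real.cosh (t * x) := by
    intro x
    have h1 : (t * x) ^ (2 * p) / (2 * p).factorial ≤ Real.cosh (t * x) := by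
      have hs := Real.hasSum_cosh (t * x)
      exact le_hasSum hs p fun i _ => div_nonneg
        ((even_two_mul i).pow_nonneg _) (by positivity)
    rw [div_le_iff₀ (by positivity), mul_pow, pow_mul t, ht2, div_pow, one_pow,
      div_mul_eq_mul_div, one_mul, div_le_iff₀ (by positivity)] at h1
    linarith
  calc _ ≤ ∑ b ∈ Finset.range (j + 1), (j.choose b : ℝ) *
        ((2 * p).factorial * ((j : ℝ) + 1) ^ p * Real.cosh (t * (2 * (b : ℝ) - j))) := by
        gcongr with b _
        exact hpow _
    _ = (2 * p).factorial * ((j : ℝ) + 1) ^ p * (2 ^ j * Real.cosh t ^ j) := by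
        rw [← hcosh, Finset.mul_sum]
        exact Finset.sum_congr rfl fun b _ => by ring
    _ ≤ (2 * p).factorial * ((j : ℝ) + 1) ^ p * (2 ^ j * 2) := by gcongr
    _ = _ := by ring

/-- Inverse moments of the binomial law. -/
lemma sum_choose_div_pow_le {p q : ℝ} (hp : 0 < p) (hq : 0 ≤ q) (hpq : p + q = 1) (N k : ℕ) :
    ∑ j ∈ Finset.range (N + 1), (N.choose j : ℝ) * p ^ j * q ^ (N - j) / ((j : ℝ) + 1) ^ k ≤
      k.factorial / (p ^ k * ((N : ℝ) + 1) ^ k) := by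
  -- Up to constants, dividing by `(j + 1) ^ k` shifts `N` and `j` by `k` in the binomial weights.
  have hfac : ∀ j : ℕ, (j + k).factorial ≤ k.factorial * j.factorial * (j + 1) ^ k := by
    intro j
    induction k with
    | zero => simp
    | succ k ih =>
      rw [← add_assoc, Nat.factorial_succ, Nat.factorial_succ, pow_succ]
      calc (j + k + 1) * (j + k).factorial
          ≤ ((k + 1) * (j + 1)) * (k.factorial * j.factorial * (j + 1) ^ k) :=
            Nat.mul_le_mul (by nlinarith) ih
        _ = _ := by ring
  have hN : N.factorial * (N + 1) ^ k ≤ (N + k).factorial := Nat.factorial_mul_pow_le_factorial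
  have hterm : ∀ j ∈ Finset.range (N + 1),
      (N.choose j : ℝ) * p ^ j * q ^ (N - j) / ((j : ℝ) + 1) ^ k ≤
      k.factorial / (p ^ k * ((N : ℝ) + 1) ^ k)
        * (p ^ (k + j) * q ^ (N + k - (k + j)) * ((N + k).choose (k + j) : ℝ)) := by
    intro j hj
    have hj : j ≤ N := Nat.lt_succ_iff.1 (Finset.mem_range.1 hj)
    have e1 : N.choose j * j.factorial * (N - j).factorial = N.factorial :=
      Nat.choose_mul_factorial_mul_factorial hj
    have e2 : (N + k).choose (k + j) * (k + j).factorial * (N - j).factorial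
        = (N + k).factorial := by
      have := Nat.choose_mul_factorial_mul_factorial (show k + j ≤ N + k by omega)
      rwa [show N + k - (k + j) = N - j by omega] at this
    have hch : N.choose j * (N + 1) ^ k ≤ k.factorial * (N + k).choose (k + j) * (j + 1) ^ k := by
      have h3 : N.choose j * (N + 1) ^ k * (j.factorial * (N - j).factorial) ≤
          k.factorial * (N + k).choose (k + j) * (j + 1) ^ k
            * (j.factorial * (N - j).factorial) := by
        calc _ = N.factorial * (N + 1) ^ k := by rw [← e1]; ring
          _ ≤ (N + k).factorial := hN
          _ = (N + k).choose (k + j) * (j + k).factorial * (N - j).factorial := by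
              rw [← e2, add_comm k j]
          _ ≤ (N + k).choose (k + j) * (k.factorial * j.factorial * (j + 1) ^ k)
              * (N - j).factorial := by
              gcongr; exact hfac j
          _ = _ := by ring
      exact Nat.le_of_mul_le_mul_right h3 (by positivity)
    have hch' : (N.choose j : ℝ) * ((N : ℝ) + 1) ^ k
        ≤ k.factorial * ((N + k).choose (k + j) : ℝ) * ((j : ℝ) + 1) ^ k := by exact_mod_cast hch
    rw [show N + k - (k + j) = N - j by omega, pow_add p k j, div_mul_eq_mul_div,
      div_le_div_iff₀ (by positivity) (by positivity)]
    have hpos : 0 ≤ p ^ k * p ^ j * q ^ (N - j) := by positivity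
    calc _ = (p ^ k * p ^ j * q ^ (N - j)) * ((N.choose j : ℝ) * ((N : ℝ) + 1) ^ k) := by ring
      _ ≤ (p ^ k * p ^ j * q ^ (N - j))
          * (k.factorial * ((N + k).choose (k + j) : ℝ) * ((j : ℝ) + 1) ^ k) := by gcongr
      _ = _ := by ring
  refine (Finset.sum_le_sum hterm).trans ?_
  rw [← Finset.mul_sum]
  refine mul_le_of_le_one_right (by positivity) ?_
  have hadd := add_pow p q (N + k)
  rw [hpq, one_pow, show N + k + 1 = k + (N + 1) by ring, Finset.sum_range_add] at hadd
  have : 0 ≤ ∑ x ∈ Finset.range k, p ^ x * q ^ (N + k - x) * ((N + k).choose x : ℝ) := by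
    positivity
  linarith

/-- Polynomials are dominated by exponentials. -/
lemma exists_pow_le_exp {lam : ℝ} (hl : 0 < lam) (p : ℕ) :
    ∃ c : ℝ, 0 < c ∧ ∀ m : ℕ, (1 + 2 * (m : ℝ)) ^ p ≤ c * Real.exp (lam * m) := by
  refine ⟨(2 / lam) ^ p * p.factorial * Real.exp (lam / 2), by positivity, fun m => ?_⟩
  have h := Real.pow_div_factorial_le_exp (lam / 2 * (1 + 2 * (m : ℝ))) (by positivity) p
  rw [div_le_iff₀ (by positivity), mul_pow] at h
  calc (1 + 2 * (m : ℝ)) ^ p = (2 / lam) ^ p * ((lam / 2) ^ p * (1 + 2 * (m : ℝ)) ^ p) := by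
        rw [← mul_assoc, ← mul_pow]; field_simp; simp
    _ ≤ (2 / lam) ^ p * (Real.exp (lam / 2 * (1 + 2 * (m : ℝ))) * p.factorial) := by gcongr
    _ = _ := by
        rw [show lam / 2 * (1 + 2 * (m : ℝ)) = lam / 2 + lam * m by ring, Real.exp_add]; ring

/-- Polynomial weights times a slow geometric growth are dominated by exponentials. -/
lemma exists_geom_le_exp {lam : ℝ} (hl : 0 < lam) (p : ℕ) :
    ∃ δ c : ℝ, 0 < δ ∧ δ ≤ 1 / 2 ∧ 0 < c ∧ ∀ m : ℕ,
      (1 + 2 * (m : ℝ)) ^ p * ((1 + δ) / (1 - δ)) ^ m ≤ c * Real.exp (lam * m) := by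
  obtain ⟨c, hc, h⟩ := exists_pow_le_exp (half_pos hl) p
  have hδ0 : 0 < min (1 / 2) (lam / 8) := by positivity
  refine ⟨min (1 / 2) (lam / 8), c, hδ0, min_le_left _ _, hc, fun m => ?_⟩
  set δ := min (1 / 2) (lam / 8) with hδ
  have h2 : δ ≤ 1 / 2 := min_le_left _ _
  have h8 : δ ≤ lam / 8 := min_le_right _ _
  have hr : (1 + δ) / (1 - δ) ≤ Real.exp (lam / 2) := by
    calc (1 + δ) / (1 - δ) ≤ 4 * δ + 1 := by
          rw [div_le_iff₀ (by linarith)]; nlinarith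
      _ ≤ Real.exp (4 * δ) := Real.add_one_le_exp _
      _ ≤ _ := Real.exp_le_exp.2 (by linarith)
  have hr0 : 0 ≤ (1 + δ) / (1 - δ) := div_nonneg (by linarith) (by linarith)
  calc _ ≤ c * Real.exp (lam / 2 * m) * Real.exp (lam / 2) ^ m := by
        gcongr; exact h m
    _ = _ := by
        rw [← Real.exp_nat_mul, mul_assoc, ← Real.exp_add]; congr 2; ring

lemma mul_le_pow_five_add_sq {a x : ℝ} (ha : 0 ≤ a) (hx : 1 ≤ x) : a * x ≤ a ^ 5 + x ^ 2 := by
  rcases le_total a x with h | h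
  · nlinarith [pow_nonneg ha 5]
  · have h1 : 1 ≤ a := hx.trans h
    have : a ^ 2 ≤ a ^ 5 := pow_le_pow_right₀ h1 (by norm_num)
    nlinarith

lemma pow_four_mul_le {a x : ℝ} (ha : 0 ≤ a) (hx : 0 ≤ x) : a ^ 4 * x ≤ a ^ 5 + x ^ 5 := by
  rcases le_total a x with h | h
  · have : a ^ 4 * x ≤ x ^ 4 * x := by gcongr
    nlinarith [pow_nonneg ha 5]
  · have : a ^ 4 * x ≤ a ^ 4 * a := by gcongr
    nlinarith [pow_nonneg hx 5]

end Elementary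

/-! ### Power series with nonnegative coefficients -/

section Mass

open PowerSeries

/-- The total mass of a power series, i.e. the sum of (the positive parts of) its coefficients. -/
noncomputable def mass (A : ℝ⟦X⟧) : ℝ≥0∞ := ∑' k, ENNReal.ofReal (coeff k A)

/-- All coefficients of the power series are nonnegative. -/
def NonnegCoeff (A : ℝ⟦X⟧) : Prop := ∀ k, 0 ≤ coeff k A

lemma NonnegCoeff.add {A B : ℝ⟦X⟧} (hA : NonnegCoeff A) (hB : NonnegCoeff B) :
    NonnegCoeff (A + B) := fun k => by
  rw [map_add]; exact add_nonneg (hA k) (hB k)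

lemma NonnegCoeff.mul {A B : ℝ⟦X⟧} (hA : NonnegCoeff A) (hB : NonnegCoeff B) :
    NonnegCoeff (A * B) := fun k => by
  rw [coeff_mul]; exact Finset.sum_nonneg fun p _ => mul_nonneg (hA _) (hB _)

lemma nonnegCoeff_C {a : ℝ} (ha : 0 ≤ a) : NonnegCoeff (C a) := fun k => by
  rw [coeff_C]; split_ifs <;> simp [ha]

lemma nonnegCoeff_one : NonnegCoeff 1 := by simpa using nonnegCoeff_C zero_le_one

lemma nonnegCoeff_X : NonnegCoeff X := fun k => by
  rw [coeff_X]; split_ifs <;> simp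

lemma NonnegCoeff.pow {A : ℝ⟦X⟧} (hA : NonnegCoeff A) (n : ℕ) : NonnegCoeff (A ^ n) := by
  induction n with
  | zero => simpa using nonnegCoeff_one
  | succ n ih => rw [pow_succ]; exact ih.mul hA

lemma nonnegCoeff_sum {ι : Type*} (s : Finset ι) {A : ι → ℝ⟦X⟧} (h : ∀ i ∈ s, NonnegCoeff (A i)) :
    NonnegCoeff (∑ i ∈ s, A i) := fun k => by
  rw [map_sum]; exact Finset.sum_nonneg fun i hi => h i hi k

lemma mass_add {A B : ℝ⟦X⟧} (hA : NonnegCoeff A) (hB : NonnegCoeff B) :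
    mass (A + B) = mass A + mass B := by
  unfold mass
  rw [← ENNReal.tsum_add]
  exact tsum_congr fun k => by rw [map_add, ENNReal.ofReal_add (hA k) (hB k)]

lemma mass_mul {A B : ℝ⟦X⟧} (hA : NonnegCoeff A) (hB : NonnegCoeff B) :
    mass (A * B) = mass A * mass B := by
  unfold mass
  rw [← ENNReal.tsum_mul_right]
  simp_rw [← ENNReal.tsum_mul_left]
  rw [← ENNReal.tsum_prod (f := fun a b => ENNReal.ofReal (coeff a A) * ENNReal.ofReal (coeff b B)),
    ← Finset.HasAntidiagonal.sigmaAntidiagonalEquivProd.tsum_eq, ENNReal.tsum_sigma']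
  refine tsum_congr fun n => ?_
  rw [coeff_mul, ENNReal.ofReal_sum_of_nonneg fun p _ => mul_nonneg (hA _) (hB _), tsum_fintype,
    ← Finset.sum_coe_sort]
  exact Finset.sum_congr rfl fun p _ => by
    simp [ENNReal.ofReal_mul (hA _)]

lemma mass_C {a : ℝ} : mass (C a) = ENNReal.ofReal a := by
  unfold mass
  rw [tsum_eq_single 0 fun k hk => by simp [coeff_C, hk]]
  simp

lemma mass_one : mass 1 = 1 := by
  have := mass_C (a := 1); simpa using this

lemma mass_X : mass X = 1 := by
  unfold mass
  rw [tsum_eq_single 1 fun k hk => by simp [coeff_X, hk]]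
  simp

lemma mass_pow {A : ℝ⟦X⟧} (hA : NonnegCoeff A) (n : ℕ) : mass (A ^ n) = mass A ^ n := by
  induction n with
  | zero => simpa using mass_one
  | succ n ih => rw [pow_succ, mass_mul (hA.pow n) hA, ih, pow_succ]

lemma mass_sum {ι : Type*} (s : Finset ι) {A : ι → ℝ⟦X⟧} (h : ∀ i ∈ s, NonnegCoeff (A i)) :
    mass (∑ i ∈ s, A i) = ∑ i ∈ s, mass (A i) := by
  induction s using Finset.cons_induction with
  | empty => simp [mass]
  | cons a s ha ih =>
    rw [Finset.sum_cons, Finset.sum_cons,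
      mass_add (h _ (by simp)) (nonnegCoeff_sum _ fun i hi => h i (by simp [hi])),
      ih fun i hi => h i (by simp [hi])]

lemma coeff_one_add_X_pow (j k : ℕ) : coeff k ((1 + X : ℝ⟦X⟧) ^ j) = (j.choose k : ℝ) := by
  have := Polynomial.coeff_one_add_X_pow ℝ j k
  rw [← this, ← Polynomial.coeff_coe]
  simp

/-- Coefficients of a product with `(1 + X) ^ j`. -/
lemma coeff_mul_one_add_X_pow (A : ℝ⟦X⟧) (j s : ℕ) :
    coeff s (A * (1 + X) ^ j) = ∑ m ∈ Finset.range (s + 1), coeff m A * binShift j s m := by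
  rw [coeff_mul, Finset.Nat.sum_antidiagonal_eq_sum_range_succ_mk]
  refine Finset.sum_congr rfl fun m hm => ?_
  rw [coeff_one_add_X_pow, binShift, if_pos (Nat.lt_succ_iff.1 (Finset.mem_range.1 hm))]

end Mass

/-! ### Conditional expectations for powers of a lattice law -/

section Core
open PowerSeries

/-- The power series whose mass bounds the fourth power of the `L⁴` norm of the conditional
expectation given a sum with a binomial component. -/
noncomputable def quarticSeries (κ g : ℕ → ℝ) (G : ℝ) (r j : ℕ) : ℝ⟦X⟧ :=
  PowerSeries.mk fun s => ((|2 * (s : ℝ) - (j + 1)| + √(j + 1)) / (j + 1)) ^ (4 * r)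
    * ∑ m ∈ Finset.range (s + 1), κ m * binShift j s m * (G + |g m|) ^ 4

lemma nonnegCoeff_quarticSeries {κ : ℕ → ℝ} (hκ : ∀ m, 0 ≤ κ m) (g : ℕ → ℝ) (G : ℝ) (r j : ℕ) :
    NonnegCoeff (quarticSeries κ g G r j) := fun s => by
  rw [quarticSeries, coeff_mk]
  refine mul_nonneg (by positivity) (Finset.sum_nonneg fun m _ => mul_nonneg
    (mul_nonneg (hκ m) (binShift_nonneg _ _ _)) (by positivity))

/-- The `4 r`-th moment of (deviation + √j) / j under a binomial law shifted by `m`. -/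
lemma sum_choose_mul_dev_le (j m r : ℕ) :
    ∑ b ∈ Finset.range (j + 1), (j.choose b : ℝ)
      * ((|2 * ((m + b : ℕ) : ℝ) - (j + 1)| + √(j + 1)) / (j + 1)) ^ (4 * r) ≤
    2 ^ (4 * r) * (2 * (4 * r).factorial + 3 ^ (4 * r)) * 2 ^ j / ((j : ℝ) + 1) ^ (2 * r)
      * (1 + 2 * (m : ℝ)) ^ (4 * r) := by
  set J : ℝ := (j : ℝ) + 1 with hJ
  have hJ1 : 1 ≤ J := by rw [hJ]; linarith [show (0 : ℝ) ≤ (j : ℝ) by positivity]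
  have hJ0 : 0 < J := by linarith
  have hs1 : 1 ≤ √J := by rw [Real.one_le_sqrt]; exact hJ1
  have hm : (0 : ℝ) ≤ m := by positivity
  have hsJ : √J ^ (4 * r) = J ^ (2 * r) := by
    rw [show 4 * r = 2 * (2 * r) by ring, pow_mul, Real.sq_sqrt hJ0.le]
  have hterm : ∀ b : ℕ, ((|2 * ((m + b : ℕ) : ℝ) - J| + √J) / J) ^ (4 * r) ≤
      2 ^ (4 * r) / J ^ (4 * r) * ((2 * (b : ℝ) - j) ^ (4 * r)
        + 3 ^ (4 * r) * (1 + 2 * (m : ℝ)) ^ (4 * r) * J ^ (2 * r)) := by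
    intro b
    have h1 : |2 * ((m + b : ℕ) : ℝ) - J| + √J ≤ |2 * (b : ℝ) - j| + 3 * (1 + 2 * m) * √J := by
      have : 2 * ((m + b : ℕ) : ℝ) - J = (2 * (b : ℝ) - j) + (2 * m - 1) := by
        rw [hJ]; push_cast; ring
      rw [this]
      have h2 : |(2 * (b : ℝ) - j) + (2 * m - 1)| ≤ |2 * (b : ℝ) - j| + (2 * m + 1) :=
        (abs_add_le _ _).trans (by
          gcongr
          rw [abs_le]; constructor <;> linarith)
      nlinarith
    rw [div_pow, div_mul_eq_mul_div, div_le_div_iff_of_pos_right (by positivity)]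
    calc _ ≤ (|2 * (b : ℝ) - j| + 3 * (1 + 2 * m) * √J) ^ (4 * r) := by gcongr
      _ ≤ 2 ^ (4 * r - 1) * (|2 * (b : ℝ) - j| ^ (4 * r) + (3 * (1 + 2 * m) * √J) ^ (4 * r)) :=
          add_pow_le (abs_nonneg _) (by positivity) _
      _ ≤ 2 ^ (4 * r) * (|2 * (b : ℝ) - j| ^ (4 * r) + (3 * (1 + 2 * m) * √J) ^ (4 * r)) := by
          gcongr
          · norm_num
          · omega
      _ = _ := by
          have hev : Even (4 * r) := ⟨2 * r, by ring⟩
          rw [hev.pow_abs, mul_pow, mul_pow, hsJ]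
  have hsum : ∑ b ∈ Finset.range (j + 1), (j.choose b : ℝ) = 2 ^ j := by
    exact_mod_cast Nat.sum_range_choose j
  have hmom := sum_choose_mul_pow_le j (2 * r)
  rw [show 2 * (2 * r) = 4 * r by ring, ← hJ] at hmom
  have hone : (1 : ℝ) ≤ (1 + 2 * (m : ℝ)) ^ (4 * r) := one_le_pow₀ (by linarith)
  calc _ ≤ ∑ b ∈ Finset.range (j + 1), (j.choose b : ℝ) * (2 ^ (4 * r) / J ^ (4 * r)
        * ((2 * (b : ℝ) - j) ^ (4 * r)
        + 3 ^ (4 * r) * (1 + 2 * (m : ℝ)) ^ (4 * r) * J ^ (2 * r))) := by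
        gcongr with b _
        exact hterm b
    _ = 2 ^ (4 * r) / J ^ (4 * r) * (∑ b ∈ Finset.range (j + 1), (j.choose b : ℝ)
          * (2 * (b : ℝ) - j) ^ (4 * r)
        + (∑ b ∈ Finset.range (j + 1), (j.choose b : ℝ))
          * (3 ^ (4 * r) * (1 + 2 * (m : ℝ)) ^ (4 * r) * J ^ (2 * r))) := by
        rw [Finset.sum_mul, ← Finset.sum_add_distrib, Finset.mul_sum]
        exact Finset.sum_congr rfl fun b _ => by ring
    _ ≤ 2 ^ (4 * r) / J ^ (4 * r) * (2 * (4 * r).factorial * 2 ^ j * J ^ (2 * r)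
          * (1 + 2 * (m : ℝ)) ^ (4 * r)
        + 2 ^ j * (3 ^ (4 * r) * (1 + 2 * (m : ℝ)) ^ (4 * r) * J ^ (2 * r))) := by
        rw [hsum]
        gcongr
        exact hmom.trans (le_mul_of_one_le_right (by positivity) hone)
    _ = _ := by
        rw [show 4 * r = 2 * r + 2 * r by ring, pow_add J]
        field_simp

lemma mass_quarticSeries_le {κ g : ℕ → ℝ} (hκ : ∀ m, 0 ≤ κ m) {G B : ℝ} {r : ℕ}
    (hs : Summable fun m => κ m * (G + |g m|) ^ 4 * (1 + 2 * (m : ℝ)) ^ (4 * r))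
    (hB : ∑' m, κ m * (G + |g m|) ^ 4 * (1 + 2 * (m : ℝ)) ^ (4 * r) ≤ B) (j : ℕ) :
    mass (quarticSeries κ g G r j) ≤ ENNReal.ofReal
      (2 ^ (4 * r) * (2 * (4 * r).factorial + 3 ^ (4 * r)) * 2 ^ j / ((j : ℝ) + 1) ^ (2 * r)
        * B) := by
  set E : ℕ → ℝ := fun s => ((|2 * (s : ℝ) - (j + 1)| + √(j + 1)) / (j + 1)) ^ (4 * r) with hE
  set c : ℝ := 2 ^ (4 * r) * (2 * (4 * r).factorial + 3 ^ (4 * r)) * 2 ^ j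
    / ((j : ℝ) + 1) ^ (2 * r) with hc
  have hE0 : ∀ s, 0 ≤ E s := fun s => by rw [hE]; positivity
  have hc0 : 0 ≤ c := by positivity
  set y : ℕ → ℝ := fun m => κ m * (G + |g m|) ^ 4 with hy
  have hy0 : ∀ m, 0 ≤ y m := fun m => mul_nonneg (hκ m) (by positivity)
  have h1 : mass (quarticSeries κ g G r j)
      = ∑' s, ∑' m, ENNReal.ofReal (y m * (binShift j s m * E s)) := by
    unfold mass
    refine tsum_congr fun s => ?_
    have hx : ∀ m, 0 ≤ y m * (binShift j s m * E s) := fun m =>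
      mul_nonneg (hy0 m) (mul_nonneg (binShift_nonneg _ _ _) (hE0 s))
    rw [quarticSeries, coeff_mk, tsum_eq_sum (s := Finset.range (s + 1)) fun m hm => by
      rw [binShift_of_lt (by simpa [Nat.lt_succ_iff] using hm)]; simp,
      ← ENNReal.ofReal_sum_of_nonneg fun m _ => hx m, Finset.mul_sum]
    congr 1
    exact Finset.sum_congr rfl fun m _ => by rw [hy]; ring
  rw [h1, ENNReal.tsum_comm]
  have h2 : ∀ m, ∑' s, ENNReal.ofReal (y m * (binShift j s m * E s))
      ≤ ENNReal.ofReal (c * (y m * (1 + 2 * (m : ℝ)) ^ (4 * r))) := by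
    intro m
    have h3 : ∑' s, ENNReal.ofReal (y m * (binShift j s m * E s))
        = ∑ b ∈ Finset.range (j + 1), ENNReal.ofReal (y m * ((j.choose b : ℝ) * E (m + b))) := by
      rw [tsum_eq_sum (s := (Finset.range (j + 1)).map (addLeftEmbedding m))]
      · rw [Finset.sum_map]
        refine Finset.sum_congr rfl fun b _ => ?_
        simp [binShift]
      · intro s hs
        have : binShift j s m = 0 := by
          unfold binShift
          split_ifs with h
          · rw [Nat.choose_eq_zero_of_lt, Nat.cast_zero]
            by_contra hlt
            exact hs (Finset.mem_map.2 ⟨s - m, Finset.mem_range.2 (by omega), by simp; omega⟩)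
          · rfl
        simp [this]
    rw [h3, ← ENNReal.ofReal_sum_of_nonneg fun b _ =>
      mul_nonneg (hy0 m) (mul_nonneg (by positivity) (hE0 _)), ← Finset.mul_sum]
    refine ENNReal.ofReal_le_ofReal ?_
    calc _ ≤ y m * (c * (1 + 2 * (m : ℝ)) ^ (4 * r)) :=
          mul_le_mul_of_nonneg_left (sum_choose_mul_dev_le j m r) (hy0 m)
      _ = _ := by ring
  refine (ENNReal.tsum_le_tsum h2).trans ?_
  have hz0 : ∀ m, 0 ≤ c * (y m * (1 + 2 * (m : ℝ)) ^ (4 * r)) := fun m =>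
    mul_nonneg hc0 (mul_nonneg (hy0 m) (by positivity))
  rw [← ENNReal.ofReal_tsum_of_nonneg hz0 (hs.mul_left c), tsum_mul_left]
  exact ENNReal.ofReal_le_ofReal (mul_le_mul_of_nonneg_left hB hc0)

/-- Moment bounds by Young's inequality: with exponential moments of `κ`, the fifth moment of `g`
controls the weighted first and fourth moments. -/
lemma exists_young_bounds {κ : ℕ → ℝ} (hκ : ∀ m, 0 ≤ κ m) {lam : ℝ} (hl : 0 < lam)
    (hexp : Summable fun m => κ m * Real.exp (lam * m)) (r : ℕ) :
    ∃ δ A B : ℝ, 0 < δ ∧ δ ≤ 1 / 2 ∧ 0 < A ∧ 0 < B ∧ ∀ (g : ℕ → ℝ) (G : ℝ), 0 < G →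
      (Summable fun m => κ m * |g m| ^ 5) → ∑' m, κ m * |g m| ^ 5 ≤ G ^ 5 →
      ((Summable fun m => κ m * |g m| * ((1 + 2 * m) ^ (2 * r) * ((1 + δ) / (1 - δ)) ^ m)) ∧
        ∑' m, κ m * |g m| * ((1 + 2 * m) ^ (2 * r) * ((1 + δ) / (1 - δ)) ^ m) ≤ A * G) ∧
      ((Summable fun m => κ m * (G + |g m|) ^ 4 * (1 + 2 * (m : ℝ)) ^ (4 * r)) ∧
        ∑' m, κ m * (G + |g m|) ^ 4 * (1 + 2 * (m : ℝ)) ^ (4 * r) ≤ B * G ^ 4) := by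
  obtain ⟨δ, c, hδ0, hδ, hc, hw⟩ := exists_geom_le_exp (half_pos hl) (2 * r)
  obtain ⟨c', hc', hw'⟩ := exists_pow_le_exp hl (5 * (4 * r))
  set Z := ∑' m, κ m * Real.exp (lam * m) with hZ
  have hZ0 : 0 ≤ Z := tsum_nonneg fun m => mul_nonneg (hκ m) (Real.exp_pos _).le
  have hρ : 1 ≤ (1 + δ) / (1 - δ) := by rw [le_div_iff₀ (by linarith)]; linarith
  have hm1 : ∀ m : ℕ, (1 : ℝ) ≤ 1 + 2 * (m : ℝ) := fun m => by
    linarith [show (0 : ℝ) ≤ (m : ℝ) by positivity]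
  refine ⟨δ, 1 + c ^ 2 * Z, 8 * (1 + 2 * c' * Z), hδ0, hδ, by positivity, by positivity,
    fun g G hG hs hle => ⟨?_, ?_⟩⟩
  · have hb : ∀ m, κ m * |g m| * ((1 + 2 * (m : ℝ)) ^ (2 * r) * ((1 + δ) / (1 - δ)) ^ m) ≤
        (G ^ 4)⁻¹ * (κ m * |g m| ^ 5) + G * c ^ 2 * (κ m * Real.exp (lam * m)) := by
      intro m
      set w := (1 + 2 * (m : ℝ)) ^ (2 * r) * ((1 + δ) / (1 - δ)) ^ m with hwd
      have hw1 : 1 ≤ w := one_le_mul_of_one_le_of_one_le (one_le_pow₀ (hm1 m)) (one_le_pow₀ hρ)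
      have hw2 : w ^ 2 ≤ c ^ 2 * Real.exp (lam * m) := by
        calc w ^ 2 ≤ (c * Real.exp (lam / 2 * m)) ^ 2 := by
              gcongr; exact hw m
          _ = _ := by
              rw [mul_pow, ← Real.exp_nat_mul]; congr 2; push_cast; ring
      have hy := mul_le_pow_five_add_sq (a := |g m| / G) (by positivity) hw1
      calc κ m * |g m| * w = κ m * G * (|g m| / G * w) := by field_simp
        _ ≤ κ m * G * ((|g m| / G) ^ 5 + c ^ 2 * Real.exp (lam * m)) := by
            refine mul_le_mul_of_nonneg_left (hy.trans (by gcongr)) (mul_nonneg (hκ m) hG.le)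
        _ = _ := by field_simp
    have hsum := (hs.mul_left ((G ^ 4)⁻¹)).add (hexp.mul_left (G * c ^ 2))
    have h0 : ∀ m, 0 ≤ κ m * |g m| * ((1 + 2 * (m : ℝ)) ^ (2 * r) * ((1 + δ) / (1 - δ)) ^ m) :=
      fun m => mul_nonneg (mul_nonneg (hκ m) (abs_nonneg _)) (by positivity)
    have hS := Summable.of_nonneg_of_le h0 hb hsum
    refine ⟨hS, (hS.tsum_le_tsum hb hsum).trans ?_⟩
    rw [(hs.mul_left _).tsum_add (hexp.mul_left _), tsum_mul_left, tsum_mul_left, ← hZ]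
    have : (G ^ 4)⁻¹ * ∑' m, κ m * |g m| ^ 5 ≤ (G ^ 4)⁻¹ * G ^ 5 := by gcongr
    have e : (G ^ 4)⁻¹ * G ^ 5 = G := by field_simp
    rw [e] at this
    linarith
  · have hb : ∀ m, κ m * (G + |g m|) ^ 4 * (1 + 2 * (m : ℝ)) ^ (4 * r) ≤
        8 * G⁻¹ * (κ m * |g m| ^ 5) + 8 * G ^ 4 * (2 * c') * (κ m * Real.exp (lam * m)) := by
      intro m
      set w := (1 + 2 * (m : ℝ)) ^ (4 * r) with hwd
      have hw1 : 1 ≤ w := one_le_pow₀ (hm1 m)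
      have hw5 : w ^ 5 ≤ c' * Real.exp (lam * m) := by
        rw [hwd, ← pow_mul, mul_comm (4 * r) 5]; exact hw' m
      have hww : w ≤ c' * Real.exp (lam * m) := (le_self_pow₀ hw1 (by norm_num)).trans hw5
      have hy := pow_four_mul_le (a := |g m| / G) (by positivity) (by positivity : 0 ≤ w)
      have h4 : (1 + |g m| / G) ^ 4 ≤ 8 * (1 + (|g m| / G) ^ 4) := by
        have := add_pow_le (a := (1 : ℝ)) (b := |g m| / G) zero_le_one (by positivity) 4
        norm_num at this ⊢; exact this
      calc κ m * (G + |g m|) ^ 4 * w = κ m * G ^ 4 * ((1 + |g m| / G) ^ 4 * w) := by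
            field_simp
        _ ≤ κ m * G ^ 4 * (8 * (1 + (|g m| / G) ^ 4) * w) := by
            refine mul_le_mul_of_nonneg_left ?_ (mul_nonneg (hκ m) (by positivity))
            gcongr
        _ = κ m * G ^ 4 * (8 * (w + (|g m| / G) ^ 4 * w)) := by ring
        _ ≤ κ m * G ^ 4 * (8 * (c' * Real.exp (lam * m)
              + ((|g m| / G) ^ 5 + c' * Real.exp (lam * m)))) := by
            refine mul_le_mul_of_nonneg_left ?_ (mul_nonneg (hκ m) (by positivity))
            gcongr
            exact hy.trans (by gcongr)
        _ = _ := by field_simp; ring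
    have hsum := (hs.mul_left (8 * G⁻¹)).add (hexp.mul_left (8 * G ^ 4 * (2 * c')))
    have h0 : ∀ m, 0 ≤ κ m * (G + |g m|) ^ 4 * (1 + 2 * (m : ℝ)) ^ (4 * r) :=
      fun m => mul_nonneg (mul_nonneg (hκ m) (by positivity)) (by positivity)
    have hS := Summable.of_nonneg_of_le h0 hb hsum
    refine ⟨hS, (hS.tsum_le_tsum hb hsum).trans ?_⟩
    rw [(hs.mul_left _).tsum_add (hexp.mul_left _), tsum_mul_left, tsum_mul_left, ← hZ]
    have : 8 * G⁻¹ * ∑' m, κ m * |g m| ^ 5 ≤ 8 * G⁻¹ * G ^ 5 := by gcongr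
    have e : 8 * G⁻¹ * G ^ 5 = 8 * G ^ 4 := by field_simp
    rw [e] at this
    linarith

lemma coeff_add_mul_pos {A B : ℝ⟦X⟧} {a b : ℕ} (hA : NonnegCoeff A) (hB : NonnegCoeff B)
    (ha : 0 < coeff a A) (hb : 0 < coeff b B) : 0 < coeff (a + b) (A * B) := by
  rw [coeff_mul]
  exact Finset.sum_pos' (fun p _ => mul_nonneg (hA _) (hB _)) ⟨(a, b), by simp, mul_pos ha hb⟩

/-- If the support of the law `M` contains `0` and has greatest common divisor `1`, some power of
`M` charges two consecutive integers, so it splits off a multiple of a shifted fair Bernoulli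
law. -/
lemma exists_bernoulli_part {M : ℝ⟦X⟧} (hM : NonnegCoeff M) (h0 : 0 < coeff 0 M)
    (hgcd : Nat.setGcd {k | 0 < coeff k M} = 1) :
    ∃ (N A : ℕ) (θ : ℝ) (K : ℝ⟦X⟧), 0 < N ∧ 0 < θ ∧ NonnegCoeff K ∧
      M ^ N = C θ * X ^ A * (1 + X) + K := by
  -- As `0` is charged, the supports of the powers increase, and they exhaust the generated monoid.
  have hcl : ∀ a ∈ AddSubmonoid.closure {k | 0 < coeff k M},
      ∃ N, ∀ N' ≥ N, 0 < coeff a (M ^ N') := by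
    have hpow0 : ∀ n, 0 < coeff 0 (M ^ n) := by
      intro n
      induction n with
      | zero => simp
      | succ n ih => rw [pow_succ]; exact coeff_add_mul_pos (a := 0) (b := 0) (hM.pow n) hM ih h0
    intro a ha
    induction ha using AddSubmonoid.closure_induction with
    | mem x hx =>
      refine ⟨1, fun N' hN => ?_⟩
      obtain ⟨k, rfl⟩ := Nat.exists_eq_add_of_le hN
      rw [pow_add, pow_one, ← add_zero x]
      exact coeff_add_mul_pos hM (hM.pow k) hx (hpow0 k)
    | zero => exact ⟨0, fun N' _ => hpow0 N'⟩
    | add x y _ _ hx hy =>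
      obtain ⟨N1, h1⟩ := hx
      obtain ⟨N2, h2⟩ := hy
      refine ⟨N1 + N2, fun N' hN => ?_⟩
      obtain ⟨k, rfl⟩ := Nat.exists_eq_add_of_le hN
      rw [add_assoc, pow_add]
      exact coeff_add_mul_pos (hM.pow _) (hM.pow _) (h1 _ le_rfl) (h2 _ (by omega))
  obtain ⟨A, hA⟩ := Nat.exists_mem_closure_of_ge {k | 0 < coeff k M}
  rw [hgcd] at hA
  obtain ⟨N1, h1⟩ := hcl A (hA A le_rfl (one_dvd _))
  obtain ⟨N2, h2⟩ := hcl (A + 1) (hA (A + 1) (by omega) (one_dvd _))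
  set N := N1 + N2 + 1 with hN
  have p1 := h1 N (by omega)
  have p2 := h2 N (by omega)
  set θ := min (coeff A (M ^ N)) (coeff (A + 1) (M ^ N)) with hθ
  have hθl : θ ≤ coeff A (M ^ N) := min_le_left _ _
  have hθr : θ ≤ coeff (A + 1) (M ^ N) := min_le_right _ _
  refine ⟨N, A, θ, M ^ N - C θ * X ^ A * (1 + X), by omega, lt_min p1 p2, fun k => ?_,
    by ring⟩
  have hcoe : coeff k (C θ * X ^ A * (1 + X)) = if A ≤ k then θ * ((1 : ℕ).choose (k - A) : ℝ)
      else 0 := by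
    rw [mul_assoc, coeff_C_mul, coeff_X_pow_mul']
    have := coeff_one_add_X_pow 1 (k - A)
    rw [pow_one] at this
    rw [this]; split_ifs <;> simp
  rw [map_sub, hcoe, sub_nonneg]
  split_ifs with h
  · obtain ⟨i, rfl⟩ := Nat.exists_eq_add_of_le h
    rw [Nat.add_sub_cancel_left]
    match i with
    | 0 => simpa using hθl
    | 1 => simpa using hθr
    | i + 2 =>
      rw [Nat.choose_eq_zero_of_lt (by omega)]; simpa using hM.pow N _
  · exact hM.pow N k

/-- **Canonical expectations of functions orthogonal to polynomials.** `M` is the law of one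
variable, `n` of which are summed; `F` is the signed law of the sum of `l` of them under a density
whose conditional expectation given that sum is `g`. If `F` annihilates the polynomials of
degree `< r ≤ 3`, the conditional expectation given the sum of all `n` variables has `L⁴` norm
`O (n ^ (-r / 2))`. -/
theorem exists_quartic_bound {M : ℝ⟦X⟧} (hM : NonnegCoeff M) (h0 : 0 < coeff 0 M)
    (hmass : mass M = 1) (hgcd : Nat.setGcd {k | 0 < coeff k M} = 1)
    {lam : ℝ} (hl : 0 < lam) (hexp : mass (rescale (Real.exp lam) M) ≠ ∞) (l r : ℕ) (hr : r ≤ 3) :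
    ∃ C : ℝ, 0 < C ∧ ∀ (F : ℝ⟦X⟧) (g : ℕ → ℝ) (G : ℝ), 0 < G →
      (∀ k, coeff k F = coeff k (M ^ l) * g k) →
      (Summable fun k => coeff k (M ^ l) * |g k| ^ 5) →
      ∑' k, coeff k (M ^ l) * |g k| ^ 5 ≤ G ^ 5 →
      (∀ i < r, ∑' k, coeff k F * (k.choose i : ℝ) = 0) →
      ∀ n, l ≤ n → 1 ≤ n →
        ∑' t, ENNReal.ofReal (|coeff t (F * M ^ (n - l))| ^ 4 / coeff t (M ^ n) ^ 3) ≤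
          ENNReal.ofReal (C * G ^ 4 / (n : ℝ) ^ (2 * r)) := by
  obtain ⟨b, A, θ, K, hb, hθ, hK, hMb⟩ := exists_bernoulli_part hM h0 hgcd
  set κ : ℕ → ℝ := fun m => coeff m (M ^ l) with hκd
  have hκ : ∀ m, 0 ≤ κ m := hM.pow l
  have hκ0 : 0 < κ 0 := by
    rw [hκd]; simp only [coeff_zero_eq_constantCoeff, map_pow] at h0 ⊢; exact pow_pos h0 l
  have hκs : Summable fun m => κ m * Real.exp (lam * m) := by
    have hR : NonnegCoeff (rescale (Real.exp lam) M) := fun k => by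
      rw [coeff_rescale]; exact mul_nonneg (by positivity) (hM k)
    have h1 : mass (rescale (Real.exp lam) (M ^ l)) ≠ ∞ := by
      rw [map_pow, mass_pow hR]; exact ENNReal.pow_ne_top hexp
    unfold mass at h1
    have h2 := ENNReal.summable_toReal h1
    refine h2.congr fun m => ?_
    rw [coeff_rescale, ENNReal.toReal_ofReal (mul_nonneg (by positivity) (hκ m)),
      ← Real.exp_nat_mul, mul_comm, mul_comm lam]
  obtain ⟨δ, A1, B1, hδ0, hδ, hA1, hB1, hY⟩ := exists_young_bounds hκ hl hκs r
  obtain ⟨k, hk0, hmK, hpk⟩ : ∃ k : ℝ, 0 ≤ k ∧ mass K = ENNReal.ofReal k ∧ 2 * θ + k = 1 := by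
    have h1 : mass (M ^ b) = 1 := by rw [mass_pow hM, hmass, one_pow]
    have hn1 : NonnegCoeff (C θ * X ^ A) := (nonnegCoeff_C hθ.le).mul (nonnegCoeff_X.pow A)
    have hn2 : NonnegCoeff (1 + X) := nonnegCoeff_one.add nonnegCoeff_X
    rw [hMb, mass_add (hn1.mul hn2) hK, mass_mul hn1 hn2,
      mass_mul (nonnegCoeff_C hθ.le) (nonnegCoeff_X.pow A), mass_pow nonnegCoeff_X, mass_X,
      mass_add nonnegCoeff_one nonnegCoeff_X, mass_one, mass_X, mass_C, one_pow, mul_one,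
      one_add_one_eq_two] at h1
    have hKt : mass K ≠ ∞ := by
      intro h; rw [h] at h1; simp at h1
    refine ⟨(mass K).toReal, ENNReal.toReal_nonneg, (ENNReal.ofReal_toReal hKt).symm, ?_⟩
    have h2 := congrArg ENNReal.toReal h1
    rw [ENNReal.toReal_add (by finiteness) hKt, ENNReal.toReal_mul,
      ENNReal.toReal_ofReal hθ.le] at h2
    simp at h2
    linarith
  set C1 : ℝ := 2080 * A1 / κ 0 + (1 / δ) ^ r with hC1
  have hC10 : 0 < C1 := by positivity
  set cr : ℝ := 2 ^ (4 * r) * (2 * (4 * r).factorial + 3 ^ (4 * r)) with hcr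
  have hcr0 : 0 < cr := by positivity
  refine ⟨C1 ^ 4 * cr * B1 * ((2 * r).factorial / (2 * θ) ^ (2 * r)) * (b * (l + 1)) ^ (2 * r),
    by positivity, fun F g G hG hF hgs hgG hz n hln hn => ?_⟩
  obtain ⟨⟨hs1, hA⟩, hs2, hB⟩ := hY g G hG hgs hgG
  -- `M ^ (n - l)` is a mixture over `j` of `D j * (1 + X) ^ j`.
  set N := (n - l) / b with hN
  set D : ℕ → ℝ⟦X⟧ := fun j =>
    C ((N.choose j : ℝ) * θ ^ j) * X ^ (A * j) * K ^ (N - j) * M ^ ((n - l) % b) with hD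
  have hDn : ∀ j, NonnegCoeff (D j) := fun j =>
    (((nonnegCoeff_C (by positivity)).mul (nonnegCoeff_X.pow _)).mul (hK.pow _)).mul (hM.pow _)
  have hDm : ∀ j, mass (D j) = ENNReal.ofReal ((N.choose j : ℝ) * θ ^ j * k ^ (N - j)) := by
    intro j
    have e1 : NonnegCoeff (C ((N.choose j : ℝ) * θ ^ j)) := nonnegCoeff_C (by positivity)
    have e2 := e1.mul (nonnegCoeff_X.pow (A * j))
    simp only [hD]
    rw [mass_mul (e2.mul (hK.pow _)) (hM.pow _), mass_mul e2 (hK.pow _),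
      mass_mul e1 (nonnegCoeff_X.pow _), mass_pow hM, mass_pow hK, mass_pow nonnegCoeff_X,
      mass_X, hmass, one_pow, one_pow, mul_one, mul_one, mass_C, hmK, ← ENNReal.ofReal_pow hk0,
      ← ENNReal.ofReal_mul (by positivity)]
  have hdec : M ^ (n - l) = ∑ j ∈ Finset.range (N + 1), D j * (1 + X) ^ j := by
    conv_lhs => rw [← Nat.div_add_mod (n - l) b, pow_add, pow_mul, hMb, add_pow, Finset.sum_mul]
    refine Finset.sum_congr rfl fun j _ => ?_
    simp only [hD, mul_pow, map_mul, map_pow, map_natCast, pow_mul, ← hN]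
    ring
  have hMn : M ^ n = ∑ j ∈ Finset.range (N + 1), D j * (M ^ l * (1 + X) ^ j) := by
    rw [← Nat.add_sub_cancel' hln, pow_add, hdec, Finset.mul_sum]
    exact Finset.sum_congr rfl fun j _ => by ring
  have hFM : F * M ^ (n - l) = ∑ j ∈ Finset.range (N + 1), D j * (F * (1 + X) ^ j) := by
    rw [hdec, Finset.mul_sum]
    exact Finset.sum_congr rfl fun j _ => by ring
  set U : ℕ → ℝ⟦X⟧ := fun j => C (C1 ^ 4) * quarticSeries κ g G r j with hU
  have hUn : ∀ j, NonnegCoeff (U j) := fun j =>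
    (nonnegCoeff_C (by positivity)).mul (nonnegCoeff_quarticSeries hκ g G r j)
  -- The estimate for a single binomial component,
  have hloc : ∀ j s, |coeff s (F * (1 + X) ^ j)| ^ 4
      ≤ coeff s (M ^ l * (1 + X) ^ j) ^ 3 * coeff s (U j) := by
    intro j s
    have hz' : ∀ i < r, ∑' m, κ m * g m * (m.choose i : ℝ) = 0 := fun i hi => by
      rw [← hz i hi]; exact tsum_congr fun m => by rw [hF]
    have hp := abs_sum_mul_binShift_le hκ hκ0 hr hδ0 hδ A1 hG hs1 hA hz' j s
    have hq := sum_pow_four_le (Finset.range (s + 1)) (w := fun m => κ m * binShift j s m)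
      (V := fun m => G + |g m|) (P := fun _ => 1) (U := fun m => (G + |g m|) ^ 4)
      (fun m _ => mul_nonneg (hκ m) (binShift_nonneg _ _ _)) (fun _ _ => zero_le_one)
      (fun m _ => by positivity) (fun m _ => by simp)
    rw [coeff_mul_one_add_X_pow, coeff_mul_one_add_X_pow, hU]
    simp only [mul_one] at hq
    rw [coeff_C_mul, quarticSeries, coeff_mk, Finset.sum_congr rfl fun m _ => by rw [hF m]]
    refine (pow_le_pow_left₀ (abs_nonneg _) hp 4).trans ?_
    rw [mul_pow, mul_pow, ← hC1, ← pow_mul, mul_comm r 4]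
    refine (mul_le_mul_of_nonneg_left hq (by positivity)).trans_eq ?_
    ring
  -- and for the mixture, by Hölder's inequality.
  have hglob : ∀ t, |coeff t (F * M ^ (n - l))| ^ 4 / coeff t (M ^ n) ^ 3
      ≤ coeff t (∑ j ∈ Finset.range (N + 1), D j * U j) := by
    intro t
    set I := Finset.range (N + 1) ×ˢ Finset.HasAntidiagonal.antidiagonal t with hI
    have hexpand : ∀ W : ℕ → ℝ⟦X⟧, coeff t (∑ j ∈ Finset.range (N + 1), D j * W j)
        = ∑ i ∈ I, coeff i.2.1 (D i.1) * coeff i.2.2 (W i.1) := by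
      intro W
      rw [map_sum, hI, Finset.sum_product]
      exact Finset.sum_congr rfl fun j _ => by rw [coeff_mul]
    have h1 := sum_pow_four_le I (w := fun i => coeff i.2.1 (D i.1))
      (V := fun i => |coeff i.2.2 (F * (1 + X) ^ i.1)|)
      (P := fun i => coeff i.2.2 (M ^ l * (1 + X) ^ i.1)) (U := fun i => coeff i.2.2 (U i.1))
      (fun i _ => hDn _ _)
      (fun i _ => (hM.pow l).mul ((nonnegCoeff_one.add nonnegCoeff_X).pow _) _)
      (fun i _ => hUn _ _) (fun i _ => hloc _ _)
    have h2 : |coeff t (F * M ^ (n - l))|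
        ≤ ∑ i ∈ I, coeff i.2.1 (D i.1) * |coeff i.2.2 (F * (1 + X) ^ i.1)| := by
      rw [hFM, hexpand fun j => F * (1 + X) ^ j]
      refine (Finset.abs_sum_le_sum_abs _ _).trans (Finset.sum_le_sum fun i _ => ?_)
      rw [abs_mul, abs_of_nonneg (hDn _ _)]
    rw [← hexpand fun j => M ^ l * (1 + X) ^ j, ← hMn, ← hexpand U] at h1
    have hUt : 0 ≤ coeff t (∑ j ∈ Finset.range (N + 1), D j * U j) :=
      nonnegCoeff_sum _ (fun j _ => (hDn j).mul (hUn j)) t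
    rcases (hM.pow n t).eq_or_lt with h | h
    · rw [← h]; simpa using hUt
    · rw [div_le_iff₀ (by positivity), mul_comm (coeff t (∑ j ∈ _, _))]
      exact (pow_le_pow_left₀ (abs_nonneg _) h2 4).trans h1
  have hmU : ∀ j, mass (U j) ≤ ENNReal.ofReal
      (C1 ^ 4 * (cr * 2 ^ j / ((j : ℝ) + 1) ^ (2 * r) * (B1 * G ^ 4))) := by
    intro j
    rw [hU, mass_mul (nonnegCoeff_C (by positivity)) (nonnegCoeff_quarticSeries hκ g G r j), mass_C,
      ENNReal.ofReal_mul (by positivity)]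
    gcongr
    exact mass_quarticSeries_le hκ hs2 hB j
  have hNn : (n : ℝ) ≤ (N + 1) * (b * (l + 1)) := by
    have h1 : n - l < b * (N + 1) := Nat.lt_mul_div_succ _ hb
    have h2 : n ≤ (N + 1) * (b * (l + 1)) := by
      have h3 : 1 ≤ b * (N + 1) := Nat.mul_pos hb N.succ_pos
      have h4 : l ≤ b * (N + 1) * l := Nat.le_mul_of_pos_left _ h3
      calc n ≤ b * (N + 1) + l := by omega
        _ ≤ b * (N + 1) + b * (N + 1) * l := by omega
        _ = _ := by ring
    exact_mod_cast h2
  calc _ ≤ ∑' t, ENNReal.ofReal (coeff t (∑ j ∈ Finset.range (N + 1), D j * U j)) :=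
        ENNReal.tsum_le_tsum fun t => ENNReal.ofReal_le_ofReal (hglob t)
    _ = ∑ j ∈ Finset.range (N + 1), mass (D j) * mass (U j) := by
        rw [← mass, mass_sum _ fun j _ => (hDn j).mul (hUn j)]
        exact Finset.sum_congr rfl fun j _ => mass_mul (hDn j) (hUn j)
    _ ≤ ∑ j ∈ Finset.range (N + 1), ENNReal.ofReal (C1 ^ 4 * cr * (B1 * G ^ 4) *
          ((N.choose j : ℝ) * (2 * θ) ^ j * k ^ (N - j) / ((j : ℝ) + 1) ^ (2 * r))) := by
        refine Finset.sum_le_sum fun j _ => ?_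
        refine (mul_le_mul_right (hmU j) _).trans ?_
        rw [hDm, ← ENNReal.ofReal_mul (by positivity)]
        refine ENNReal.ofReal_le_ofReal (le_of_eq ?_)
        rw [mul_pow]; ring
    _ ≤ _ := by
        rw [← ENNReal.ofReal_sum_of_nonneg fun j _ => by positivity, ← Finset.mul_sum]
        refine ENNReal.ofReal_le_ofReal ?_
        have h1 := sum_choose_div_pow_le (p := 2 * θ) (by positivity) hk0 hpk N (2 * r)
        have h2 : 1 / ((N : ℝ) + 1) ^ (2 * r)
            ≤ (b * ((l : ℝ) + 1)) ^ (2 * r) / (n : ℝ) ^ (2 * r) := by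
          rw [div_le_div_iff₀ (by positivity) (by positivity), one_mul, ← mul_pow]
          gcongr
          linarith
        calc _ ≤ C1 ^ 4 * cr * (B1 * G ^ 4) * (((2 * r).factorial / (2 * θ) ^ (2 * r))
              * (1 / ((N : ℝ) + 1) ^ (2 * r))) := by
              refine mul_le_mul_of_nonneg_left (h1.trans_eq ?_) (by positivity)
              field_simp
          _ ≤ C1 ^ 4 * cr * (B1 * G ^ 4) * (((2 * r).factorial / (2 * θ) ^ (2 * r))
              * ((b * ((l : ℝ) + 1)) ^ (2 * r) / (n : ℝ) ^ (2 * r))) := by gcongr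
          _ = _ := by ring

end Core

/-! ### Generating series of local functions -/

section Product

variable (μ : Measure ℕ) [IsProbabilityMeasure μ]

instance : IsProbabilityMeasure (prodMeasure μ) := by
  unfold prodMeasure; infer_instance

/-- Disjoint sets of sites are independent. -/
lemma indepFun_domRestrict {S T : Set ℤ} (h : Disjoint S T) :
    IndepFun (S.domRestrict (π := fun _ : ℤ => ℕ)) (T.domRestrict (π := fun _ : ℤ => ℕ))
      (prodMeasure μ) := by
  have hi : iIndepFun (fun (i : ℤ) (η : Config) => η i) (prodMeasure μ) :=
    iIndepFun_infinitePi (P := fun _ : ℤ => μ) (X := fun _ k => k) fun _ => measurable_id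
  rw [iIndepFun_iff_iIndep] at hi
  have hc : ∀ S : Set ℤ, MeasurableSpace.comap (S.domRestrict (π := fun _ : ℤ => ℕ)) inferInstance
      = ⨆ i ∈ S, MeasurableSpace.comap (fun η : Config => η i) inferInstance := by
    intro S
    rw [MeasurableSpace.pi, MeasurableSpace.comap_iSup, iSup_subtype']
    refine iSup_congr fun i => ?_
    rw [MeasurableSpace.comap_comp]
    rfl
  rw [IndepFun_iff_Indep, hc, hc]
  exact indep_iSup_of_disjoint (fun i => (measurable_pi_apply i).comap_le) hi h

variable {μ}

lemma measurable_of_dependsOn {β : Type*} [MeasurableSpace β] [Nonempty β] {f : Config → β}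
    {Δ : Finset ℤ} (hf : DependsOn f (Δ : Set ℤ)) : Measurable f := by
  obtain ⟨g, rfl⟩ := dependsOn_iff_exists_comp.1 hf
  exact (measurable_of_countable g).comp (by fun_prop)

lemma integral_mul_of_dependsOn {f h : Config → ℝ} {Δ Δ' : Finset ℤ} (hd : Disjoint Δ Δ')
    (hf : DependsOn f (Δ : Set ℤ)) (hh : DependsOn h (Δ' : Set ℤ)) :
    ∫ η, f η * h η ∂(prodMeasure μ) = (∫ η, f η ∂(prodMeasure μ)) * ∫ η, h η ∂(prodMeasure μ) := by
  have h1 := measurable_of_dependsOn hf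
  have h2 := measurable_of_dependsOn hh
  obtain ⟨f', rfl⟩ := dependsOn_iff_exists_comp.1 hf
  obtain ⟨h', rfl⟩ := dependsOn_iff_exists_comp.1 hh
  have := (indepFun_domRestrict μ (Finset.disjoint_coe.2 hd)).comp (measurable_of_countable f')
    (measurable_of_countable h')
  exact this.integral_fun_mul_eq_mul_integral h1.aestronglyMeasurable h2.aestronglyMeasurable

lemma integral_site (h : ℕ → ℝ) (x : ℤ) :
    ∫ η, h (η x) ∂(prodMeasure μ) = ∫ k, h k ∂μ := by
  have h1 := (measurePreserving_eval_infinitePi (fun _ : ℤ => μ) x).map_eq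
  have h2 := integral_map (μ := Measure.infinitePi fun _ : ℤ => μ)
    (measurable_pi_apply x).aemeasurable (measurable_of_countable h).aestronglyMeasurable
  erw [h1] at h2
  exact h2.symm

/-- The sum of `ξ (η x)` over the sites of `Λ`. -/
def siteSum (ξ : ℕ → ℕ) (Λ : Finset ℤ) (η : Config) : ℕ := ∑ x ∈ Λ, ξ (η x)

lemma dependsOn_siteSum (ξ : ℕ → ℕ) (Λ : Finset ℤ) : DependsOn (siteSum ξ Λ) (Λ : Set ℤ) :=
  fun _ _ h => Finset.sum_congr rfl fun x hx => by rw [h x hx]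

lemma measurable_siteSum (ξ : ℕ → ℕ) (Λ : Finset ℤ) : Measurable (siteSum ξ Λ) :=
  measurable_of_dependsOn (dependsOn_siteSum ξ Λ)

lemma measurableSet_siteSum_eq (ξ : ℕ → ℕ) (Λ : Finset ℤ) (t : ℕ) :
    MeasurableSet {η | siteSum ξ Λ η = t} :=
  measurable_siteSum ξ Λ (measurableSet_singleton t)

variable (μ) in
/-- The generating series of the signed law of `siteSum ξ Λ` under the density `f`. -/
noncomputable def sumSeries (ξ : ℕ → ℕ) (f : Config → ℝ) (Λ : Finset ℤ) : PowerSeries ℝ :=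
  PowerSeries.mk fun t => ∫ η in {η | siteSum ξ Λ η = t}, f η ∂(prodMeasure μ)

variable (μ) in
/-- The generating series of the law of `ξ` at one site. -/
noncomputable def siteSeries (ξ : ℕ → ℕ) : PowerSeries ℝ :=
  PowerSeries.mk fun t => μ.real (ξ ⁻¹' {t})

lemma sumSeries_insert (ξ : ℕ → ℕ) {f : Config → ℝ} {Λ : Finset ℤ} {x : ℤ} (hx : x ∉ Λ)
    (hf : DependsOn f (Λ : Set ℤ)) (hi : Integrable f (prodMeasure μ)) :
    sumSeries μ ξ f (insert x Λ) = sumSeries μ ξ f Λ * siteSeries μ ξ := by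
  ext t
  rw [PowerSeries.coeff_mul]
  simp only [sumSeries, siteSeries, PowerSeries.coeff_mk]
  have hset : {η : Config | siteSum ξ (insert x Λ) η = t}
      = ⋃ p ∈ Finset.HasAntidiagonal.antidiagonal t,
        {η | siteSum ξ Λ η = p.1} ∩ {η | ξ (η x) = p.2} := by
    ext η
    simp only [siteSum, Finset.sum_insert hx, Set.mem_ofPred_eq, Set.mem_iUnion, Set.mem_inter_iff,
      Finset.HasAntidiagonal.mem_antidiagonal, exists_prop, Prod.exists]
    constructor
    · intro h; exact ⟨_, _, by rw [add_comm]; exact h, rfl, rfl⟩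
    · rintro ⟨a, b, h, rfl, rfl⟩; rw [add_comm]; exact h
  have hmx : ∀ b, MeasurableSet {η : Config | ξ (η x) = b} := fun b =>
    (measurable_of_countable ξ).comp (measurable_pi_apply x) (measurableSet_singleton b)
  rw [hset, integral_biUnion_finset _ (fun p _ => (measurableSet_siteSum_eq ξ Λ _).inter (hmx _))
    (fun p _ q _ hpq => ?_) (fun p _ => hi.integrableOn)]
  · refine Finset.sum_congr rfl fun p _ => ?_
    have h1 : DependsOn ({η | siteSum ξ Λ η = p.1}.indicator f) (Λ : Set ℤ) := fun a b hab => by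
      simp only [Set.indicator, Set.mem_ofPred_eq, dependsOn_siteSum ξ Λ hab, hf hab]
      congr
    have h2 : DependsOn ({η : Config | ξ (η x) = p.2}.indicator fun _ => (1 : ℝ))
        (({x} : Finset ℤ) : Set ℤ) := fun a b hab => by
      simp only [Set.indicator, Set.mem_ofPred_eq, hab x (by simp)]
    have h3 := integral_mul_of_dependsOn (μ := μ) (by simpa using hx) h1 h2
    rw [integral_indicator (measurableSet_siteSum_eq ξ Λ _),
      integral_indicator_const _ (hmx _)] at h3
    have h4 : (prodMeasure μ).real {η : Config | ξ (η x) = p.2} = μ.real (ξ ⁻¹' {p.2}) := by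
      have := (measurePreserving_eval_infinitePi (fun _ : ℤ => μ) x).measureReal_preimage
        (s := ξ ⁻¹' {p.2}) (MeasurableSet.of_discrete).nullMeasurableSet
      exact this
    rw [h4, smul_eq_mul, mul_one] at h3
    rw [← h3, ← integral_indicator ((measurableSet_siteSum_eq ξ Λ _).inter (hmx _))]
    congr 1
    ext η
    by_cases ha : siteSum ξ Λ η = p.1 <;> by_cases hb : ξ (η x) = p.2 <;>
      simp [Set.indicator, ha, hb]
  · rw [Function.onFun, Set.disjoint_left]
    rintro η ⟨h1, h2⟩ ⟨h3, h4⟩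
    exact hpq (Prod.ext (h1.symm.trans h3) (h2.symm.trans h4))

/-- Enlarging the set of sites multiplies the series by a power of the one-site series. -/
lemma sumSeries_of_subset (ξ : ℕ → ℕ) {f : Config → ℝ} {Δ Λ : Finset ℤ} (hΔ : Δ ⊆ Λ)
    (hf : DependsOn f (Δ : Set ℤ)) (hi : Integrable f (prodMeasure μ)) :
    sumSeries μ ξ f Λ = sumSeries μ ξ f Δ * siteSeries μ ξ ^ (Λ.card - Δ.card) := by
  have key : ∀ s : Finset ℤ, Disjoint Δ s →
      sumSeries μ ξ f (Δ ∪ s) = sumSeries μ ξ f Δ * siteSeries μ ξ ^ s.card := by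
    intro s
    induction s using Finset.induction_on with
    | empty => simp
    | insert x s hx ih =>
      intro hd
      rw [Finset.disjoint_insert_right] at hd
      have hx' : x ∉ Δ ∪ s := by simp [hd.1, hx]
      rw [Finset.union_insert, sumSeries_insert ξ hx' (hf.mono (by simp)) hi, ih hd.2,
        Finset.card_insert_of_notMem hx, pow_succ, mul_assoc]
  have := key (Λ \ Δ) Finset.disjoint_sdiff
  rwa [Finset.union_sdiff_of_subset hΔ, Finset.card_sdiff_of_subset hΔ] at this

lemma sumSeries_one (ξ : ℕ → ℕ) (Λ : Finset ℤ) :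
    sumSeries μ ξ (fun _ => 1) Λ = siteSeries μ ξ ^ Λ.card := by
  have h := sumSeries_of_subset (μ := μ) ξ (f := fun _ => 1) (Finset.empty_subset Λ)
    (fun _ _ _ => rfl) (integrable_const _)
  have h0 : sumSeries μ ξ (fun _ => 1) ∅ = 1 := by
    ext t
    by_cases ht : t = 0 <;> simp [sumSeries, siteSum, PowerSeries.coeff_one, ht, eq_comm]
  rw [h, h0, one_mul, Finset.card_empty, Nat.sub_zero]

lemma coeff_siteSeries_pow (ξ : ℕ → ℕ) (Λ : Finset ℤ) (t : ℕ) :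
    PowerSeries.coeff t (siteSeries μ ξ ^ Λ.card)
      = (prodMeasure μ).real {η | siteSum ξ Λ η = t} := by
  rw [← sumSeries_one, sumSeries, PowerSeries.coeff_mk]
  simp

end Product

/-! ### Conditional expectations given the particle number -/

section CondExp

lemma hasSum_setIntegral_siteSum {μ : Measure ℕ} (ξ : ℕ → ℕ) (Λ : Finset ℤ)
    {f : Config → ℝ} {A : Set Config}
    (hA : MeasurableSet A) (hi : Integrable f (prodMeasure μ)) :
    HasSum (fun t => ∫ η in A ∩ {η | siteSum ξ Λ η = t}, f η ∂(prodMeasure μ))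
      (∫ η in A, f η ∂(prodMeasure μ)) := by
  have h := hasSum_integral_iUnion (μ := prodMeasure μ) (f := f)
    (s := fun t => A ∩ {η | siteSum ξ Λ η = t})
    (fun t => hA.inter (measurableSet_siteSum_eq ξ Λ t))
    (fun a b hab => by
      rw [Function.onFun, Set.disjoint_left]
      rintro η ⟨_, h1⟩ ⟨_, h2⟩
      exact hab (h1.symm.trans h2)) hi.integrableOn
  have hU : (⋃ t, A ∩ {η | siteSum ξ Λ η = t}) = A := by
    ext η; simp
  rwa [hU] at h

variable {μ : Measure ℕ} [IsProbabilityMeasure μ]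

variable (μ) in
/-- `m` is generated, from the point of view of the sites in `Λ`, by the total number of particles
in `Λ`: this number is `m`-measurable and on each of its level sets the events of `m` agree with
events independent of the configuration in `Λ`. -/
structure IsCanonicalField (Λ : Finset ℤ) (m : MeasurableSpace Config) : Prop where
  le : m ≤ MeasurableSpace.pi
  measurable : Measurable[m] (siteSum id Λ)
  split : ∀ A, MeasurableSet[m] A → ∀ s, ∃ B : Set Config,
    A ∩ {η | siteSum id Λ η = s} = B ∩ {η | siteSum id Λ η = s} ∧
    ∀ f : Config → ℝ, DependsOn f (Λ : Set ℤ) →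
      ∫ η in B, f η ∂(prodMeasure μ) = (prodMeasure μ).real B * ∫ η, f η ∂(prodMeasure μ)

variable (μ) in
/-- The conditional mean of `f` given that there are `s` particles in `Λ` (zero if this event has
probability zero). -/
noncomputable def condMean (Λ : Finset ℤ) (f : Config → ℝ) (s : ℕ) : ℝ :=
  (∫ η in {η | siteSum id Λ η = s}, f η ∂(prodMeasure μ))
    / (prodMeasure μ).real {η | siteSum id Λ η = s}

lemma integrable_condMean (Λ : Finset ℤ) {f : Config → ℝ} (hi : Integrable f (prodMeasure μ)) :
    Integrable (fun η => condMean μ Λ f (siteSum id Λ η)) (prodMeasure μ) := by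
  have hSm := measurable_siteSum id Λ
  have hle : ∀ s, ‖condMean μ Λ f s‖ₑ * (prodMeasure μ) {η | siteSum id Λ η = s} ≤
      ENNReal.ofReal (∫ η in {η | siteSum id Λ η = s}, |f η| ∂(prodMeasure μ)) := by
    intro s
    rw [← ofReal_measureReal, Real.enorm_eq_ofReal_abs, ← ENNReal.ofReal_mul (abs_nonneg _)]
    refine ENNReal.ofReal_le_ofReal ?_
    rw [condMean, abs_div, abs_of_nonneg (measureReal_nonneg (μ := prodMeasure μ))]
    refine le_trans ?_ (abs_integral_le_integral_abs (f := f))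
    rcases (measureReal_nonneg (μ := prodMeasure μ)
      (s := {η | siteSum id Λ η = s})).eq_or_lt with h | h
    · rw [← h, mul_zero]; exact abs_nonneg _
    · rw [div_mul_cancel₀ _ h.ne']
  refine ⟨((measurable_of_countable (condMean μ Λ f)).comp hSm).aestronglyMeasurable, ?_⟩
  have e : ∫⁻ η, ‖condMean μ Λ f (siteSum id Λ η)‖ₑ ∂(prodMeasure μ)
      = ∑' s, ‖condMean μ Λ f s‖ₑ * (prodMeasure μ) {η | siteSum id Λ η = s} := by
    rw [← lintegral_map (f := fun s => ‖condMean μ Λ f s‖ₑ) (measurable_of_countable _) hSm,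
      lintegral_countable']
    refine tsum_congr fun s => ?_
    rw [Measure.map_apply hSm (measurableSet_singleton s)]; rfl
  have hsum := (hasSum_setIntegral_siteSum id Λ MeasurableSet.univ hi.abs).summable
  simp only [Set.univ_inter] at hsum
  rw [HasFiniteIntegral, e]
  refine (ENNReal.tsum_le_tsum hle).trans_lt ?_
  rw [← ENNReal.ofReal_tsum_of_nonneg (fun s => integral_nonneg fun _ => abs_nonneg _) hsum]
  exact ENNReal.ofReal_lt_top

lemma setIntegral_condMean {Λ : Finset ℤ} {f : Config → ℝ} (hf : DependsOn f (Λ : Set ℤ))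
    (hi : Integrable f (prodMeasure μ)) {A : Set Config} (hA : MeasurableSet A)
    (hsplit : ∀ s, ∃ B : Set Config,
      A ∩ {η | siteSum id Λ η = s} = B ∩ {η | siteSum id Λ η = s} ∧
      ∀ f : Config → ℝ, DependsOn f (Λ : Set ℤ) →
        ∫ η in B, f η ∂(prodMeasure μ) = (prodMeasure μ).real B * ∫ η, f η ∂(prodMeasure μ)) :
    ∫ η in A, condMean μ Λ f (siteSum id Λ η) ∂(prodMeasure μ)
      = ∫ η in A, f η ∂(prodMeasure μ) := by
  have hms := measurableSet_siteSum_eq id Λ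
  refine (hasSum_setIntegral_siteSum id Λ hA (integrable_condMean Λ hi)).unique ?_
  convert! hasSum_setIntegral_siteSum id Λ hA hi using 2 with s
  obtain ⟨B, hAB, hind⟩ := hsplit s
  have hdi : ∀ F : Config → ℝ, DependsOn F (Λ : Set ℤ) →
      ∫ η in A ∩ {η | siteSum id Λ η = s}, F η ∂(prodMeasure μ)
        = (prodMeasure μ).real B * ∫ η in {η | siteSum id Λ η = s}, F η ∂(prodMeasure μ) := by
    intro F hF
    have hF' : DependsOn ({η | siteSum id Λ η = s}.indicator F) (Λ : Set ℤ) := fun a b hab => by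
      simp only [Set.indicator, Set.mem_ofPred_eq, dependsOn_siteSum id Λ hab, hF hab]
      congr
    have := hind _ hF'
    rwa [setIntegral_indicator (hms s), integral_indicator (hms s), ← hAB] at this
  have hconst : ∫ η in A ∩ {η | siteSum id Λ η = s}, condMean μ Λ f (siteSum id Λ η)
        ∂(prodMeasure μ)
      = ∫ η in A ∩ {η | siteSum id Λ η = s}, condMean μ Λ f s * 1 ∂(prodMeasure μ) :=
    setIntegral_congr_fun (hA.inter (hms s)) fun η hη => by
      simp only [mul_one]; rw [show siteSum id Λ η = s from hη.2]
  rw [hconst, integral_const_mul, hdi (fun _ => 1) (fun _ _ _ => rfl), hdi f hf]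
  simp only [integral_const, smul_eq_mul, mul_one, measureReal_restrict_apply_univ]
  rw [condMean]
  by_cases h0 : (prodMeasure μ).real {η | siteSum id Λ η = s} = 0
  · have hz : (prodMeasure μ) {η | siteSum id Λ η = s} = 0 := by
      rwa [measureReal_eq_zero_iff] at h0
    rw [setIntegral_measure_zero _ hz]; simp
  · field_simp

/-- The conditional expectation given a canonical field is the elementary conditional mean. -/
lemma condExp_ae_eq {Λ : Finset ℤ} {m : MeasurableSpace Config} (hm : IsCanonicalField μ Λ m)
    {f : Config → ℝ} (hf : DependsOn f (Λ : Set ℤ)) (hi : Integrable f (prodMeasure μ)) :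
    (prodMeasure μ)[f | m] =ᵐ[prodMeasure μ] fun η => condMean μ Λ f (siteSum id Λ η) :=
  (ae_eq_condExp_of_forall_setIntegral_eq hm.le hi
    (fun _ _ _ => (integrable_condMean Λ hi).integrableOn)
    (fun _ hA _ => setIntegral_condMean hf hi (hm.le _ hA) (hm.split _ hA))
    ((measurable_of_countable (condMean μ Λ f)).comp hm.measurable).aestronglyMeasurable).symm

end CondExp

/-! ### Random variables with all moments -/

section Moments

open scoped NNReal

/-- The random variable belongs to every `Lᵖ` with `p` finite. -/
def AllMoments {Ω : Type*} [MeasurableSpace Ω] (X : Ω → ℝ) (P : Measure Ω) : Prop :=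
  ∀ p : ℝ≥0, MemLp X p P

variable {Ω : Type*} {mΩ : MeasurableSpace Ω} {P : Measure Ω} [IsFiniteMeasure P] {X Y : Ω → ℝ}

omit [IsFiniteMeasure P] in
lemma AllMoments.add (hX : AllMoments X P) (hY : AllMoments Y P) :
    AllMoments (fun ω => X ω + Y ω) P := fun p => (hX p).add (hY p)

lemma allMoments_const (c : ℝ) : AllMoments (fun _ : Ω => c) P := fun _ => memLp_const c

omit [IsFiniteMeasure P] in
lemma AllMoments.mul (hX : AllMoments X P) (hY : AllMoments Y P) :
    AllMoments (fun ω => X ω * Y ω) P := fun p => by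
  have : ENNReal.HolderTriple ((2 * p : ℝ≥0) : ℝ≥0∞) ((2 * p : ℝ≥0) : ℝ≥0∞) (p : ℝ≥0∞) := by
    constructor
    rw [← two_mul, ENNReal.coe_mul, ENNReal.mul_inv (Or.inl (by norm_num)) (Or.inl (by norm_num)),
      ← mul_assoc]
    norm_num
    rw [ENNReal.mul_inv_cancel (by norm_num) (by norm_num), one_mul]
  exact (hY (2 * p)).mul (hX (2 * p))

lemma AllMoments.pow (hX : AllMoments X P) (n : ℕ) : AllMoments (fun ω => X ω ^ n) P := by
  induction n with
  | zero => simpa using allMoments_const (P := P) 1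
  | succ n ih => simpa only [pow_succ] using ih.mul hX

lemma AllMoments.const_mul (hX : AllMoments X P) (c : ℝ) : AllMoments (fun ω => c * X ω) P :=
  (allMoments_const c).mul hX

omit [IsFiniteMeasure P] in
lemma AllMoments.sum {ι : Type*} (s : Finset ι) {X : ι → Ω → ℝ}
    (h : ∀ i ∈ s, AllMoments (X i) P) : AllMoments (fun ω => ∑ i ∈ s, X i ω) P :=
  fun p => memLp_finsetSum s fun i hi => h i hi p

lemma AllMoments.integrable (hX : AllMoments X P) : Integrable X P := (hX 1).integrable le_rfl

/-- A function in `L⁵` times a function with all moments is integrable. -/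
lemma AllMoments.integrable_mul (hY : AllMoments Y P) (hX : MemLp X 5 P) :
    Integrable (fun ω => X ω * Y ω) P := by
  have h2 : MemLp X 2 P := hX.mono_exponent (by norm_num)
  have h2' : MemLp Y 2 P := hY 2
  exact h2.integrable_mul h2'

lemma allMoments_site {μ : Measure ℕ} [IsProbabilityMeasure μ] {h : ℕ → ℝ} (hh : AllMoments h μ)
    (x : ℤ) : AllMoments (fun η : Config => h (η x)) (prodMeasure μ) := fun p =>
  (hh p).comp_measurePreserving (measurePreserving_eval_infinitePi (fun _ : ℤ => μ) x)

lemma allMoments_natCast {μ : Measure ℕ} {lamStar : ℝ} (hlam : 0 < lamStar)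
    (hexp : ∀ lam : ℝ, |lam| ≤ lamStar → Integrable (fun k : ℕ => Real.exp (lam * (k : ℝ))) μ) :
    AllMoments (fun k : ℕ => (k : ℝ)) μ := by
  refine memLp_of_mem_interior_integrableExpSet ?_
  refine mem_interior.2 ⟨Set.Ioo (-lamStar) lamStar, fun t ht => hexp t (abs_le.2
    ⟨ht.1.le, ht.2.le⟩), isOpen_Ioo, by simp [hlam]⟩

end Moments

/-! ### Lattice coordinates -/

section Lattice

variable {μ : Measure ℕ} [IsProbabilityMeasure μ]

/-- The number of lattice steps of size `d` from `k₀` to `k`. -/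
def latticeSteps (k₀ d k : ℕ) : ℕ := (k - k₀) / d

variable (μ) in
/-- The support of `μ` has smallest element `k₀` and spans the lattice `k₀ + d ℤ`. -/
structure IsLatticeLaw (k₀ d : ℕ) : Prop where
  pos : 0 < d
  eq : ∀ᵐ k ∂μ, k = k₀ + d * latticeSteps k₀ d k
  base : 0 < PowerSeries.coeff 0 (siteSeries μ (latticeSteps k₀ d))
  gcd : Nat.setGcd {t | 0 < PowerSeries.coeff t (siteSeries μ (latticeSteps k₀ d))} = 1

lemma exists_isLatticeLaw (hpos : 0 < μ {1}) (hlt : μ {1} < 1) : ∃ k₀ d, IsLatticeLaw μ k₀ d := by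
  classical
  have hex : ∃ k, μ {k} ≠ 0 := ⟨1, hpos.ne'⟩
  set k₀ := Nat.find hex with hk₀
  have hk : μ {k₀} ≠ 0 := Nat.find_spec hex
  have hmin : ∀ k, μ {k} ≠ 0 → k₀ ≤ k := fun k h => Nat.find_min' hex h
  set d := Nat.setGcd {t | μ {k₀ + t} ≠ 0} with hd
  have hdvd : ∀ k, μ {k} ≠ 0 → d ∣ k - k₀ := fun k h =>
    Nat.setGcd_dvd_of_mem (by
      show μ {k₀ + (k - k₀)} ≠ 0
      rwa [Nat.add_sub_cancel' (hmin k h)])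
  have heq : ∀ k, μ {k} ≠ 0 → k = k₀ + d * latticeSteps k₀ d k := fun k h => by
    rw [latticeSteps, Nat.mul_div_cancel' (hdvd k h), Nat.add_sub_cancel' (hmin k h)]
  have hd0 : 0 < d := by
    rw [Nat.pos_iff_ne_zero]
    intro h0
    have hone : ∀ k, μ {k} ≠ 0 → k = k₀ := fun k h => by simpa [h0] using heq k h
    have h1 : 1 = k₀ := hone 1 hpos.ne'
    have hae : ∀ᵐ k ∂μ, k ∈ ({1} : Set ℕ) := by
      rw [ae_iff_of_countable]
      intro k h; rw [Set.mem_singleton_iff, h1]; exact hone k h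
    exact hlt.ne ((prob_compl_eq_zero_iff (measurableSet_singleton 1)).1 hae)
  have hcoeff : ∀ t, μ {k₀ + d * t} ≠ 0 →
      0 < PowerSeries.coeff t (siteSeries μ (latticeSteps k₀ d)) := by
    intro t h
    rw [siteSeries, PowerSeries.coeff_mk, measureReal_def, ENNReal.toReal_pos_iff]
    refine ⟨(pos_iff_ne_zero.2 h).trans_le (measure_mono ?_), measure_lt_top _ _⟩
    simp [latticeSteps, Nat.mul_div_cancel_left t hd0]
  refine ⟨k₀, d, hd0, ae_iff_of_countable.2 heq, hcoeff 0 (by simpa using hk), ?_⟩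
  set e := Nat.setGcd {t | 0 < PowerSeries.coeff t (siteSeries μ (latticeSteps k₀ d))} with he
  have h1 : d * e ∣ d := by
    conv_rhs => rw [hd]
    rw [Nat.dvd_setGcd_iff]
    intro t ht
    obtain ⟨u, rfl⟩ : d ∣ t := Nat.setGcd_dvd_of_mem ht
    exact mul_dvd_mul_left d (Nat.setGcd_dvd_of_mem (hcoeff u ht))
  have h2 : d * e ∣ d * 1 := by simpa using h1
  exact Nat.dvd_one.1 (Nat.dvd_of_mul_dvd_mul_left hd0 h2)

omit [IsProbabilityMeasure μ] in
lemma nonnegCoeff_siteSeries (ξ : ℕ → ℕ) : NonnegCoeff (siteSeries μ ξ) := fun t => by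
  rw [siteSeries, PowerSeries.coeff_mk]; exact measureReal_nonneg

lemma tsum_mul_siteSeries (ξ : ℕ → ℕ) (φ : ℕ → ℝ≥0∞) :
    ∑' t, φ t * ENNReal.ofReal (PowerSeries.coeff t (siteSeries μ ξ)) = ∫⁻ k, φ (ξ k) ∂μ := by
  rw [← lintegral_map (measurable_of_countable φ) (measurable_of_countable ξ), lintegral_countable']
  refine tsum_congr fun t => ?_
  rw [siteSeries, PowerSeries.coeff_mk, ofReal_measureReal,
    Measure.map_apply (measurable_of_countable ξ) (measurableSet_singleton t)]

lemma mass_siteSeries (ξ : ℕ → ℕ) : mass (siteSeries μ ξ) = 1 := by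
  have := tsum_mul_siteSeries (μ := μ) ξ fun _ => 1
  simpa [mass] using this

lemma mass_rescale_siteSeries_ne_top {ξ : ℕ → ℕ} (hξ : ∀ k, ξ k ≤ k) {lam : ℝ} (hl : 0 ≤ lam)
    (hexp : Integrable (fun k : ℕ => Real.exp (lam * (k : ℝ))) μ) :
    mass (PowerSeries.rescale (Real.exp lam) (siteSeries μ ξ)) ≠ ∞ := by
  have h := tsum_mul_siteSeries (μ := μ) ξ fun t => ENNReal.ofReal (Real.exp lam ^ t)
  have e : mass (PowerSeries.rescale (Real.exp lam) (siteSeries μ ξ))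
      = ∫⁻ k, ENNReal.ofReal (Real.exp lam ^ ξ k) ∂μ := by
    rw [← h, mass]
    refine tsum_congr fun t => ?_
    rw [PowerSeries.coeff_rescale, ENNReal.ofReal_mul (by positivity)]
  rw [e]
  refine ne_top_of_le_ne_top hexp.lintegral_lt_top.ne (lintegral_mono fun k => ?_)
  refine ENNReal.ofReal_le_ofReal ?_
  rw [← Real.exp_nat_mul, mul_comm]
  exact Real.exp_le_exp.2 (mul_le_mul_of_nonneg_left (by exact_mod_cast hξ k) hl)

lemma IsLatticeLaw.siteSum_ae_eq {k₀ d : ℕ} (h : IsLatticeLaw μ k₀ d) (Λ : Finset ℤ) :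
    ∀ᵐ η ∂(prodMeasure μ),
      siteSum id Λ η = Λ.card * k₀ + d * siteSum (latticeSteps k₀ d) Λ η := by
  have h1 : ∀ x : ℤ, ∀ᵐ η ∂(prodMeasure μ), η x = k₀ + d * latticeSteps k₀ d (η x) := fun x =>
    (measurePreserving_eval_infinitePi (fun _ : ℤ => μ) x).quasiMeasurePreserving.ae h.eq
  have h2 : ∀ᵐ η ∂(prodMeasure μ), ∀ x, η x = k₀ + d * latticeSteps k₀ d (η x) :=
    ae_all_iff.2 h1
  filter_upwards [h2] with η hη
  simp only [siteSum, id]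
  rw [Finset.mul_sum, ← smul_eq_mul (a := Λ.card), ← Finset.sum_const, ← Finset.sum_add_distrib]
  exact Finset.sum_congr rfl fun x _ => hη x

/-- The conditional mean in lattice coordinates, as a ratio of coefficients. -/
lemma IsLatticeLaw.condMean_eq {k₀ d : ℕ} (h : IsLatticeLaw μ k₀ d) (Λ : Finset ℤ)
    (f : Config → ℝ) (t : ℕ) :
    condMean μ Λ f (Λ.card * k₀ + d * t) =
      PowerSeries.coeff t (sumSeries μ (latticeSteps k₀ d) f Λ)
        / PowerSeries.coeff t (siteSeries μ (latticeSteps k₀ d) ^ Λ.card) := by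
  have hset : ({η | siteSum id Λ η = Λ.card * k₀ + d * t} : Set Config)
      =ᵐ[prodMeasure μ] {η | siteSum (latticeSteps k₀ d) Λ η = t} := by
    filter_upwards [h.siteSum_ae_eq Λ] with η hη
    apply propext
    change siteSum id Λ η = _ ↔ siteSum (latticeSteps k₀ d) Λ η = t
    rw [hη, Nat.add_left_cancel_iff, Nat.mul_right_inj h.pos.ne']
  rw [condMean, coeff_siteSeries_pow, sumSeries, PowerSeries.coeff_mk, setIntegral_congr_set hset,
    measureReal_congr hset]

lemma lintegral_siteSum (ξ : ℕ → ℕ) (Λ : Finset ℤ) (φ : ℕ → ℝ≥0∞) :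
    ∫⁻ η, φ (siteSum ξ Λ η) ∂(prodMeasure μ)
      = ∑' t, φ t * ENNReal.ofReal (PowerSeries.coeff t (siteSeries μ ξ ^ Λ.card)) := by
  rw [← lintegral_map (measurable_of_countable φ) (measurable_siteSum ξ Λ), lintegral_countable']
  refine tsum_congr fun t => ?_
  rw [Measure.map_apply (measurable_siteSum ξ Λ) (measurableSet_singleton t),
    coeff_siteSeries_pow, ofReal_measureReal]
  rfl

/-- The `L⁴` norm of a conditional expectation given a canonical field. -/
lemma IsLatticeLaw.eLpNorm_condExp_pow_four {k₀ d : ℕ} (h : IsLatticeLaw μ k₀ d) {Λ : Finset ℤ}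
    {m : MeasurableSpace Config} (hm : IsCanonicalField μ Λ m)
    {f : Config → ℝ} (hf : DependsOn f (Λ : Set ℤ)) (hi : Integrable f (prodMeasure μ)) :
    eLpNorm ((prodMeasure μ)[f | m]) 4 (prodMeasure μ) ^ 4 =
      ∑' t, ENNReal.ofReal (|PowerSeries.coeff t (sumSeries μ (latticeSteps k₀ d) f Λ)| ^ 4
        / PowerSeries.coeff t (siteSeries μ (latticeSteps k₀ d) ^ Λ.card) ^ 3) := by
  set ξ := latticeSteps k₀ d with hξ
  have hae : (prodMeasure μ)[f | m] =ᵐ[prodMeasure μ]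
      fun η => condMean μ Λ f (Λ.card * k₀ + d * siteSum ξ Λ η) := by
    filter_upwards [condExp_ae_eq hm hf hi, h.siteSum_ae_eq Λ] with η h1 h2
    rw [h1, h2]
  rw [eLpNorm_congr_ae hae, eLpNorm_eq_lintegral_rpow_enorm_toReal (by norm_num) (by norm_num)]
  rw [← ENNReal.rpow_natCast, ← ENNReal.rpow_mul]
  have h4 : (1 / (4 : ℝ≥0∞).toReal * ((4 : ℕ) : ℝ)) = 1 := by norm_num
  rw [h4, ENNReal.rpow_one, lintegral_siteSum ξ Λ fun t =>
    ‖condMean μ Λ f (Λ.card * k₀ + d * t)‖ₑ ^ (4 : ℝ≥0∞).toReal]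
  refine tsum_congr fun t => ?_
  have hp0 := (nonnegCoeff_siteSeries (μ := μ) ξ).pow Λ.card t
  rw [h.condMean_eq, ← hξ, Real.enorm_eq_ofReal_abs,
    show (4 : ℝ≥0∞).toReal = ((4 : ℕ) : ℝ) by norm_num, ENNReal.rpow_natCast,
    ← ENNReal.ofReal_pow (abs_nonneg _), ← ENNReal.ofReal_mul (by positivity), abs_div,
    abs_of_nonneg hp0, div_pow]
  congr 1
  rcases hp0.eq_or_lt with h0 | h0
  · rw [← h0]; simp
  · field_simp

end Lattice

/-! ### Functions orthogonal to polynomials of the particle number -/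

section Jensen

variable {μ : Measure ℕ} [IsProbabilityMeasure μ]

/-- Jensen's inequality on an event, for the fifth power. -/
lemma abs_setIntegral_pow_five_le {Ω : Type*} [MeasurableSpace Ω] {P : Measure Ω}
    [IsFiniteMeasure P] {f : Ω → ℝ} (hf : MemLp f 5 P) (A : Set Ω) :
    P.real A * |(∫ ω in A, f ω ∂P) / P.real A| ^ 5 ≤ ∫ ω in A, |f ω| ^ 5 ∂P := by
  have h5 : Integrable (fun ω => |f ω| ^ 5) P := hf.integrable_norm_pow (p := 5) (by norm_num)
  have h1 : Integrable (fun ω => |f ω|) P := (hf.integrable (by norm_num)).abs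
  rcases (measureReal_nonneg (μ := P) (s := A)).eq_or_lt with h | h
  · rw [← h, zero_mul]; exact integral_nonneg fun _ => by positivity
  set c := |(∫ ω in A, f ω ∂P) / P.real A| with hc
  have hc0 : 0 ≤ c := abs_nonneg _
  have hcA : c * P.real A ≤ ∫ ω in A, |f ω| ∂P := by
    rw [hc, abs_div, abs_of_pos h, div_mul_cancel₀ _ h.ne']
    exact abs_integral_le_integral_abs
  -- The tangent line of `a ↦ a ^ 5` at `c`.
  have htan : ∀ a : ℝ, 0 ≤ a → 5 * c ^ 4 * a - 4 * c ^ 5 ≤ a ^ 5 := by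
    intro a ha
    have : 0 ≤ (a - c) ^ 2 * (a ^ 3 + 2 * a ^ 2 * c + 3 * a * c ^ 2 + 4 * c ^ 3) := by positivity
    nlinarith
  have hint : ∫ ω in A, (5 * c ^ 4 * |f ω| - 4 * c ^ 5) ∂P ≤ ∫ ω in A, |f ω| ^ 5 ∂P :=
    integral_mono ((h1.integrableOn.const_mul _).sub (integrable_const _)) h5.integrableOn
      fun ω => htan _ (abs_nonneg _)
  rw [integral_sub (h1.integrableOn.const_mul _) (integrable_const _), integral_const_mul,
    integral_const, smul_eq_mul, measureReal_restrict_apply_univ] at hint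
  have : 5 * c ^ 4 * (c * P.real A) ≤ 5 * c ^ 4 * ∫ ω in A, |f ω| ∂P := by gcongr
  nlinarith

end Jensen

section CanonicalBound

variable {μ : Measure ℕ} [IsProbabilityMeasure μ]

/-- If `f` is orthogonal to the powers of degree `< r ≤ 3` of the particle number in `Δ`, its
weighted binomial sums in lattice coordinates vanish. -/
lemma IsLatticeLaw.tsum_sumSeries_choose {k₀ d : ℕ} (h : IsLatticeLaw μ k₀ d)
    (hmom : AllMoments (fun k : ℕ => (k : ℝ)) μ) {Δ : Finset ℤ} {f : Config → ℝ}
    (hf5 : MemLp f 5 (prodMeasure μ)) {r : ℕ} (hr : r ≤ 3)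
    (hz : ∀ i < r, ∫ η, f η * (siteSum id Δ η : ℝ) ^ i ∂(prodMeasure μ) = 0) {i : ℕ} (hi : i < r) :
    ∑' t, PowerSeries.coeff t (sumSeries μ (latticeSteps k₀ d) f Δ) * (t.choose i : ℝ) = 0 := by
  set ν := prodMeasure μ with hν
  set ξ := latticeSteps k₀ d with hξ
  set S : Config → ℝ := fun η => (siteSum id Δ η : ℝ) with hS
  set a : ℝ := Δ.card * k₀ with ha
  have hd : (d : ℝ) ≠ 0 := by exact_mod_cast h.pos.ne'
  have hSm : AllMoments S ν := by
    have : S = fun η : Config => ∑ x ∈ Δ, ((η x : ℕ) : ℝ) := by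
      ext η; simp [hS, siteSum]
    rw [this]
    exact AllMoments.sum Δ fun x _ => allMoments_site hmom x
  have hint : ∀ i, Integrable (fun η => f η * S η ^ i) ν := fun i => (hSm.pow i).integrable_mul hf5
  have hT : ∀ᵐ η ∂ν, (siteSum ξ Δ η : ℝ) = (S η - a) / d := by
    filter_upwards [h.siteSum_ae_eq Δ] with η hη
    rw [hS]; dsimp only; rw [hη, ha]; push_cast; field_simp; ring
  -- The binomial coefficient is a polynomial of degree `i` in the particle number.
  obtain ⟨c0, c1, c2, hc1, hc2, hpoly⟩ : ∃ c0 c1 c2 : ℝ, (i < 1 → c1 = 0) ∧ (i < 2 → c2 = 0) ∧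
      ∀ t : ℕ, ∀ s : ℝ, (t : ℝ) = (s - a) / d → (t.choose i : ℝ) = c0 + c1 * s + c2 * s ^ 2 := by
    have hi3 : i < 3 := by omega
    interval_cases i
    · exact ⟨1, 0, 0, by simp, by simp, by simp⟩
    · refine ⟨-a / d, 1 / d, 0, by simp, by simp, fun t s h => ?_⟩
      rw [Nat.choose_one_right, h]; ring
    · refine ⟨a / d * (a / d + 1) / 2, -(2 * a / d + 1) / d / 2, 1 / d ^ 2 / 2, by simp, by simp,
        fun t s h => ?_⟩
      rw [Nat.cast_choose_two, h]; field_simp; ring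
  have hae : (fun η => f η * ((siteSum ξ Δ η).choose i : ℝ)) =ᵐ[ν]
      fun η => c0 * (f η * S η ^ 0) + c1 * (f η * S η ^ 1) + c2 * (f η * S η ^ 2) := by
    filter_upwards [hT] with η hη
    rw [hpoly _ _ hη]; ring
  have hI : Integrable (fun η => f η * ((siteSum ξ Δ η).choose i : ℝ)) ν :=
    ((((hint 0).const_mul c0).add ((hint 1).const_mul c1)).add ((hint 2).const_mul c2)).congr
      hae.symm
  have hs := hasSum_setIntegral_siteSum ξ Δ MeasurableSet.univ hI
  have h01 : Integrable (fun η => c0 * (f η * S η ^ 0) + c1 * (f η * S η ^ 1)) ν :=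
    ((hint 0).const_mul c0).add ((hint 1).const_mul c1)
  rw [setIntegral_univ, integral_congr_ae hae, integral_add h01 ((hint 2).const_mul c2),
    integral_add ((hint 0).const_mul c0) ((hint 1).const_mul c1),
    integral_const_mul, integral_const_mul, integral_const_mul] at hs
  have hval : c0 * ∫ η, f η * S η ^ 0 ∂ν + c1 * ∫ η, f η * S η ^ 1 ∂ν
      + c2 * ∫ η, f η * S η ^ 2 ∂ν = 0 := by
    have z0 : ∫ η, f η * S η ^ 0 ∂ν = 0 := hz 0 (by omega)
    have z1 : c1 * ∫ η, f η * S η ^ 1 ∂ν = 0 := by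
      rcases lt_or_ge i 1 with h1 | h1
      · rw [hc1 h1, zero_mul]
      · rw [hz 1 (by omega), mul_zero]
    have z2 : c2 * ∫ η, f η * S η ^ 2 ∂ν = 0 := by
      rcases lt_or_ge i 2 with h1 | h1
      · rw [hc2 h1, zero_mul]
      · rw [hz 2 (by omega), mul_zero]
    rw [z0, z1, z2]; ring
  rw [hval] at hs
  rw [← hs.tsum_eq]
  refine tsum_congr fun t => ?_
  rw [sumSeries, PowerSeries.coeff_mk, Set.univ_inter, ← integral_mul_const]
  refine setIntegral_congr_fun (measurableSet_siteSum_eq ξ Δ t) fun η hη => ?_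
  simp only [show siteSum ξ Δ η = t from hη]

/-- **Canonical expectations of functions orthogonal to polynomials** of degree `< r` in the number
of particles: their `L⁴` norm is `O (|Λ| ^ (-r / 2))`. -/
theorem exists_canonical_bound (hpos : 0 < μ {1}) (hlt : μ {1} < 1) {lamStar : ℝ}
    (hlam : 0 < lamStar)
    (hexp : ∀ lam : ℝ, |lam| ≤ lamStar → Integrable (fun k : ℕ => Real.exp (lam * (k : ℝ))) μ)
    (Δ : Finset ℤ) {r : ℕ} (hr : r ≤ 3) :
    ∃ C : ℝ, 0 ≤ C ∧ ∀ f : Config → ℝ, DependsOn f (Δ : Set ℤ) → MemLp f 5 (prodMeasure μ) →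
      (∀ i < r, ∫ η, f η * (siteSum id Δ η : ℝ) ^ i ∂(prodMeasure μ) = 0) →
      ∀ Λ : Finset ℤ, Δ ⊆ Λ → Λ.Nonempty → ∀ m, IsCanonicalField μ Λ m →
        eLpNorm ((prodMeasure μ)[f | m]) 4 (prodMeasure μ) ≤
          ENNReal.ofReal (C / (Λ.card : ℝ) ^ ((r : ℝ) / 2)) * eLpNorm f 5 (prodMeasure μ) := by
  obtain ⟨k₀, d, hL⟩ := exists_isLatticeLaw hpos hlt
  set ξ := latticeSteps k₀ d with hξ
  have hξle : ∀ k, ξ k ≤ k := fun k => (Nat.div_le_self _ _).trans (Nat.sub_le _ _)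
  have hM := nonnegCoeff_siteSeries (μ := μ) ξ
  obtain ⟨C, hC, hbound⟩ := exists_quartic_bound hM hL.base (mass_siteSeries ξ) hL.gcd hlam
    (mass_rescale_siteSeries_ne_top hξle hlam.le (hexp _ (abs_of_pos hlam).le)) Δ.card r hr
  refine ⟨C ^ (1 / 4 : ℝ), by positivity, fun f hf hf5 hz Λ hΔ hΛ => ?_⟩
  have hi : Integrable f (prodMeasure μ) := hf5.integrable (by norm_num)
  rcases eq_or_ne (eLpNorm f 5 (prodMeasure μ)) 0 with h0 | h0
  · have hf0 : f =ᵐ[prodMeasure μ] 0 :=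
      (eLpNorm_eq_zero_iff hf5.aestronglyMeasurable (by norm_num)).1 h0
    intro m _
    have h1 : (prodMeasure μ)[f | m] =ᵐ[prodMeasure μ] 0 := by
      have := condExp_congr_ae (m := m) hf0
      rwa [condExp_zero] at this
    rw [eLpNorm_congr_ae h1, eLpNorm_zero]
    exact zero_le
  set G := (eLpNorm f 5 (prodMeasure μ)).toReal with hG
  have hG0 : 0 < G := ENNReal.toReal_pos h0 hf5.eLpNorm_ne_top
  have hGof : eLpNorm f 5 (prodMeasure μ) = ENNReal.ofReal G :=
    (ENNReal.ofReal_toReal hf5.eLpNorm_ne_top).symm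
  have h5 : Integrable (fun η => |f η| ^ 5) (prodMeasure μ) :=
    hf5.integrable_norm_pow (p := 5) (by norm_num)
  have hG5 : ∫ η, |f η| ^ 5 ∂(prodMeasure μ) = G ^ 5 := by
    have hI : 0 ≤ ∫ η, |f η| ^ 5 ∂(prodMeasure μ) := integral_nonneg fun _ => by positivity
    rw [hG, hf5.eLpNorm_eq_integral_rpow_norm (by norm_num) (by norm_num)]
    have e5 : (5 : ℝ≥0∞).toReal = ((5 : ℕ) : ℝ) := by norm_num
    simp only [e5, Real.rpow_natCast, Real.norm_eq_abs]
    rw [ENNReal.toReal_ofReal (by positivity), ← Real.rpow_natCast, ← Real.rpow_mul hI]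
    norm_num
  set F := sumSeries μ ξ f Δ with hF
  -- `F k / κ k` is the conditional expectation of `f` given that the sum over `Δ` is `k`.
  set κ : ℕ → ℝ := fun k => PowerSeries.coeff k (siteSeries μ ξ ^ Δ.card) with hκ
  have hκF : ∀ k, PowerSeries.coeff k F = κ k * (PowerSeries.coeff k F / κ k) := by
    intro k
    by_cases hk : κ k = 0
    · rw [hk, zero_mul, hF, sumSeries, PowerSeries.coeff_mk]
      have hk' : (prodMeasure μ) {η | siteSum ξ Δ η = k} = 0 := by
        rw [hκ] at hk; dsimp only at hk
        rwa [coeff_siteSeries_pow, measureReal_eq_zero_iff] at hk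
      exact setIntegral_measure_zero _ hk'
    · field_simp
  have hs5 := hasSum_setIntegral_siteSum ξ Δ MeasurableSet.univ h5
  rw [setIntegral_univ] at hs5
  simp only [Set.univ_inter] at hs5
  have hJ : ∀ k, κ k * |PowerSeries.coeff k F / κ k| ^ 5
      ≤ ∫ η in {η | siteSum ξ Δ η = k}, |f η| ^ 5 ∂(prodMeasure μ) := by
    intro k
    rw [hκ]; dsimp only
    rw [coeff_siteSeries_pow, hF, sumSeries, PowerSeries.coeff_mk]
    exact abs_setIntegral_pow_five_le hf5 _
  have hsum : Summable fun k => κ k * |PowerSeries.coeff k F / κ k| ^ 5 :=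
    Summable.of_nonneg_of_le (fun k => mul_nonneg (hM.pow _ k) (by positivity)) hJ hs5.summable
  have hle : ∑' k, κ k * |PowerSeries.coeff k F / κ k| ^ 5 ≤ G ^ 5 := by
    rw [← hG5, ← hs5.tsum_eq]
    exact hsum.tsum_le_tsum hJ hs5.summable
  have hn : 1 ≤ Λ.card := hΛ.card_pos
  have hmain := hbound F (fun k => PowerSeries.coeff k F / κ k) G hG0 hκF hsum hle
    (fun i hi => hL.tsum_sumSeries_choose (allMoments_natCast hlam hexp) hf5 hr hz hi)
    Λ.card (Finset.card_le_card hΔ) hn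
  intro m hm
  rw [hF, ← sumSeries_of_subset ξ hΔ hf hi,
    ← hL.eLpNorm_condExp_pow_four hm (hf.mono (by exact_mod_cast hΔ)) hi] at hmain
  have hnp : (0 : ℝ) < Λ.card := by exact_mod_cast hn
  have hc0 : 0 ≤ C ^ (1 / 4 : ℝ) / (Λ.card : ℝ) ^ ((r : ℝ) / 2) :=
    div_nonneg (Real.rpow_nonneg hC.le _) (Real.rpow_nonneg hnp.le _)
  rw [hGof, ← ENNReal.ofReal_mul hc0]
  refine (ENNReal.pow_le_pow_left_iff (n := 4) (by norm_num)).1 (hmain.trans_eq ?_)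
  rw [← ENNReal.ofReal_pow (mul_nonneg hc0 hG0.le)]
  congr 1
  rw [mul_pow, div_pow, ← Real.rpow_natCast (C ^ (1 / 4 : ℝ)), ← Real.rpow_mul hC.le,
    ← Real.rpow_natCast ((Λ.card : ℝ) ^ ((r : ℝ) / 2)), ← Real.rpow_mul hnp.le,
    ← Real.rpow_natCast _ (2 * r)]
  push_cast
  rw [show (1 / 4 : ℝ) * 4 = 1 by norm_num, Real.rpow_one, show (r : ℝ) / 2 * 4 = 2 * r by ring]
  ring

end CanonicalBound

/-! ### The tilted mean and its derivatives -/

section Tilting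

open Filter Topology

/-- Quadratic vanishing of a `C²` function whose value and first derivative vanish. -/
lemma tendsto_div_sq {u : ℝ → ℝ} {a : ℝ} (hu : ContDiffAt ℝ 2 u a) (h0 : u a = 0)
    (h1 : deriv u a = 0) :
    Tendsto (fun x => u x / (x - a) ^ 2) (𝓝[≠] a) (𝓝 (iteratedDeriv 2 u a / 2)) := by
  have hdiff : ∀ᶠ x in 𝓝 a, DifferentiableAt ℝ u x := by
    filter_upwards [hu.eventually (by simp)] with x hx
    exact hx.differentiableAt (by norm_num)
  have hd' : DifferentiableAt ℝ (deriv u) a := by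
    have h2 : ContDiffAt ℝ 1 (fderiv ℝ u) a := hu.fderiv_right (by norm_num)
    exact (h2.differentiableAt (by norm_num)).clm_apply (differentiableAt_const 1)
  have hs : Tendsto (fun x => deriv u x / (x - a)) (𝓝[≠] a) (𝓝 (iteratedDeriv 2 u a)) := by
    have := hd'.hasDerivAt.tendsto_slope
    rw [iteratedDeriv_succ, iteratedDeriv_one]
    refine this.congr fun x => ?_
    rw [slope_def_field, h1, sub_zero]
  have hg : ∀ x, HasDerivAt (fun x => (x - a) ^ 2) (2 * (x - a)) x := fun x => by
    simpa using ((hasDerivAt_id' x).sub_const a).fun_pow 2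
  refine deriv.lhopital_zero_nhdsNE (hdiff.filter_mono nhdsWithin_le_nhds) ?_ ?_ ?_ ?_
  · filter_upwards [self_mem_nhdsWithin] with x hx
    rw [(hg x).deriv]
    exact mul_ne_zero two_ne_zero (sub_ne_zero.2 hx)
  · have := hu.continuousAt.tendsto
    rw [h0] at this
    exact this.mono_left nhdsWithin_le_nhds
  · have : ContinuousAt (fun x => (x - a) ^ 2) a := by fun_prop
    have h2 := this.tendsto
    simp only [sub_self, ne_eq, OfNat.ofNat_ne_zero, not_false_eq_true, zero_pow] at h2
    exact h2.mono_left nhdsWithin_le_nhds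
  · refine (hs.div_const 2).congr' ?_
    filter_upwards [self_mem_nhdsWithin] with x hx
    rw [(hg x).deriv, div_div, mul_comm]

/-- An analytic moment generating function of a signed density `f`: its first derivatives at the
origin are the first moments. -/
lemma analyticAt_integral_mul_exp {Ω : Type*} [MeasurableSpace Ω] {P : Measure Ω}
    [IsFiniteMeasure P] {f X : Ω → ℝ} (hfm : Measurable f) (hX : Measurable X) (hf : MemLp f 2 P)
    {ε : ℝ} (hε : 0 < ε) (hexp : ∀ t : ℝ, |t| < ε → Integrable (fun ω => Real.exp (t * X ω)) P) :
    AnalyticAt ℝ (fun t => ∫ ω, f ω * Real.exp (t * X ω) ∂P) 0 ∧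
    deriv (fun t => ∫ ω, f ω * Real.exp (t * X ω) ∂P) 0 = ∫ ω, f ω * X ω ∂P ∧
    iteratedDeriv 2 (fun t => ∫ ω, f ω * Real.exp (t * X ω) ∂P) 0 = ∫ ω, f ω * X ω ^ 2 ∂P := by
  -- The positive and the negative part of `f` are densities of finite measures, to which the theory
  -- of moment generating functions applies.
  have hmeas : ∀ h : Ω → ℝ, Measurable h → Measurable fun ω => ENNReal.ofReal (h ω) :=
    fun h hh => hh.ennreal_ofReal
  have hL2 : ∀ t : ℝ, |t| < ε / 2 → MemLp (fun ω => Real.exp (t * X ω)) 2 P := by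
    intro t ht
    have hm : AEStronglyMeasurable (fun ω => Real.exp (t * X ω)) P := by fun_prop
    rw [memLp_two_iff_integrable_sq hm]
    refine (hexp (2 * t) (by rw [abs_mul, abs_two]; linarith)).congr (.of_forall fun ω => ?_)
    dsimp only
    rw [← Real.exp_nat_mul]; congr 1; push_cast; ring
  have key : ∀ h : Ω → ℝ, Measurable h → MemLp h 2 P → (∀ ω, 0 ≤ h ω) →
      0 ∈ interior (integrableExpSet X (P.withDensity fun ω => ENNReal.ofReal (h ω))) ∧
      ∀ g : Ω → ℝ, ∫ ω, g ω ∂(P.withDensity fun ω => ENNReal.ofReal (h ω)) = ∫ ω, h ω * g ω ∂P := by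
    intro h hm h2 h0
    have hlt : ∀ᵐ ω ∂P, ENNReal.ofReal (h ω) < ∞ := .of_forall fun _ => ENNReal.ofReal_lt_top
    constructor
    · refine mem_interior.2 ⟨Set.Ioo (-(ε / 2)) (ε / 2), fun t ht => ?_, isOpen_Ioo, by simp [hε]⟩
      change Integrable _ _
      rw [integrable_withDensity_iff (hmeas h hm) hlt]
      refine ((hL2 t (abs_lt.2 ht)).integrable_mul h2).congr (.of_forall fun ω => ?_)
      simp [ENNReal.toReal_ofReal (h0 ω)]
    · intro g
      rw [integral_withDensity_eq_integral_toReal_smul (hmeas h hm) hlt]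
      simp [ENNReal.toReal_ofReal (h0 _)]
  obtain ⟨p1, p2⟩ := key (fun ω => max (f ω) 0) (hfm.max measurable_const) hf.pos_part
    fun ω => le_max_right _ _
  obtain ⟨n1, n2⟩ := key (fun ω => max (-f ω) 0) (hfm.neg.max measurable_const) hf.neg_part
    fun ω => le_max_right _ _
  set Pp := P.withDensity fun ω => ENNReal.ofReal (max (f ω) 0)
  set Pn := P.withDensity fun ω => ENNReal.ofReal (max (-f ω) 0)
  have hsplit : ∀ g : Ω → ℝ, MemLp g 2 P →
      ∫ ω, f ω * g ω ∂P = ∫ ω, g ω ∂Pp - ∫ ω, g ω ∂Pn := by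
    intro g hg
    have hfp : MemLp (fun ω => max (f ω) 0) 2 P := hf.pos_part
    have hfn : MemLp (fun ω => max (-f ω) 0) 2 P := hf.neg_part
    have i1 : Integrable (fun ω => max (f ω) 0 * g ω) P := hfp.integrable_mul hg
    have i2 : Integrable (fun ω => max (-f ω) 0 * g ω) P := hfn.integrable_mul hg
    rw [p2, n2, ← integral_sub i1 i2]
    refine integral_congr_ae (.of_forall fun ω => ?_)
    dsimp only
    rw [← sub_mul]
    congr 1
    rcases le_total (f ω) 0 with h | h
    · rw [max_eq_right h, max_eq_left (by linarith)]; ring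
    · rw [max_eq_left h, max_eq_right (by linarith)]; ring
  have hXall : ∀ p : NNReal, MemLp X p P := memLp_of_mem_interior_integrableExpSet
    (mem_interior.2 ⟨Set.Ioo (-ε) ε, fun t ht => hexp t (abs_lt.2 ht), isOpen_Ioo, by simp [hε]⟩)
  have hev : (fun t => ∫ ω, f ω * Real.exp (t * X ω) ∂P) =ᶠ[𝓝 0]
      fun t => mgf X Pp t - mgf X Pn t := by
    filter_upwards [Ioo_mem_nhds (show -(ε / 2) < 0 by linarith) (show 0 < ε / 2 by linarith)]
      with t ht
    exact hsplit _ (hL2 t (abs_lt.2 ht))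
  have a1 := analyticAt_mgf p1
  have a2 := analyticAt_mgf n1
  refine ⟨(a1.sub a2).congr hev.symm, ?_, ?_⟩
  · rw [hev.deriv_eq, deriv_fun_sub a1.differentiableAt a2.differentiableAt, deriv_mgf_zero p1,
      deriv_mgf_zero n1, hsplit X (hXall 2)]
  · have hX2 : MemLp (fun ω => X ω ^ 2) 2 P := by
      have : AllMoments X P := hXall
      exact this.pow 2 2
    rw [hev.iteratedDeriv_eq, iteratedDeriv_fun_sub a1.contDiffAt a2.contDiffAt,
      iteratedDeriv_mgf_zero p1, iteratedDeriv_mgf_zero n1, hsplit _ hX2]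
    rfl

variable {μ : Measure ℕ} [IsProbabilityMeasure μ]

variable (μ) in
/-- The centred number of particles at one site. -/
noncomputable def centred (k : ℕ) : ℝ := (k : ℝ) - density (prodMeasure μ)

omit [IsProbabilityMeasure μ] in
lemma measurable_centred : Measurable (centred μ) := measurable_of_countable _

lemma density_prodMeasure : density (prodMeasure μ) = ∫ k, (k : ℝ) ∂μ :=
  integral_site (fun k : ℕ => (k : ℝ)) 0

omit [IsProbabilityMeasure μ] in
lemma integrableExpSet_centred {lamStar : ℝ}
    (hexp : ∀ lam : ℝ, |lam| ≤ lamStar → Integrable (fun k : ℕ => Real.exp (lam * (k : ℝ))) μ)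
    {lam : ℝ} (hl : lam ∈ Set.Ioo (-lamStar) lamStar) :
    lam ∈ interior (integrableExpSet (centred μ) μ) := by
  refine mem_interior.2 ⟨Set.Ioo (-lamStar) lamStar, fun t ht => ?_, isOpen_Ioo, hl⟩
  change Integrable _ _
  refine ((hexp t (abs_lt.2 ht).le).mul_const (Real.exp (-t * density (prodMeasure μ)))).congr
    (.of_forall fun k => ?_)
  dsimp only
  rw [← Real.exp_add, centred]; congr 1; ring

omit [IsProbabilityMeasure μ] in
lemma integrable_exp_centred {lamStar : ℝ}
    (hexp : ∀ lam : ℝ, |lam| ≤ lamStar → Integrable (fun k : ℕ => Real.exp (lam * (k : ℝ))) μ)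
    {lam : ℝ} (hl : lam ∈ Set.Ioo (-lamStar) lamStar) :
    Integrable (fun k => Real.exp (lam * centred μ k)) μ := by
  have h : lam ∈ integrableExpSet (centred μ) μ :=
    interior_subset (integrableExpSet_centred hexp hl)
  exact h

omit [IsProbabilityMeasure μ] in
lemma allMoments_centred {lamStar : ℝ} (hlam : 0 < lamStar)
    (hexp : ∀ lam : ℝ, |lam| ≤ lamStar → Integrable (fun k : ℕ => Real.exp (lam * (k : ℝ))) μ) :
    AllMoments (centred μ) μ :=
  memLp_of_mem_interior_integrableExpSet (integrableExpSet_centred hexp (by simp [hlam]))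

lemma integral_centred (hmom : AllMoments (fun k : ℕ => (k : ℝ)) μ) :
    ∫ k, centred μ k ∂μ = 0 := by
  unfold centred
  rw [integral_sub ((hmom 1).integrable (by simp)) (integrable_const _), ← density_prodMeasure]
  simp

lemma siteVar_eq : siteVar μ = ∫ k, centred μ k ^ 2 ∂μ :=
  integral_site (fun k => centred μ k ^ 2) 0

section

variable {lamStar : ℝ} (hlam : 0 < lamStar)
  (hexp : ∀ lam : ℝ, |lam| ≤ lamStar → Integrable (fun k : ℕ => Real.exp (lam * (k : ℝ))) μ)

include hexp in
lemma isProbabilityMeasure_tilted_centred {lam : ℝ} (hl : lam ∈ Set.Ioo (-lamStar) lamStar) :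
    IsProbabilityMeasure (μ.tilted fun k => lam * centred μ k) :=
  isProbabilityMeasure_tilted (integrable_exp_centred hexp hl)

include hexp in
/-- The density of the tilted product measure is given by the derivative of the cumulant generating
function. -/
lemma density_tiltedProd {lam : ℝ} (hl : lam ∈ Set.Ioo (-lamStar) lamStar) :
    density (tiltedProd μ lam) = density (prodMeasure μ) + deriv (cgf (centred μ) μ) lam := by
  have hint := integrableExpSet_centred hexp hl
  have := isProbabilityMeasure_tilted_centred hexp hl
  have h1 : density (tiltedProd μ lam) = ∫ k, (k : ℝ) ∂(μ.tilted fun k => lam * centred μ k) :=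
    haveI : IsProbabilityMeasure
        (μ.tilted fun k : ℕ => lam * ((k : ℝ) - density (prodMeasure μ))) := this
    density_prodMeasure
  have h2 : Integrable (centred μ) (μ.tilted fun k => lam * centred μ k) :=
    (memLp_tilted_mul hint 1).integrable (by simp)
  rw [h1, ← integral_tilted_mul_self hint]
  have h3 : ∀ k : ℕ, (k : ℝ) = density (prodMeasure μ) + centred μ k := fun k => by
    rw [centred]; ring
  simp_rw [h3]
  rw [integral_add (integrable_const _) h2]
  simp

include hexp in
/-- The tilted variances are positive, as the marginal is not concentrated at one point. -/
lemma iteratedDeriv_cgf_pos (hpos : 0 < μ {1}) (hlt : μ {1} < 1) {lam : ℝ}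
    (hl : lam ∈ Set.Ioo (-lamStar) lamStar) : 0 < iteratedDeriv 2 (cgf (centred μ) μ) lam := by
  have hint := integrableExpSet_centred hexp hl
  have := isProbabilityMeasure_tilted_centred hexp hl
  rw [← variance_tilted_mul hint]
  refine lt_of_le_of_ne (variance_nonneg _ _) fun h0 => ?_
  have h2 : MemLp (centred μ) 2 (μ.tilted fun k => lam * centred μ k) := memLp_tilted_mul hint 2
  have hev : eVar[centred μ; μ.tilted fun k => lam * centred μ k] = 0 := by
    rw [← h2.ofReal_variance_eq, ← h0, ENNReal.ofReal_zero]
  rw [evariance_eq_zero_iff measurable_centred.aemeasurable] at hev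
  have hac := absolutelyContinuous_tilted (integrable_exp_centred hexp hl)
  have hae := hac.ae_le hev
  set c := ∫ x, centred μ x ∂(μ.tilted fun k => lam * centred μ k)
  change ∀ᵐ k ∂μ, centred μ k = c at hae
  rw [ae_iff_of_countable] at hae
  have hall : ∀ᵐ k ∂μ, k ∈ ({1} : Set ℕ) := by
    rw [ae_iff_of_countable]
    intro k hk
    have h3 : centred μ k = centred μ 1 := (hae k hk).trans (hae 1 hpos.ne').symm
    simp only [centred, sub_left_inj] at h3
    exact_mod_cast h3
  exact hlt.ne ((prob_compl_eq_zero_iff (measurableSet_singleton 1)).1 hall)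

include hlam hexp in
lemma iteratedDeriv_cgf_zero : iteratedDeriv 2 (cgf (centred μ) μ) 0 = siteVar μ := by
  have hint := integrableExpSet_centred hexp (lam := 0) (by simp [hlam])
  rw [iteratedDeriv_two_cgf hint, deriv_cgf_zero hint,
    integral_centred (allMoments_natCast hlam hexp), siteVar_eq]
  simp

include hlam hexp in
lemma siteVar_pos (hpos : 0 < μ {1}) (hlt : μ {1} < 1) : 0 < siteVar μ := by
  rw [← iteratedDeriv_cgf_zero hlam hexp]
  exact iteratedDeriv_cgf_pos hexp hpos hlt (by simp [hlam])

include hexp in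
lemma strictMonoOn_density (hpos : 0 < μ {1}) (hlt : μ {1} < 1) :
    StrictMonoOn (fun lam => density (tiltedProd μ lam)) (Set.Ioo (-lamStar) lamStar) := by
  have hK : StrictMonoOn (deriv (cgf (centred μ) μ)) (Set.Ioo (-lamStar) lamStar) := by
    refine strictMonoOn_of_deriv_pos (convex_Ioo _ _) (fun lam hl => ?_) fun lam hl => ?_
    · have ha := (analyticAt_cgf (integrableExpSet_centred hexp hl)).deriv
      exact ha.continuousAt.continuousWithinAt
    · rw [interior_Ioo] at hl
      have := iteratedDeriv_cgf_pos hexp hpos hlt hl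
      rwa [iteratedDeriv_succ, iteratedDeriv_one] at this
  intro a ha b hb hab
  simp only [density_tiltedProd hexp ha, density_tiltedProd hexp hb]
  linarith [hK ha hb hab]

include hexp in
/-- The chemical potential inverts the density. -/
lemma tiltParam_density (hpos : 0 < μ {1}) (hlt : μ {1} < 1) {lam : ℝ}
    (hl : lam ∈ Set.Ioo (-lamStar) lamStar) :
    tiltParam μ lamStar (density (tiltedProd μ lam)) = lam :=
  (strictMonoOn_density hexp hpos hlt).injOn.leftInvOn_invFunOn hl

/-- The centred number of particles in `Δ`. -/
noncomputable def centredSum (μ : Measure ℕ) (Δ : Finset ℤ) (η : Config) : ℝ :=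
  ∑ x ∈ Δ, centred μ (η x)

omit [IsProbabilityMeasure μ] in
lemma measurable_centredSum (Δ : Finset ℤ) : Measurable (centredSum μ Δ) :=
  Finset.measurable_sum _ fun x _ => measurable_centred.comp (measurable_pi_apply x)

/-- The expectation of a local function under the tilted product measure. -/
lemma integral_tiltedProd {lam : ℝ} (hl : Integrable (fun k => Real.exp (lam * centred μ k)) μ)
    {Δ : Finset ℤ} {f : Config → ℝ} (hf : DependsOn f (Δ : Set ℤ)) :
    ∫ η, f η ∂(tiltedProd μ lam) =
      (∫ η, f η * Real.exp (lam * centredSum μ Δ η) ∂(prodMeasure μ))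
        / mgf (centred μ) μ lam ^ Δ.card := by
  set Z := mgf (centred μ) μ lam with hZ
  have hZ0 : 0 < Z := mgf_pos hl
  have hprob : IsProbabilityMeasure (μ.tilted fun k => lam * centred μ k) :=
    isProbabilityMeasure_tilted hl
  obtain ⟨g, hg⟩ := dependsOn_iff_exists_comp.1 hf
  set W : (Δ → ℕ) → ℝ := fun a => ∏ x, Real.exp (lam * centred μ (a x)) / Z with hW
  have hW0 : ∀ a, 0 ≤ W a := fun a => Finset.prod_nonneg fun x _ => by positivity
  have hpi : Measure.pi (fun _ : Δ => μ.tilted fun k => lam * centred μ k)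
      = (Measure.pi fun _ : Δ => μ).withDensity fun a => ENNReal.ofReal (W a) := by
    refine Measure.ext_of_singleton fun a => ?_
    rw [Measure.pi_singleton, withDensity_apply _ (measurableSet_singleton a), lintegral_singleton,
      Measure.pi_singleton, hW, ENNReal.ofReal_prod_of_nonneg fun x _ => by positivity,
      ← Finset.prod_mul_distrib]
    refine Finset.prod_congr rfl fun x _ => ?_
    rw [tilted_apply, lintegral_singleton]
    rfl
  have e1 : ∫ η, f η ∂(tiltedProd μ lam)
      = ∫ a, g a ∂(Measure.pi fun _ : Δ => μ.tilted fun k => lam * centred μ k) := by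
    rw [hg]
    exact integral_restrict_infinitePi (fun _ : ℤ => μ.tilted fun k => lam * centred μ k)
      (measurable_of_countable g).aestronglyMeasurable
  have e2 : ∫ η, f η * W (Δ.restrict η) ∂(prodMeasure μ)
      = ∫ a, g a * W a ∂(Measure.pi fun _ : Δ => μ) := by
    rw [hg]
    exact integral_restrict_infinitePi (fun _ : ℤ => μ) (f := fun a => g a * W a)
      (measurable_of_countable _).aestronglyMeasurable
  rw [e1, hpi, integral_withDensity_eq_integral_toReal_smul (measurable_of_countable _)
    (.of_forall fun _ => ENNReal.ofReal_lt_top)]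
  simp only [ENNReal.toReal_ofReal (hW0 _), smul_eq_mul, mul_comm (W _)]
  rw [← e2, ← integral_div]
  refine integral_congr_ae (.of_forall fun η => ?_)
  dsimp only
  rw [mul_div_assoc]
  congr 1
  rw [hW]; dsimp only
  rw [Finset.prod_div_distrib, Finset.prod_const, Finset.card_univ, Fintype.card_coe,
    ← Real.exp_sum, centredSum, Finset.mul_sum]
  congr 2
  exact Finset.sum_coe_sort Δ fun x => lam * centred μ (η x)

include hexp in
lemma integrable_exp_centredSum (Δ : Finset ℤ) {lam : ℝ} (hl : |lam| < lamStar) :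
    Integrable (fun η => Real.exp (lam * centredSum μ Δ η)) (prodMeasure μ) := by
  have hi : iIndepFun (fun (i : ℤ) (η : Config) => centred μ (η i)) (prodMeasure μ) :=
    iIndepFun_infinitePi (P := fun _ : ℤ => μ) (X := fun _ => centred μ) fun _ => measurable_centred
  have h1 := hi.integrable_exp_mul_sum
    (fun i => measurable_centred.comp (measurable_pi_apply i)) (s := Δ) (t := lam) fun i _ => by
      have h2 : Integrable (fun k => Real.exp (lam * centred μ k)) μ :=
        integrable_exp_centred hexp (abs_lt.1 hl)
      exact (measurePreserving_eval_infinitePi (fun _ : ℤ => μ) i).integrable_comp_of_integrable h2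
  simpa [centredSum] using h1

include hlam hexp in
/-- Regularity of the tilted mean of a local function at `ρ`, and the values of its first two
derivatives (the second one when the lower ones vanish) as moments under the product measure. -/
theorem tiltedMean_regular (hpos : 0 < μ {1}) (hlt : μ {1} < 1) {Δ : Finset ℤ} {f : Config → ℝ}
    (hf : DependsOn f (Δ : Set ℤ)) (hf5 : MemLp f 5 (prodMeasure μ)) :
    ContDiffAt ℝ 2 (tiltedMean μ lamStar f) (density (prodMeasure μ)) ∧
    tiltedMean μ lamStar f (density (prodMeasure μ)) = ∫ η, f η ∂(prodMeasure μ) ∧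
    (tiltedMean μ lamStar f (density (prodMeasure μ)) = 0 →
      ∫ η, f η * centredSum μ Δ η ∂(prodMeasure μ)
        = deriv (tiltedMean μ lamStar f) (density (prodMeasure μ)) * siteVar μ) ∧
    (tiltedMean μ lamStar f (density (prodMeasure μ)) = 0 →
      deriv (tiltedMean μ lamStar f) (density (prodMeasure μ)) = 0 →
      ∫ η, f η * centredSum μ Δ η ^ 2 ∂(prodMeasure μ)
        = iteratedDeriv 2 (tiltedMean μ lamStar f) (density (prodMeasure μ)) * siteVar μ ^ 2) := by
  set ρ := density (prodMeasure μ) with hρ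
  set φ := tiltedMean μ lamStar f with hφ
  set N : ℝ → ℝ := fun t => ∫ η, f η * Real.exp (t * centredSum μ Δ η) ∂(prodMeasure μ) with hN
  set Z : ℝ → ℝ := fun t => mgf (centred μ) μ t ^ Δ.card with hZ
  set D : ℝ → ℝ := fun t => ρ + deriv (cgf (centred μ) μ) t with hD
  have h0mem : (0 : ℝ) ∈ Set.Ioo (-lamStar) lamStar := by simp [hlam]
  have hIoo : Set.Ioo (-lamStar) lamStar ∈ 𝓝 (0 : ℝ) := isOpen_Ioo.mem_nhds h0mem
  have hint0 := integrableExpSet_centred hexp h0mem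
  obtain ⟨hNa, hN1, hN2⟩ := analyticAt_integral_mul_exp (P := prodMeasure μ)
    (measurable_of_dependsOn hf) (measurable_centredSum Δ) (hf5.mono_exponent (by norm_num)) hlam
    fun t ht => integrable_exp_centredSum hexp Δ ht
  rw [← hN] at hNa hN1 hN2
  have hZa : AnalyticAt ℝ Z 0 := (analyticAt_mgf hint0).pow _
  have hZ1 : Z 0 = 1 := by simp [hZ]
  have hN0 : N 0 = ∫ η, f η ∂(prodMeasure μ) := by simp [hN]
  have hDa : AnalyticAt ℝ D 0 := analyticAt_const.add (analyticAt_cgf hint0).deriv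
  have hD0 : D 0 = ρ := by
    rw [hD]; dsimp only
    rw [deriv_cgf_zero hint0, integral_centred (allMoments_natCast hlam hexp)]; simp
  have hσ := siteVar_pos hlam hexp hpos hlt
  have hD1 : HasStrictDerivAt D (siteVar μ) 0 := by
    have h1 : deriv D 0 = siteVar μ := by
      rw [hD, deriv_const_add, ← iteratedDeriv_cgf_zero hlam hexp, iteratedDeriv_succ,
        iteratedDeriv_one]
    rw [← h1]; exact hDa.hasStrictDerivAt
  have hDens : ∀ t ∈ Set.Ioo (-lamStar) lamStar, density (tiltedProd μ t) = D t :=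
    fun t ht => density_tiltedProd hexp ht
  -- Along the family of tilted measures `φ` is a quotient of moment generating functions.
  have hφD : ∀ t ∈ Set.Ioo (-lamStar) lamStar, φ (D t) = N t / Z t := by
    intro t ht
    rw [hφ, tiltedMean, ← hDens t ht, tiltParam_density hexp hpos hlt ht,
      integral_tiltedProd (integrable_exp_centred hexp ht) hf]
  have hZpos : ∀ t ∈ Set.Ioo (-lamStar) lamStar, 0 < Z t := fun t ht =>
    pow_pos (mgf_pos (integrable_exp_centred hexp ht)) _
  have hNφ : ∀ t ∈ Set.Ioo (-lamStar) lamStar, N t = φ (D t) * Z t := fun t ht => by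
    rw [hφD t ht, div_mul_cancel₀ _ (hZpos t ht).ne']
  have hφρ : φ ρ = ∫ η, f η ∂(prodMeasure μ) := by
    rw [← hD0, hφD 0 h0mem, hZ1, hN0, div_one]
  -- Near `ρ` the chemical potential is the local inverse of the density.
  have hC : ContDiffAt ℝ 2 φ ρ := by
    set L := hD1.localInverse D (siteVar μ) 0 hσ.ne' with hL
    have hLc : ContDiffAt ℝ 2 L ρ := by
      have h1 : HasFDerivAt D ((ContinuousLinearEquiv.unitsEquivAut ℝ (Units.mk0 _ hσ.ne')) :
          ℝ →L[ℝ] ℝ) 0 := by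
        have := hD1.hasDerivAt.hasFDerivAt
        convert! this using 1
      have h2 := (hDa.contDiffAt (n := 2)).to_localInverse h1 (by norm_num)
      rw [hD0] at h2
      exact h2
    have hL0 : L ρ = 0 := by
      rw [← hD0]; exact hD1.hasStrictFDerivAt_equiv hσ.ne' |>.localInverse_apply_image
    have hright : ∀ᶠ z in 𝓝 ρ, D (L z) = z := by
      have := hD1.eventually_right_inverse hσ.ne'
      rwa [hD0] at this
    have hmem : ∀ᶠ z in 𝓝 ρ, L z ∈ Set.Ioo (-lamStar) lamStar :=
      hLc.continuousAt.eventually_mem (by rw [hL0]; exact hIoo)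
    have hev : φ =ᶠ[𝓝 ρ] fun z => N (L z) / Z (L z) := by
      filter_upwards [hright, hmem] with z h1 h2
      rw [← hφD _ h2, h1]
    refine ContDiffAt.congr_of_eventuallyEq ?_ hev
    have hNc : ContDiffAt ℝ 2 N (L ρ) := by rw [hL0]; exact hNa.contDiffAt
    have hZc : ContDiffAt ℝ 2 Z (L ρ) := by rw [hL0]; exact hZa.contDiffAt
    refine (hNc.comp ρ hLc).div (hZc.comp ρ hLc) ?_
    rw [hL0, hZ1]
    exact one_ne_zero
  refine ⟨hC, hφρ, fun hφ0 => ?_, fun hφ0 hφ1 => ?_⟩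
  · have hev : N =ᶠ[𝓝 0] fun t => φ (D t) * Z t := by
      filter_upwards [hIoo] with t ht using hNφ t ht
    have hφd : HasDerivAt φ (deriv φ ρ) (D 0) := by
      rw [hD0]; exact (hC.differentiableAt (by norm_num)).hasDerivAt
    have hprod := (hφd.comp 0 hD1.hasDerivAt).mul hZa.differentiableAt.hasDerivAt
    have hd := hprod.congr_of_eventuallyEq hev
    rw [← hN1, hd.deriv]
    simp only [Function.comp, hD0, hφ0, hZ1]
    ring
  · have hN00 : N 0 = 0 := by rw [hN0, ← hφρ, hφ0]
    have hev : N =ᶠ[𝓝 0] fun t => φ (D t) * Z t := by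
      filter_upwards [hIoo] with t ht using hNφ t ht
    have hφd : HasDerivAt φ (deriv φ ρ) (D 0) := by
      rw [hD0]; exact (hC.differentiableAt (by norm_num)).hasDerivAt
    have hN10 : deriv N 0 = 0 := by
      have hprod := (hφd.comp 0 hD1.hasDerivAt).mul hZa.differentiableAt.hasDerivAt
      have hd := hprod.congr_of_eventuallyEq hev
      rw [hd.deriv]
      simp only [Function.comp, hD0, hφ0, hφ1]
      ring
    -- Both sides of `N t = φ (D t) * Z t` are compared to second order in `t`.
    have t1 := tendsto_div_sq (hNa.contDiffAt (n := 2)) hN00 hN10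
    have t2 := tendsto_div_sq hC hφ0 hφ1
    have hDne : ∀ᶠ t in 𝓝[≠] (0 : ℝ), D t ≠ ρ := by
      filter_upwards [self_mem_nhdsWithin, nhdsWithin_le_nhds hIoo] with t h1 h2 h3
      apply h1
      rw [← hD0, ← hDens t h2, ← hDens 0 h0mem] at h3
      exact (strictMonoOn_density hexp hpos hlt).injOn h2 h0mem h3
    have hDt : Tendsto D (𝓝[≠] 0) (𝓝[≠] ρ) := by
      refine tendsto_nhdsWithin_iff.2 ⟨?_, hDne⟩
      have := hDa.continuousAt.tendsto
      rw [hD0] at this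
      exact this.mono_left nhdsWithin_le_nhds
    have hslope : Tendsto (fun t => (D t - ρ) / t) (𝓝[≠] 0) (𝓝 (siteVar μ)) := by
      refine hD1.hasDerivAt.tendsto_slope.congr fun t => ?_
      rw [slope_def_field, hD0, sub_zero]
    have hZt : Tendsto Z (𝓝[≠] 0) (𝓝 1) := by
      have := hZa.continuousAt.tendsto
      rw [hZ1] at this
      exact this.mono_left nhdsWithin_le_nhds
    have t3 := ((t2.comp hDt).mul (hslope.pow 2)).mul hZt
    have t4 : Tendsto (fun t => N t / (t - 0) ^ 2) (𝓝[≠] 0)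
        (𝓝 (iteratedDeriv 2 φ ρ / 2 * siteVar μ ^ 2 * 1)) := by
      refine t3.congr' ?_
      filter_upwards [self_mem_nhdsWithin, nhdsWithin_le_nhds hIoo, hDne] with t h1 h2 h3
      have h1' : t ≠ 0 := h1
      have h3' : D t - ρ ≠ 0 := sub_ne_zero.2 h3
      rw [hNφ t h2, sub_zero, Function.comp_apply]
      field_simp
    have := tendsto_nhds_unique t1 t4
    rw [← hN2]
    linarith

end

end Tilting

/-! ### Exchangeability -/

section Exchangeability

variable {μ : Measure ℕ} [IsProbabilityMeasure μ]

lemma measurePreserving_comp_perm (e : Equiv.Perm ℤ) :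
    MeasurePreserving (fun η : Config => η ∘ e) (prodMeasure μ) (prodMeasure μ) := by
  refine ⟨by fun_prop, ?_⟩
  have h := Measure.infinitePi_map_piCongrLeft (μ := fun _ : ℤ => μ) e.symm
  have h2 : (MeasurableEquiv.piCongrLeft (fun _ : ℤ => ℕ) e.symm : Config → Config)
      = fun η => η ∘ e := by
    funext η x
    have h3 := MeasurableEquiv.piCongrLeft_apply_apply (β := fun _ : ℤ => ℕ) e.symm η (e x)
    rw [Equiv.symm_apply_apply] at h3
    exact h3
  rw [h2] at h
  exact h

lemma integrable_comp_perm (e : Equiv.Perm ℤ) {f : Config → ℝ}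
    (hi : Integrable f (prodMeasure μ)) :
    Integrable (fun η => f (η ∘ e)) (prodMeasure μ) :=
  (measurePreserving_comp_perm e).integrable_comp_of_integrable hi

lemma condMean_comp_swap {Λ : Finset ℤ} {a b : ℤ} (ha : a ∈ Λ) (hb : b ∈ Λ) (f : Config → ℝ)
    (s : ℕ) : condMean μ Λ (fun η => f (η ∘ Equiv.swap a b)) s = condMean μ Λ f s := by
  have hS : ∀ η : Config, siteSum id Λ (η ∘ Equiv.swap a b) = siteSum id Λ η := fun η =>
    Finset.sum_equiv (Equiv.swap a b)
      (fun i => by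
        rcases eq_or_ne i a with rfl | hia
        · simp [ha, hb]
        rcases eq_or_ne i b with rfl | hib
        · simp [ha, hb]
        rw [Equiv.swap_apply_of_ne_of_ne hia hib])
      fun i _ => rfl
  have hset : {η | siteSum id Λ η = s}
      = (fun η : Config => η ∘ Equiv.swap a b) ⁻¹' {η | siteSum id Λ η = s} := by
    ext η; simp only [Set.mem_preimage, Set.mem_ofPred_eq, hS]
  have hemb : MeasurableEmbedding fun η : Config => η ∘ Equiv.swap a b := by
    refine MeasurableEmbedding.of_measurable_inverse (g := fun η => η ∘ Equiv.swap a b)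
      (by fun_prop) ?_ (by fun_prop) fun η => by funext x; simp
    have : Function.Surjective fun η : Config => η ∘ Equiv.swap a b := fun η =>
      ⟨η ∘ Equiv.swap a b, by funext x; simp⟩
    rw [this.range_eq]; exact MeasurableSet.univ
  rw [condMean, condMean]
  congr 1
  conv_lhs => rw [hset]
  exact (measurePreserving_comp_perm (Equiv.swap a b)).setIntegral_preimage_emb hemb f _

/-- Exchangeability under a canonical field. -/
lemma condExp_comp_swap {Λ : Finset ℤ} {m : MeasurableSpace Config} (hm : IsCanonicalField μ Λ m)
    {a b : ℤ} (ha : a ∈ Λ) (hb : b ∈ Λ) {f : Config → ℝ} (hf : DependsOn f (Λ : Set ℤ))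
    (hi : Integrable f (prodMeasure μ)) :
    (prodMeasure μ)[fun η => f (η ∘ Equiv.swap a b) | m] =ᵐ[prodMeasure μ]
      (prodMeasure μ)[f | m] := by
  have hf' : DependsOn (fun η => f (η ∘ Equiv.swap a b)) (Λ : Set ℤ) := fun u v huv =>
    hf fun i hi => huv _ (by
      rcases eq_or_ne i a with rfl | hia
      · simpa using hb
      rcases eq_or_ne i b with rfl | hib
      · simpa using ha
      rwa [Equiv.swap_apply_of_ne_of_ne hia hib])
  have hi' := integrable_comp_perm (Equiv.swap a b) hi
  filter_upwards [condExp_ae_eq hm hf' hi', condExp_ae_eq hm hf hi] with η h1 h2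
  rw [h1, h2, condMean_comp_swap ha hb]

variable {Λ : Finset ℤ}

lemma dependsOn_site {β : Type*} (h : ℕ → β) {x : ℤ} {s : Set ℤ} (hx : x ∈ s) :
    DependsOn (fun η : Config => h (η x)) s := fun _ _ hab => by
  dsimp only; rw [hab x hx]

lemma dependsOn_op {β γ δ : Type*} (op : β → γ → δ) {f : Config → β} {g : Config → γ} {s : Set ℤ}
    (hf : DependsOn f s) (hg : DependsOn g s) : DependsOn (fun η => op (f η) (g η)) s :=
  fun _ _ hab => by dsimp only; rw [hf hab, hg hab]

lemma condExp_site_eq {m : MeasurableSpace Config} (hm : IsCanonicalField μ Λ m) {h : ℕ → ℝ}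
    (hh : AllMoments h μ) {x y : ℤ} (hx : x ∈ Λ) (hy : y ∈ Λ) :
    (prodMeasure μ)[fun η => h (η x) | m] =ᵐ[prodMeasure μ]
      (prodMeasure μ)[fun η => h (η y) | m] := by
  have h1 := condExp_comp_swap hm hx hy (dependsOn_site h (Finset.mem_coe.2 hy))
    (allMoments_site hh y).integrable
  simpa using h1

lemma condExp_pair_eq {m : MeasurableSpace Config} (hm : IsCanonicalField μ Λ m) {h : ℕ → ℝ}
    (hh : AllMoments h μ) {x y x' y' : ℤ} (hx : x ∈ Λ) (hy : y ∈ Λ) (hx' : x' ∈ Λ) (hy' : y' ∈ Λ)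
    (hxy : x ≠ y) (hxy' : x' ≠ y') :
    (prodMeasure μ)[fun η => h (η x) * h (η y) | m] =ᵐ[prodMeasure μ]
      (prodMeasure μ)[fun η => h (η x') * h (η y') | m] := by
  have key : ∀ {u v a b : ℤ}, u ∈ Λ → v ∈ Λ → a ∈ Λ → b ∈ Λ →
      (prodMeasure μ)[fun η => h (η (Equiv.swap a b u)) * h (η (Equiv.swap a b v)) | m]
        =ᵐ[prodMeasure μ] (prodMeasure μ)[fun η => h (η u) * h (η v) | m] := fun hu hv ha hb =>
    condExp_comp_swap hm ha hb (dependsOn_op (· * ·) (dependsOn_site h (Finset.mem_coe.2 hu))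
      (dependsOn_site h (Finset.mem_coe.2 hv)))
      ((allMoments_site hh _).mul (allMoments_site hh _)).integrable
  -- First move `x` to `x'`, then the image of `y` to `y'`.
  set w := Equiv.swap x x' y with hw
  have hwΛ : w ∈ Λ := by
    rw [hw, Equiv.swap_apply_def]; split_ifs <;> assumption
  have hwx : x' ≠ w := fun h0 => hxy (by
    have : Equiv.swap x x' x = Equiv.swap x x' y := by rw [Equiv.swap_apply_left, ← hw, ← h0]
    exact (Equiv.swap x x').injective this)
  have h1 := key hx hy hx hx'
  rw [Equiv.swap_apply_left, ← hw] at h1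
  have h2 := key hx' hwΛ hwΛ hy'
  rw [Equiv.swap_apply_left, Equiv.swap_apply_of_ne_of_ne hwx hxy'] at h2
  exact h1.symm.trans h2.symm

omit [IsProbabilityMeasure μ] in
lemma centredSum_eq (Λ : Finset ℤ) (η : Config) :
    centredSum μ Λ η = (siteSum id Λ η : ℝ) - Λ.card * density (prodMeasure μ) := by
  simp [centredSum, centred, siteSum, Finset.sum_sub_distrib]

lemma allMoments_centredSum (hc : AllMoments (centred μ) μ) (Λ : Finset ℤ) :
    AllMoments (centredSum μ Λ) (prodMeasure μ) :=
  AllMoments.sum Λ fun x _ => allMoments_site hc x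

lemma condExp_centredSum_pow {m : MeasurableSpace Config} (hm : IsCanonicalField μ Λ m)
    (hc : AllMoments (centred μ) μ) (j : ℕ) :
    (prodMeasure μ)[fun η => centredSum μ Λ η ^ j | m] = fun η => centredSum μ Λ η ^ j := by
  refine condExp_of_stronglyMeasurable hm.le ?_
    ((allMoments_centredSum hc Λ).pow j).integrable
  have h : (fun η => centredSum μ Λ η ^ j) =
      (fun s : ℕ => ((s : ℝ) - Λ.card * density (prodMeasure μ)) ^ j) ∘ siteSum id Λ := by
    funext η; simp [centredSum_eq]
  rw [h]
  exact ((measurable_of_countable _).comp hm.measurable).stronglyMeasurable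

/-- The conditional mean of one centred occupation number is the centred empirical density. -/
lemma condExp_centred {m : MeasurableSpace Config} (hm : IsCanonicalField μ Λ m)
    (hc : AllMoments (centred μ) μ) {x : ℤ} (hx : x ∈ Λ) :
    (prodMeasure μ)[fun η => centred μ (η x) | m] =ᵐ[prodMeasure μ]
      fun η => centredSum μ Λ η / Λ.card := by
  have h1 := condExp_centredSum_pow hm hc 1
  simp only [pow_one] at h1
  have h2 := condExp_finsetSum (μ := prodMeasure μ) (s := Λ)
    (f := fun y (η : Config) => centred μ (η y))
    (fun y _ => (allMoments_site hc y).integrable) m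
  have h3 : (∑ y ∈ Λ, fun η : Config => centred μ (η y)) = centredSum μ Λ := by
    funext η; simp [centredSum]
  rw [h3] at h2
  have h4 : ∀ᵐ η ∂(prodMeasure μ), ∀ y ∈ Λ, (prodMeasure μ)[fun η => centred μ (η y) | m] η
      = (prodMeasure μ)[fun η => centred μ (η x) | m] η :=
    (Finset.eventually_all Λ).2 fun y hy => condExp_site_eq hm hc hy hx
  filter_upwards [h2, h4] with η e2 e4
  have hn : (Λ.card : ℝ) ≠ 0 := by exact_mod_cast (Finset.card_pos.2 ⟨x, hx⟩).ne'
  rw [← congrFun h1 η, e2, Finset.sum_apply, Finset.sum_congr rfl e4, Finset.sum_const,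
    nsmul_eq_mul, mul_div_cancel_left₀ _ hn]

/-- The square of the centred number of particles, expressed by the conditional two-site and
one-site second moments. -/
lemma centredSum_sq_ae_eq {m : MeasurableSpace Config} (hm : IsCanonicalField μ Λ m)
    (hc : AllMoments (centred μ) μ) {x y : ℤ} (hx : x ∈ Λ) (hy : y ∈ Λ) (hxy : x ≠ y) :
    (fun η => centredSum μ Λ η ^ 2) =ᵐ[prodMeasure μ] fun η =>
      Λ.card * (prodMeasure μ)[fun η => centred μ (η x) ^ 2 | m] η
      + Λ.card * (Λ.card - 1)
        * (prodMeasure μ)[fun η => centred μ (η x) * centred μ (η y) | m] η := by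
  have h1 := condExp_centredSum_pow hm hc 2
  have h2 := condExp_finsetSum (μ := prodMeasure μ) (s := Λ ×ˢ Λ)
    (f := fun p (η : Config) => centred μ (η p.1) * centred μ (η p.2))
    (fun p _ => ((allMoments_site hc p.1).mul (allMoments_site hc p.2)).integrable) m
  have h3 : (∑ p ∈ Λ ×ˢ Λ, fun η : Config => centred μ (η p.1) * centred μ (η p.2))
      = fun η => centredSum μ Λ η ^ 2 := by
    funext η
    simp only [Finset.sum_apply, centredSum, sq, Finset.sum_mul_sum, Finset.sum_product]
  rw [h3] at h2
  have h4 : ∀ᵐ η ∂(prodMeasure μ), ∀ p ∈ Λ ×ˢ Λ,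
      (prodMeasure μ)[fun η => centred μ (η p.1) * centred μ (η p.2) | m] η
      = if p.1 = p.2 then (prodMeasure μ)[fun η => centred μ (η x) ^ 2 | m] η
        else (prodMeasure μ)[fun η => centred μ (η x) * centred μ (η y) | m] η := by
    refine (Finset.eventually_all _).2 fun p hp => ?_
    rw [Finset.mem_product] at hp
    by_cases h : p.1 = p.2
    · simp only [h, if_true, ← sq]
      exact condExp_site_eq hm (h := fun k => centred μ k ^ 2) (hc.pow 2) hp.2 hx
    · simp only [h, if_false]
      exact condExp_pair_eq hm hc hp.1 hp.2 hx hy h hxy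
  filter_upwards [h2, h4] with η e2 e4
  rw [← congrFun h1 η, e2, Finset.sum_apply, Finset.sum_congr rfl e4, Finset.sum_product]
  have h5 : ∀ a b : ℝ, ∀ u ∈ Λ, ∑ v ∈ Λ, (if u = v then a else b) = a + (Λ.card - 1) * b := by
    intro a b u hu
    rw [← Finset.add_sum_erase _ _ hu, if_pos rfl, Finset.sum_congr rfl fun v hv =>
      if_neg (Finset.ne_of_mem_erase hv).symm, Finset.sum_const, Finset.card_erase_of_mem hu,
      nsmul_eq_mul, Nat.cast_sub (Finset.card_pos.2 ⟨u, hu⟩), Nat.cast_one]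
  rw [Finset.sum_congr rfl (h5 _ _), Finset.sum_const, nsmul_eq_mul]
  ring

end Exchangeability

/-! ### Examples of canonical fields -/

section CanonicalFields

variable {μ : Measure ℕ} [IsProbabilityMeasure μ]

omit [IsProbabilityMeasure μ] in
lemma isCanonicalField_comap {β : Type*} [MeasurableSpace β] {Λ : Finset ℤ} {F : Config → β}
    (hF : Measurable F) (V : ℕ → Set β) (hV : ∀ s, MeasurableSet (V s))
    (hS : ∀ s, siteSum id Λ ⁻¹' {s} = F ⁻¹' V s)
    (hsplit : ∀ U, MeasurableSet U → ∀ s, ∃ B : Set Config,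
      F ⁻¹' U ∩ {η | siteSum id Λ η = s} = B ∩ {η | siteSum id Λ η = s} ∧
      ∀ f : Config → ℝ, DependsOn f (Λ : Set ℤ) →
        ∫ η in B, f η ∂(prodMeasure μ) = (prodMeasure μ).real B * ∫ η, f η ∂(prodMeasure μ)) :
    IsCanonicalField μ Λ (MeasurableSpace.comap F inferInstance) where
  le := hF.comap_le
  measurable := by
    refine @measurable_to_countable' ℕ Config _ _ (MeasurableSpace.comap F inferInstance) _
      fun s => ?_
    rw [hS]
    exact ⟨V s, hV s, rfl⟩
  split := by
    rintro _ ⟨U, hU, rfl⟩ s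
    exact hsplit U hU s

/-- Conditioning on an injective function of the number of particles in `Λ`. -/
lemma isCanonicalField_comap_siteSum {Λ : Finset ℤ} {g : ℕ → ℝ} (hg : Function.Injective g) :
    IsCanonicalField μ Λ (MeasurableSpace.comap (fun η => g (siteSum id Λ η)) inferInstance) := by
  refine isCanonicalField_comap ((measurable_of_countable g).comp (measurable_siteSum id Λ))
    (fun s => {g s}) (fun s => measurableSet_singleton _) (fun s => ?_) fun U _ s => ?_
  · ext η; simp [hg.eq_iff]
  · by_cases h : g s ∈ U
    · refine ⟨Set.univ, ?_, fun f _ => by simp⟩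
      ext η; simp only [Set.mem_inter_iff, Set.mem_preimage, Set.mem_ofPred_eq, Set.mem_univ]
      constructor
      · rintro ⟨_, h2⟩; exact ⟨trivial, h2⟩
      · rintro ⟨_, h2⟩; exact ⟨by rwa [h2], h2⟩
    · refine ⟨∅, ?_, fun f _ => by simp⟩
      ext η; simp only [Set.mem_inter_iff, Set.mem_preimage, Set.mem_ofPred_eq,
        Set.mem_empty_iff_false, false_and, iff_false, not_and]
      rintro h1 h2; exact h (by rwa [h2] at h1)

/-- Conditioning on an injective function of the number of particles in `Λ` and on the
configuration outside `Λ`. -/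
lemma isCanonicalField_comap_prod {Λ : Finset ℤ} {g : ℕ → ℝ} (hg : Function.Injective g) :
    IsCanonicalField μ Λ (MeasurableSpace.comap (fun η : Config =>
      (g (siteSum id Λ η), fun x : {x : ℤ // x ∉ Λ} => η x)) inferInstance) := by
  have hout : Measurable fun (η : Config) (x : {x : ℤ // x ∉ Λ}) => η x := by fun_prop
  refine isCanonicalField_comap
    (((measurable_of_countable g).comp (measurable_siteSum id Λ)).prodMk hout)
    (fun s => Prod.fst ⁻¹' {g s}) (fun s => measurable_fst (measurableSet_singleton _))
    (fun s => ?_) fun U hU s => ?_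
  · ext η; simp [hg.eq_iff]
  have hUs : MeasurableSet {a : {x : ℤ // x ∉ Λ} → ℕ | (g s, a) ∈ U} :=
    measurable_prodMk_left hU
  refine ⟨(fun (η : Config) (x : {x : ℤ // x ∉ Λ}) => η x) ⁻¹' {a | (g s, a) ∈ U}, ?_,
    fun f hf => ?_⟩
  · ext η; simp only [Set.mem_inter_iff, Set.mem_preimage, Set.mem_ofPred_eq, and_congr_left_iff]
    rintro h2; rw [h2]
  have hB := hout hUs
  obtain ⟨f', rfl⟩ := dependsOn_iff_exists_comp.1 hf
  have hfm := measurable_of_dependsOn hf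
  have hd : Disjoint (Λ : Set ℤ) {x | x ∉ Λ} := by
    rw [Set.disjoint_left]; intro x h1 h2; exact h2 h1
  have hone : Measurable ({a : {x : ℤ // x ∉ Λ} → ℕ | (g s, a) ∈ U}.indicator fun _ => (1 : ℝ)) :=
    measurable_const.indicator hUs
  have hind := (indepFun_domRestrict μ hd).comp (measurable_of_countable f')
    hone
  have h1 := hind.integral_fun_mul_eq_mul_integral hfm.aestronglyMeasurable
    (hone.comp hout).aestronglyMeasurable
  rw [← integral_indicator hB]
  have e1 : ∫ η, ((fun (η : Config) (x : {x : ℤ // x ∉ Λ}) => η x) ⁻¹'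
      {a | (g s, a) ∈ U}).indicator (fun _ => (1 : ℝ)) η ∂(prodMeasure μ) = (prodMeasure μ).real
        ((fun (η : Config) (x : {x : ℤ // x ∉ Λ}) => η x) ⁻¹' {a | (g s, a) ∈ U}) := by
    rw [integral_indicator_const _ hB]; simp
  rw [← e1, mul_comm]
  refine Eq.trans (integral_congr_ae (.of_forall fun η => ?_)) h1
  by_cases h : (g s, fun x : {x : ℤ // x ∉ Λ} => η x) ∈ U
  · dsimp only [Function.comp_apply]
    rw [Set.indicator_of_mem (by exact h), Set.indicator_of_mem (by exact h), mul_one]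
    rfl
  · dsimp only [Function.comp_apply]
    rw [Set.indicator_of_notMem (by exact h), Set.indicator_of_notMem (by exact h), mul_zero]

end CanonicalFields

/-! ### Moments against the centred particle number -/

section CentredMoments

variable {μ : Measure ℕ} [IsProbabilityMeasure μ]

/-- Orthogonality to powers of the centred number of particles is orthogonality to powers of the
number of particles. -/
lemma integral_mul_siteSum_pow_eq_zero (hc : AllMoments (centred μ) μ) {f : Config → ℝ}
    (hf5 : MemLp f 5 (prodMeasure μ)) {Δ : Finset ℤ} {r : ℕ}
    (h : ∀ i < r, ∫ η, f η * centredSum μ Δ η ^ i ∂(prodMeasure μ) = 0) :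
    ∀ i < r, ∫ η, f η * (siteSum id Δ η : ℝ) ^ i ∂(prodMeasure μ) = 0 := by
  intro i hi
  have e : ∀ η, f η * (siteSum id Δ η : ℝ) ^ i = ∑ j ∈ Finset.range (i + 1),
      f η * centredSum μ Δ η ^ j
        * ((Δ.card * density (prodMeasure μ)) ^ (i - j) * (i.choose j : ℝ)) := by
    intro η
    rw [show (siteSum id Δ η : ℝ) = centredSum μ Δ η + Δ.card * density (prodMeasure μ) by
      rw [centredSum_eq]; ring, add_pow, Finset.mul_sum]
    exact Finset.sum_congr rfl fun j _ => by ring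
  simp_rw [e]
  rw [integral_finsetSum]
  · refine Finset.sum_eq_zero fun j hj => ?_
    rw [integral_mul_const, h j (by have := Finset.mem_range.1 hj; omega), zero_mul]
  · exact fun j _ => (((allMoments_centredSum hc Δ).pow j).integrable_mul hf5).mul_const _

lemma integral_centred_mul_eq_zero (h0 : ∫ k, centred μ k ∂μ = 0) {x : ℤ} {G : Config → ℝ}
    {Δ : Finset ℤ} (hx : x ∉ Δ) (hG : DependsOn G (Δ : Set ℤ)) :
    ∫ η, centred μ (η x) * G η ∂(prodMeasure μ) = 0 := by
  rw [integral_mul_of_dependsOn (Δ := {x}) (f := fun η => centred μ (η x)) (by simpa using hx)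
    (dependsOn_site _ (by simp)) hG, integral_site, h0, zero_mul]

omit [IsProbabilityMeasure μ] in
lemma dependsOn_centredSum (Δ : Finset ℤ) : DependsOn (centredSum μ Δ) (Δ : Set ℤ) :=
  fun _ _ h => Finset.sum_congr rfl fun x hx => by rw [h x hx]

omit [IsProbabilityMeasure μ] in
lemma centredSum_erase {Δ : Finset ℤ} {x : ℤ} (hx : x ∈ Δ) (η : Config) :
    centredSum μ Δ η = centred μ (η x) + centredSum μ (Δ.erase x) η :=
  (Finset.add_sum_erase _ _ hx).symm

variable (hc : AllMoments (centred μ) μ) (h0 : ∫ k, centred μ k ∂μ = 0)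

include hc h0

lemma integral_centred_mul_centredSum {Δ : Finset ℤ} {x : ℤ} (hx : x ∈ Δ) :
    ∫ η, centred μ (η x) * centredSum μ Δ η ∂(prodMeasure μ) = siteVar μ := by
  have hX := allMoments_site hc x
  have hR := allMoments_centredSum hc (Δ.erase x)
  have e : ∀ η, centred μ (η x) * centredSum μ Δ η
      = centred μ (η x) ^ 2 + centred μ (η x) * centredSum μ (Δ.erase x) η := fun η => by
    rw [centredSum_erase hx]; ring
  simp_rw [e]
  rw [integral_add (hX.pow 2).integrable (hX.mul hR).integrable,
    integral_centred_mul_eq_zero h0 (Finset.notMem_erase x Δ) (dependsOn_centredSum _),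
    integral_site (fun k => centred μ k ^ 2), siteVar_eq, add_zero]

lemma integral_centredSum_sq (Δ : Finset ℤ) :
    ∫ η, centredSum μ Δ η ^ 2 ∂(prodMeasure μ) = Δ.card * siteVar μ := by
  have e : ∀ η, centredSum μ Δ η ^ 2 = ∑ x ∈ Δ, centred μ (η x) * centredSum μ Δ η := fun η => by
    rw [← Finset.sum_mul, sq]; rfl
  simp_rw [e]
  rw [integral_finsetSum _ fun x _ =>
      ((allMoments_site hc x).mul (allMoments_centredSum hc Δ)).integrable,
    Finset.sum_congr rfl fun x hx => integral_centred_mul_centredSum hc h0 hx, Finset.sum_const,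
    nsmul_eq_mul]

/-- The two-site function `(η x - ρ) (η y - ρ)` is orthogonal to polynomials of degree `≤ 1` in the
number of particles; its second moment is `2 σ⁴`. -/
lemma integral_pair_mul_centredSum {Δ : Finset ℤ} {x y : ℤ} (hx : x ∈ Δ) (hy : y ∈ Δ)
    (hxy : x ≠ y) :
    ∫ η, centred μ (η x) * centred μ (η y) ∂(prodMeasure μ) = 0 ∧
    ∫ η, centred μ (η x) * centred μ (η y) * centredSum μ Δ η ∂(prodMeasure μ) = 0 ∧
    ∫ η, centred μ (η x) * centred μ (η y) * centredSum μ Δ η ^ 2 ∂(prodMeasure μ)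
      = 2 * siteVar μ ^ 2 := by
  have hX := allMoments_site hc x
  have hY := allMoments_site hc y
  have hy' : y ∈ Δ.erase x := Finset.mem_erase.2 ⟨hxy.symm, hy⟩
  set Δ' := (Δ.erase x).erase y with hΔ'
  set R := centredSum μ Δ' with hRdef
  have hR : AllMoments R (prodMeasure μ) := allMoments_centredSum hc Δ'
  have hS : ∀ η, centredSum μ Δ η = centred μ (η x) + centred μ (η y) + R η := fun η => by
    rw [centredSum_erase hx, centredSum_erase hy', add_assoc]
  -- `R` together with one of the two sites is independent of the other site.
  have hRx : DependsOn R ((Δ.erase x : Finset ℤ) : Set ℤ) :=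
    (dependsOn_centredSum Δ').mono (Finset.coe_subset.2 (Finset.erase_subset _ _))
  have hRy : DependsOn R ((Δ.erase y : Finset ℤ) : Set ℤ) :=
    (dependsOn_centredSum Δ').mono (Finset.coe_subset.2 (by
      rw [hΔ', Finset.erase_right_comm]; exact Finset.erase_subset _ _))
  have hyx : DependsOn (fun η : Config => centred μ (η y)) ((Δ.erase x : Finset ℤ) : Set ℤ) :=
    dependsOn_site _ (Finset.mem_coe.2 hy')
  have hxy' : DependsOn (fun η : Config => centred μ (η x)) ((Δ.erase y : Finset ℤ) : Set ℤ) :=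
    dependsOn_site _ (Finset.mem_coe.2 (Finset.mem_erase.2 ⟨hxy, hx⟩))
  have zx : ∀ {G : Config → ℝ}, DependsOn G ((Δ.erase x : Finset ℤ) : Set ℤ) →
      ∫ η, centred μ (η x) * G η ∂(prodMeasure μ) = 0 := fun hG =>
    integral_centred_mul_eq_zero h0 (Finset.notMem_erase x Δ) hG
  have zy : ∀ {G : Config → ℝ}, DependsOn G ((Δ.erase y : Finset ℤ) : Set ℤ) →
      ∫ η, centred μ (η y) * G η ∂(prodMeasure μ) = 0 := fun hG =>
    integral_centred_mul_eq_zero h0 (Finset.notMem_erase y Δ) hG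
  refine ⟨zx hyx, ?_, ?_⟩
  · have e : ∀ η, centred μ (η x) * centred μ (η y) * centredSum μ Δ η
        = centred μ (η y) * centred μ (η x) ^ 2
          + centred μ (η x) * (centred μ (η y) ^ 2 + centred μ (η y) * R η) := fun η => by
      rw [hS]; ring
    simp_rw [e]
    rw [integral_add (hY.mul (hX.pow 2)).integrable
      (hX.mul ((hY.pow 2).add (hY.mul hR))).integrable,
      zx (G := fun η => centred μ (η y) ^ 2 + centred μ (η y) * R η)
        (dependsOn_op (fun a b => a ^ 2 + a * b) hyx hRx),
      zy (G := fun η => centred μ (η x) ^ 2) (dependsOn_op (fun a _ => a ^ 2) hxy' hxy'), add_zero]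
  · have e : ∀ η, centred μ (η x) * centred μ (η y) * centredSum μ Δ η ^ 2
        = centred μ (η y) * (centred μ (η x) ^ 3 + 2 * (centred μ (η x) ^ 2 * R η))
          + (centred μ (η x) * (centred μ (η y) ^ 3 + (centred μ (η y) * R η ^ 2
            + 2 * (centred μ (η y) ^ 2 * R η)))
          + 2 * (centred μ (η x) ^ 2 * centred μ (η y) ^ 2)) := fun η => by
      rw [hS]; ring
    simp_rw [e]
    rw [integral_add (hY.mul ((hX.pow 3).add (((hX.pow 2).mul hR).const_mul 2))).integrable
        ((hX.mul ((hY.pow 3).add ((hY.mul (hR.pow 2)).add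
          (((hY.pow 2).mul hR).const_mul 2)))).add
          (((hX.pow 2).mul (hY.pow 2)).const_mul 2)).integrable,
      integral_add (hX.mul ((hY.pow 3).add ((hY.mul (hR.pow 2)).add
          (((hY.pow 2).mul hR).const_mul 2)))).integrable
          (((hX.pow 2).mul (hY.pow 2)).const_mul 2).integrable,
      zx (G := fun η => centred μ (η y) ^ 3 + (centred μ (η y) * R η ^ 2
            + 2 * (centred μ (η y) ^ 2 * R η)))
        (dependsOn_op (fun a b => a ^ 3 + (a * b ^ 2 + 2 * (a ^ 2 * b))) hyx hRx),
      zy (G := fun η => centred μ (η x) ^ 3 + 2 * (centred μ (η x) ^ 2 * R η))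
        (dependsOn_op (fun a b => a ^ 3 + 2 * (a ^ 2 * b)) hxy' hRy),
      integral_const_mul,
      integral_mul_of_dependsOn (Δ := {x}) (Δ' := {y}) (f := fun η => centred μ (η x) ^ 2)
        (h := fun η => centred μ (η y) ^ 2) (by simpa using hxy)
        (dependsOn_site (fun k => centred μ k ^ 2) (by simp))
        (dependsOn_site (fun k => centred μ k ^ 2) (by simp)),
      integral_site (fun k => centred μ k ^ 2), integral_site (fun k => centred μ k ^ 2),
      ← siteVar_eq]
    ring

end CentredMoments

/-! ### Expansion of canonical expectations -/

section Expansion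

lemma enorm_integral_mul_le {Ω : Type*} {mΩ : MeasurableSpace Ω} {P : Measure Ω}
    [IsProbabilityMeasure P] {f Y : Ω → ℝ} (hf : MemLp f 5 P) (hY : AllMoments Y P) :
    ‖∫ ω, f ω * Y ω ∂P‖ₑ ≤ eLpNorm Y 2 P * eLpNorm f 5 P := by
  have hY2 : MemLp Y 2 P := hY 2
  calc ‖∫ ω, f ω * Y ω ∂P‖ₑ ≤ ∫⁻ ω, ‖f ω * Y ω‖ₑ ∂P := enorm_integral_le_lintegral_enorm _
    _ = eLpNorm (Y • f) 1 P := by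
        rw [eLpNorm_one_eq_lintegral_enorm]; simp [mul_comm]
    _ ≤ eLpNorm Y 2 P * eLpNorm f 2 P := eLpNorm_smul_le_mul_eLpNorm hf.1 hY2.1
    _ ≤ eLpNorm Y 2 P * eLpNorm f 5 P := by
        gcongr
        exact eLpNorm_le_eLpNorm_of_exponent_le (by norm_num) hf.1

/-- A bound of a coefficient determined by one moment of `f`. -/
lemma exists_coefficient_bound {Ω : Type*} {mΩ : MeasurableSpace Ω} {P : Measure Ω}
    [IsProbabilityMeasure P] {Y : Ω → ℝ} (hY : AllMoments Y P) {v : ℝ} (hv : 0 < v) :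
    ∃ K : ℝ, 0 ≤ K ∧ ∀ f : Ω → ℝ, MemLp f 5 P → ∀ c : ℝ, ∫ ω, f ω * Y ω ∂P = c * v →
      ‖c‖ₑ ≤ ENNReal.ofReal K * eLpNorm f 5 P := by
  have hY2 : MemLp Y 2 P := hY 2
  refine ⟨v⁻¹ * (eLpNorm Y 2 P).toReal, by positivity, fun f hf c h => ?_⟩
  have h1 := enorm_integral_mul_le hf hY
  have h2 : c = v⁻¹ * ∫ ω, f ω * Y ω ∂P := by rw [h]; field_simp
  rw [h2, enorm_mul, Real.enorm_eq_ofReal (by positivity), ENNReal.ofReal_mul (by positivity),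
    ENNReal.ofReal_toReal hY2.2.ne, mul_assoc]
  gcongr

/-- Subtracting a controlled multiple of a fixed function keeps the norm controlled. -/
lemma eLpNorm_sub_const_mul_le {Ω : Type*} {mΩ : MeasurableSpace Ω} {P : Measure Ω}
    {f g Y : Ω → ℝ} {p q : ℝ≥0∞} (hp : 1 ≤ p) (hg : AEStronglyMeasurable g P)
    (hgf : eLpNorm g p P ≤ eLpNorm f q P) (hY : MemLp Y p P) {K c : ℝ} (hK : 0 ≤ K)
    (hc : ‖c‖ₑ ≤ ENNReal.ofReal K * eLpNorm f q P) :
    eLpNorm (fun ω => g ω - c * Y ω) p P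
      ≤ ENNReal.ofReal (1 + K * (eLpNorm Y p P).toReal) * eLpNorm f q P := by
  calc eLpNorm (fun ω => g ω - c * Y ω) p P ≤ eLpNorm g p P + eLpNorm (c • Y) p P :=
        eLpNorm_sub_le hg (hY.1.const_smul c) hp
    _ ≤ eLpNorm f q P + ENNReal.ofReal K * eLpNorm f q P * eLpNorm Y p P := by
        rw [eLpNorm_const_smul]; gcongr
    _ = _ := by
        rw [ENNReal.ofReal_add zero_le_one (by positivity), ENNReal.ofReal_mul hK,
          ENNReal.ofReal_toReal hY.2.ne, ENNReal.ofReal_one]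
        ring

variable {μ : Measure ℕ} [IsProbabilityMeasure μ]

omit [IsProbabilityMeasure μ] in
lemma memLp_five {X : Config → ℝ} (h : AllMoments X (prodMeasure μ)) :
    MemLp X 5 (prodMeasure μ) := h 5

omit [IsProbabilityMeasure μ] in
lemma memLp_four {X : Config → ℝ} (h : AllMoments X (prodMeasure μ)) :
    MemLp X 4 (prodMeasure μ) := h 4

omit [IsProbabilityMeasure μ] in
lemma condExp_sub_const_mul {m : MeasurableSpace Config} {f Y : Config → ℝ}
    (hf : Integrable f (prodMeasure μ)) (hY : Integrable Y (prodMeasure μ)) (c : ℝ) :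
    (prodMeasure μ)[fun η => f η - c * Y η | m] =ᵐ[prodMeasure μ]
      fun η => (prodMeasure μ)[f | m] η - c * (prodMeasure μ)[Y | m] η := by
  have h1 := condExp_sub hf (hY.const_mul c) m
  have h2 := condExp_smul (μ := prodMeasure μ) c Y m
  filter_upwards [h1, h2] with η e1 e2
  refine Eq.trans e1 ?_
  rw [Pi.sub_apply]
  congr 1

omit [IsProbabilityMeasure μ] in
lemma aestronglyMeasurable_condExp {m : MeasurableSpace Config} (hm : m ≤ MeasurableSpace.pi)
    (w : Config → ℝ) :
    AEStronglyMeasurable[MeasurableSpace.pi] ((prodMeasure μ)[w | m]) (prodMeasure μ) :=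
  (stronglyMeasurable_condExp.mono hm).aestronglyMeasurable

lemma eLpNorm_condExp_sub_le {m : MeasurableSpace Config} (f Y : Config → ℝ)
    (hY : MemLp Y 4 (prodMeasure μ)) (hf : MemLp f 5 (prodMeasure μ)) (hm : m ≤ MeasurableSpace.pi)
    {K c : ℝ} (hK : 0 ≤ K) (hc : ‖c‖ₑ ≤ ENNReal.ofReal K * eLpNorm f 5 (prodMeasure μ)) :
    eLpNorm (fun η => (prodMeasure μ)[f | m] η - c * Y η) 4 (prodMeasure μ)
      ≤ ENNReal.ofReal (1 + K * (eLpNorm Y 4 (prodMeasure μ)).toReal)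
        * eLpNorm f 5 (prodMeasure μ) :=
  eLpNorm_sub_const_mul_le (by norm_num)
    (aestronglyMeasurable_condExp hm f)
    ((eLpNorm_condExp_le_eLpNorm f (by norm_num)).trans
      (eLpNorm_le_eLpNorm_of_exponent_le (by norm_num) hf.1)) hY hK hc

variable (hpos : 0 < μ {1}) (hlt : μ {1} < 1) {lamStar : ℝ} (hlam : 0 < lamStar)
  (hexp : ∀ lam : ℝ, |lam| ≤ lamStar → Integrable (fun k : ℕ => Real.exp (lam * (k : ℝ))) μ)

include hpos hlt hlam hexp

/-- The two-site canonical correlation is the quadratic polynomial of the empirical density, up to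
`O (|Λ| ^ (-3 / 2))`. -/
lemma exists_pair_bound {Δ : Finset ℤ} {x y : ℤ} (hx : x ∈ Δ) (hy : y ∈ Δ) (hxy : x ≠ y) :
    ∃ D : ℝ, 0 ≤ D ∧ ∀ Λ : Finset ℤ, Δ ⊆ Λ → ∀ m, IsCanonicalField μ Λ m →
      eLpNorm (fun η => (prodMeasure μ)[fun η => centred μ (η x) * centred μ (η y) | m] η
          - ((centredSum μ Λ η / Λ.card) ^ 2 - siteVar μ / Λ.card)) 4 (prodMeasure μ)
        ≤ ENNReal.ofReal (D / (Λ.card : ℝ) ^ (3 / 2 : ℝ)) := by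
  have hc := allMoments_centred hlam hexp
  have h0 := integral_centred (allMoments_natCast hlam hexp)
  have hX := allMoments_site hc x
  have hY := allMoments_site hc y
  obtain ⟨C1, hC1, hB1⟩ := exists_canonical_bound hpos hlt hlam hexp Δ (r := 1) (by norm_num)
  obtain ⟨C2, hC2, hB2⟩ := exists_canonical_bound hpos hlt hlam hexp Δ (r := 2) (by norm_num)
  set u : Config → ℝ := fun η => centred μ (η x) * centred μ (η y) with hu
  set v : Config → ℝ := fun η => centred μ (η x) ^ 2 - siteVar μ * 1 with hv
  have hu5 := memLp_five (hX.mul hY)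
  have hv5 : MemLp v 5 (prodMeasure μ) := (memLp_five (hX.pow 2)).sub (memLp_const _)
  have hX2i := (hX.pow 2).integrable
  have hudep : DependsOn u (Δ : Set ℤ) := dependsOn_op (· * ·)
    (dependsOn_site _ (Finset.mem_coe.2 hx)) (dependsOn_site _ (Finset.mem_coe.2 hy))
  have hvdep : DependsOn v (Δ : Set ℤ) :=
    dependsOn_site (fun k => centred μ k ^ 2 - siteVar μ * 1) (Finset.mem_coe.2 hx)
  obtain ⟨p0, p1, -⟩ := integral_pair_mul_centredSum hc h0 hx hy hxy
  have hum := integral_mul_siteSum_pow_eq_zero hc hu5 (Δ := Δ) (r := 2) fun i hi => by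
    interval_cases i
    · simpa using p0
    · simpa using p1
  have hvm := integral_mul_siteSum_pow_eq_zero hc hv5 (Δ := Δ) (r := 1) fun i hi => by
    interval_cases i
    simp only [pow_zero, mul_one, hv]
    rw [integral_sub hX2i (integrable_const _), integral_site (fun k => centred μ k ^ 2),
      ← siteVar_eq]
    simp
  set K1 := (eLpNorm v 5 (prodMeasure μ)).toReal with hK1
  set K2 := (eLpNorm u 5 (prodMeasure μ)).toReal with hK2
  refine ⟨C2 * K2 + C1 * K1, by positivity, fun Λ hΛ m hm => ?_⟩
  have hxΛ := hΛ hx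
  have hcard : 0 < Λ.card := Finset.card_pos.2 ⟨x, hxΛ⟩
  have hn1 : (1 : ℝ) ≤ Λ.card := by exact_mod_cast hcard
  have hb1 := hB1 v hvdep hv5 hvm Λ hΛ ⟨x, hxΛ⟩ m hm
  have hb2 := hB2 u hudep hu5 hum Λ hΛ ⟨x, hxΛ⟩ m hm
  set n : ℝ := (Λ.card : ℝ) with hn
  have hn0 : 0 < n := by linarith
  have e1 := centredSum_sq_ae_eq hm hc hxΛ (hΛ hy) hxy
  have e2 := condExp_sub_const_mul (m := m) hX2i (integrable_const (1 : ℝ)) (siteVar μ)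
  rw [condExp_const hm.le] at e2
  -- The error is `|Λ|⁻¹` times the difference of a term of second and one of first order.
  have e3 : (fun η => (prodMeasure μ)[u | m] η - ((centredSum μ Λ η / n) ^ 2 - siteVar μ / n))
      =ᵐ[prodMeasure μ] n⁻¹ • ((prodMeasure μ)[u | m] - (prodMeasure μ)[v | m]) := by
    filter_upwards [e1, e2] with η h1 h2
    have h1' : centredSum μ Λ η ^ 2 = n * (prodMeasure μ)[fun η => centred μ (η x) ^ 2 | m] η
      + n * (n - 1) * (prodMeasure μ)[u | m] η := h1
    have h2' : (prodMeasure μ)[v | m] η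
      = (prodMeasure μ)[fun η => centred μ (η x) ^ 2 | m] η - siteVar μ * 1 := h2
    rw [Pi.smul_apply, Pi.sub_apply, smul_eq_mul, h2', div_pow, h1']
    field_simp
    ring
  have hms := fun w => aestronglyMeasurable_condExp (μ := μ) hm.le w
  rw [eLpNorm_congr_ae e3, eLpNorm_const_smul]
  refine (mul_le_mul_right ((eLpNorm_sub_le (hms u) (hms v) (by norm_num)).trans
    (add_le_add hb2 hb1)) _).trans ?_
  rw [← ENNReal.ofReal_toReal hu5.2.ne, ← ENNReal.ofReal_toReal hv5.2.ne, ← hK1, ← hK2,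
    Real.enorm_eq_ofReal (by positivity), ← ENNReal.ofReal_mul (by positivity),
    ← ENNReal.ofReal_mul (by positivity), ← ENNReal.ofReal_add (by positivity) (by positivity),
    ← ENNReal.ofReal_mul (by positivity)]
  refine ENNReal.ofReal_le_ofReal ?_
  have r1 : n ^ (3 / 2 : ℝ) = n * n ^ (1 / 2 : ℝ) := by
    rw [show (3 / 2 : ℝ) = 1 + 1 / 2 by norm_num, Real.rpow_add hn0, Real.rpow_one]
  have r2 : n ^ (((2 : ℕ) : ℝ) / 2) = n := by norm_num
  have r3 : n ^ (((1 : ℕ) : ℝ) / 2) = n ^ (1 / 2 : ℝ) := by norm_num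
  have r4 : n ^ (1 / 2 : ℝ) ≤ n := by
    calc n ^ (1 / 2 : ℝ) ≤ n ^ (1 : ℝ) := Real.rpow_le_rpow_of_exponent_le hn1 (by norm_num)
      _ = n := Real.rpow_one n
  rw [r1, r2, r3]
  have r5 : 0 < n ^ (1 / 2 : ℝ) := by positivity
  calc n⁻¹ * (C2 / n * K2 + C1 / n ^ (1 / 2 : ℝ) * K1)
      ≤ n⁻¹ * (C2 / n ^ (1 / 2 : ℝ) * K2 + C1 / n ^ (1 / 2 : ℝ) * K1) := by gcongr
    _ = _ := by field_simp

/-- Bounds of the derivatives of the tilted mean by the `L⁵` norm. -/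
lemma exists_deriv_tiltedMean_bound (Δ : Finset ℤ) :
    ∃ K : ℝ, 0 ≤ K ∧ ∀ f : Config → ℝ, DependsOn f (Δ : Set ℤ) → MemLp f 5 (prodMeasure μ) →
      tiltedMean μ lamStar f (density (prodMeasure μ)) = 0 →
      ‖deriv (tiltedMean μ lamStar f) (density (prodMeasure μ))‖ₑ
        ≤ ENNReal.ofReal K * eLpNorm f 5 (prodMeasure μ) ∧
      (deriv (tiltedMean μ lamStar f) (density (prodMeasure μ)) = 0 →
        ‖iteratedDeriv 2 (tiltedMean μ lamStar f) (density (prodMeasure μ)) / 2‖ₑ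
          ≤ ENNReal.ofReal K * eLpNorm f 5 (prodMeasure μ)) := by
  have hS := allMoments_centredSum (allMoments_centred hlam hexp) Δ
  have hσ := siteVar_pos hlam hexp hpos hlt
  obtain ⟨K1, hK1, hb1⟩ := exists_coefficient_bound hS hσ
  obtain ⟨K2, hK2, hb2⟩ := exists_coefficient_bound (hS.pow 2)
    (show 0 < 2 * siteVar μ ^ 2 by positivity)
  refine ⟨max K1 K2, hK1.trans (le_max_left _ _), fun f hf hf5 hφ => ?_⟩
  obtain ⟨-, -, h1, h2⟩ := tiltedMean_regular hlam hexp hpos hlt hf hf5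
  refine ⟨(hb1 f hf5 _ (h1 hφ)).trans ?_, fun hd => (hb2 f hf5 _ ?_).trans ?_⟩
  · gcongr; exact le_max_left _ _
  · rw [h2 hφ hd]; ring
  · gcongr; exact le_max_right _ _

/-- **Expansion of canonical expectations** in the centred empirical density, for a local function
with vanishing mean, uniformly in the canonical field. -/
theorem exists_canonical_expansion {Δ : Finset ℤ} {x y : ℤ} (hx : x ∈ Δ) (hy : y ∈ Δ)
    (hxy : x ≠ y) :
    ∃ C : ℝ, 0 ≤ C ∧ ∀ f : Config → ℝ, DependsOn f (Δ : Set ℤ) → MemLp f 5 (prodMeasure μ) →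
      tiltedMean μ lamStar f (density (prodMeasure μ)) = 0 →
      ∀ Λ : Finset ℤ, Δ ⊆ Λ → ∀ m, IsCanonicalField μ Λ m →
        (deriv (tiltedMean μ lamStar f) (density (prodMeasure μ)) = 0 →
          eLpNorm (fun η => (prodMeasure μ)[f | m] η
              - iteratedDeriv 2 (tiltedMean μ lamStar f) (density (prodMeasure μ)) / 2
                * ((centredSum μ Λ η / Λ.card) ^ 2 - siteVar μ / Λ.card)) 4 (prodMeasure μ)
            ≤ ENNReal.ofReal (C / (Λ.card : ℝ) ^ (3 / 2 : ℝ)) * eLpNorm f 5 (prodMeasure μ)) ∧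
        eLpNorm (fun η => (prodMeasure μ)[f | m] η
            - deriv (tiltedMean μ lamStar f) (density (prodMeasure μ))
              * (centredSum μ Λ η / Λ.card)) 4 (prodMeasure μ)
          ≤ ENNReal.ofReal (C / (Λ.card : ℝ)) * eLpNorm f 5 (prodMeasure μ) := by
  have hc := allMoments_centred hlam hexp
  have h0 := integral_centred (allMoments_natCast hlam hexp)
  have hX := allMoments_site hc x
  have hY := allMoments_site hc y
  have hS := allMoments_centredSum hc Δ
  have hσ := siteVar_pos hlam hexp hpos hlt
  obtain ⟨C2, hC2, hB2⟩ := exists_canonical_bound hpos hlt hlam hexp Δ (r := 2) (by norm_num)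
  obtain ⟨C3, hC3, hB3⟩ := exists_canonical_bound hpos hlt hlam hexp Δ (r := 3) (by norm_num)
  obtain ⟨D, hD, hpair⟩ := exists_pair_bound hpos hlt hlam hexp hx hy hxy
  obtain ⟨K, hK, hder⟩ := exists_deriv_tiltedMean_bound hpos hlt hlam hexp Δ
  set X : Config → ℝ := fun η => centred μ (η x) with hXdef
  set u : Config → ℝ := fun η => centred μ (η x) * centred μ (η y) with hu
  have hum : AllMoments u (prodMeasure μ) := hX.mul hY
  have hXdep : DependsOn X (Δ : Set ℤ) := dependsOn_site _ (Finset.mem_coe.2 hx)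
  have hudep : DependsOn u (Δ : Set ℤ) := dependsOn_op (· * ·) hXdep
    (dependsOn_site _ (Finset.mem_coe.2 hy))
  obtain ⟨p0, p1, p2⟩ := integral_pair_mul_centredSum hc h0 hx hy hxy
  have q0 : ∫ η, X η ∂(prodMeasure μ) = 0 := by rw [hXdef, integral_site, h0]
  have q1 := integral_centred_mul_centredSum hc h0 hx
  set A1 := 1 + K * (eLpNorm X 5 (prodMeasure μ)).toReal with hA1
  set A2 := 1 + K * (eLpNorm u 5 (prodMeasure μ)).toReal with hA2
  have hA1' : 0 ≤ A1 := by positivity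
  have hA2' : 0 ≤ A2 := by positivity
  refine ⟨C2 * A1 + (C3 * A2 + K * D), by positivity, fun f hf hf5 hφ => ?_⟩
  obtain ⟨-, hφf, hm1, hm2⟩ := tiltedMean_regular hlam hexp hpos hlt hf hf5
  obtain ⟨hd1, hd2⟩ := hder f hf hf5 hφ
  set c1 := deriv (tiltedMean μ lamStar f) (density (prodMeasure μ)) with hc1
  set c2 := iteratedDeriv 2 (tiltedMean μ lamStar f) (density (prodMeasure μ)) with hc2
  have hfi : Integrable f (prodMeasure μ) := hf5.integrable (by norm_num)
  have hf0 : ∫ η, f η ∂(prodMeasure μ) = 0 := by rw [← hφf, hφ]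
  have hXi := hX.integrable
  have hui := hum.integrable
  -- The moments of `f - c Y`, for `Y` one of the two correctors.
  have hmom : ∀ (Y : Config → ℝ) (c : ℝ), AllMoments Y (prodMeasure μ) → ∀ i : ℕ,
      ∫ η, (f η - c * Y η) * centredSum μ Δ η ^ i ∂(prodMeasure μ)
        = ∫ η, f η * centredSum μ Δ η ^ i ∂(prodMeasure μ)
          - c * ∫ η, Y η * centredSum μ Δ η ^ i ∂(prodMeasure μ) := by
    intro Y c hYm i
    rw [← integral_const_mul, ← integral_sub ((hS.pow i).integrable_mul hf5)
      ((hYm.mul (hS.pow i)).integrable.const_mul c)]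
    exact integral_congr_ae (.of_forall fun η => by dsimp only; ring)
  have hX5 := memLp_five hX
  have hu5 := memLp_five hum
  have hF1 : MemLp (fun η => f η - c1 * X η) 5 (prodMeasure μ) := hf5.sub (hX5.const_mul c1)
  have hF2 : MemLp (fun η => f η - c2 / 2 * u η) 5 (prodMeasure μ) :=
    hf5.sub (hu5.const_mul (c2 / 2))
  have hz1 := integral_mul_siteSum_pow_eq_zero hc hF1 (Δ := Δ) (r := 2) fun i hi => by
    rw [hmom X c1 hX i]
    interval_cases i
    · simp only [pow_zero, mul_one]; rw [hf0, q0]; ring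
    · simp only [pow_one]; rw [hm1 hφ, q1]; ring
  have hz2 : c1 = 0 → ∀ i < 3, ∫ η, (f η - c2 / 2 * u η) * (siteSum id Δ η : ℝ) ^ i
      ∂(prodMeasure μ) = 0 := fun hcz =>
    integral_mul_siteSum_pow_eq_zero hc hF2 (Δ := Δ) (r := 3) fun i hi => by
      rw [hmom u (c2 / 2) hum i]
      interval_cases i
      · simp only [pow_zero, mul_one]; rw [hf0, p0]; ring
      · simp only [pow_one]; rw [hm1 hφ, p1, hcz]; ring
      · rw [hm2 hφ hcz, p2]; ring
  have hn1 := eLpNorm_sub_const_mul_le (by norm_num) hf5.1 le_rfl hX5 hK hd1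
  have hn2 := fun hcz => eLpNorm_sub_const_mul_le (by norm_num) hf5.1 le_rfl hu5 hK (hd2 hcz)
  have hdep1 : DependsOn (fun η => f η - c1 * X η) (Δ : Set ℤ) :=
    dependsOn_op (fun a b => a - c1 * b) hf hXdep
  have hdep2 : DependsOn (fun η => f η - c2 / 2 * u η) (Δ : Set ℤ) :=
    dependsOn_op (fun a b => a - c2 / 2 * b) hf hudep
  intro Λ hΛ
  have hYm : AEStronglyMeasurable (fun η => (centredSum μ Λ η / Λ.card) ^ 2
      - siteVar μ / Λ.card) (prodMeasure μ) :=
    ((((measurable_centredSum Λ).div_const _).pow_const 2).sub_const _).aestronglyMeasurable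
  intro m hm
  have hxΛ := hΛ hx
  have hcard : 0 < Λ.card := Finset.card_pos.2 ⟨x, hxΛ⟩
  have hb1 := hB2 _ hdep1 hF1 hz1 Λ hΛ ⟨x, hxΛ⟩ m hm
  have hb2 := fun hcz => hB3 _ hdep2 hF2 (hz2 hcz) Λ hΛ ⟨x, hxΛ⟩ m hm
  have hpb := hpair Λ hΛ m hm
  have hce := condExp_centred hm hc hxΛ
  have hce1 := condExp_sub_const_mul (m := m) hfi hXi c1
  have hce2 := condExp_sub_const_mul (m := m) hfi hui (c2 / 2)
  have hms := fun w => aestronglyMeasurable_condExp (μ := μ) hm.le w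
  set n : ℝ := (Λ.card : ℝ) with hn
  have hn0 : 0 < n := by rw [hn]; exact_mod_cast hcard
  constructor
  · intro hcz
    have e : (fun η => (prodMeasure μ)[f | m] η
          - c2 / 2 * ((centredSum μ Λ η / n) ^ 2 - siteVar μ / n))
        =ᵐ[prodMeasure μ] (prodMeasure μ)[fun η => f η - c2 / 2 * u η | m]
          + (c2 / 2) • fun η => (prodMeasure μ)[u | m] η
            - ((centredSum μ Λ η / n) ^ 2 - siteVar μ / n) := by
      filter_upwards [hce2] with η h
      rw [Pi.add_apply, Pi.smul_apply, smul_eq_mul, h]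
      ring
    have r : n ^ (((3 : ℕ) : ℝ) / 2) = n ^ (3 / 2 : ℝ) := by norm_num
    rw [r] at hb2
    rw [eLpNorm_congr_ae e]
    refine (eLpNorm_add_le (hms _) (((hms u).sub hYm).const_smul _) (by norm_num)).trans ?_
    rw [eLpNorm_const_smul]
    calc _ ≤ ENNReal.ofReal (C3 / n ^ (3 / 2 : ℝ))
            * (ENNReal.ofReal A2 * eLpNorm f 5 (prodMeasure μ))
          + ENNReal.ofReal K * eLpNorm f 5 (prodMeasure μ)
            * ENNReal.ofReal (D / n ^ (3 / 2 : ℝ)) :=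
          add_le_add ((hb2 hcz).trans (by gcongr; exact hn2 hcz)) (mul_le_mul' (hd2 hcz) hpb)
      _ = ENNReal.ofReal ((C3 * A2 + K * D) / n ^ (3 / 2 : ℝ)) * eLpNorm f 5 (prodMeasure μ) := by
          rw [add_div, ENNReal.ofReal_add (p := C3 * A2 / n ^ (3 / 2 : ℝ)) (by positivity)
              (by positivity), mul_div_right_comm,
            ENNReal.ofReal_mul (p := C3 / n ^ (3 / 2 : ℝ)) (by positivity), mul_div_assoc,
            ENNReal.ofReal_mul (p := K) hK]
          ring
      _ ≤ _ := mul_le_mul' (ENNReal.ofReal_le_ofReal (div_le_div_of_nonneg_right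
          (by linarith [mul_nonneg hC2 hA1']) (by positivity))) le_rfl
  · have e : (fun η => (prodMeasure μ)[f | m] η - c1 * (centredSum μ Λ η / n))
        =ᵐ[prodMeasure μ] (prodMeasure μ)[fun η => f η - c1 * X η | m] := by
      filter_upwards [hce1, hce] with η h h'
      rw [h, ← h']
    have r : n ^ (((2 : ℕ) : ℝ) / 2) = n := by norm_num
    rw [r] at hb1
    rw [eLpNorm_congr_ae e]
    calc _ ≤ ENNReal.ofReal (C2 / n) * (ENNReal.ofReal A1 * eLpNorm f 5 (prodMeasure μ)) :=
          hb1.trans (by gcongr)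
      _ = ENNReal.ofReal (C2 * A1 / n) * eLpNorm f 5 (prodMeasure μ) := by
          rw [← mul_assoc, ← ENNReal.ofReal_mul (by positivity), mul_div_right_comm]
      _ ≤ _ := by
          gcongr
          linarith [mul_nonneg hC3 hA2', mul_nonneg hK hD]

end Expansion

/-! ### Averages over boxes -/

section Boxes

variable {μ : Measure ℕ} [IsProbabilityMeasure μ]

lemma card_boxPos (n : ℕ) : (boxPos n).card = n := by simp [boxPos]

lemma card_box (l : ℕ) : (box l).card = 2 * l + 1 := by
  rw [box, Int.card_Icc]; omega

lemma boxPos_subset {n n' : ℕ} (h : n ≤ n') : boxPos n ⊆ boxPos n' :=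
  Finset.Icc_subset_Icc_right (by exact_mod_cast h)

lemma box_subset {l l' : ℕ} (h : l ≤ l') : box l ⊆ box l' :=
  Finset.Icc_subset_Icc (by omega) (by omega)

omit [IsProbabilityMeasure μ] in
lemma yAvg_eq {n : ℕ} (hn : 1 ≤ n) (η : Config) :
    yAvg μ n η = centredSum μ (boxPos n) η / (boxPos n).card := by
  have h : (n : ℝ) ≠ 0 := by exact_mod_cast (by omega : n ≠ 0)
  rw [centredSum_eq, card_boxPos, yAvg, siteSum]
  push_cast
  simp only [id]
  field_simp

omit [IsProbabilityMeasure μ] in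
lemma boxAvg_sub_eq (l : ℕ) (η : Config) :
    boxAvg l η - density (prodMeasure μ) = centredSum μ (box l) η / (box l).card := by
  have h : (2 * (l : ℝ) + 1) ≠ 0 := by positivity
  rw [centredSum_eq, card_box, boxAvg, siteSum]
  push_cast
  simp only [id]
  field_simp

lemma isCanonicalField_yAvg {n : ℕ} (hn : 1 ≤ n) :
    IsCanonicalField μ (boxPos n) (MeasurableSpace.comap (yAvg μ n) inferInstance) := by
  have h : (n : ℝ) ≠ 0 := by exact_mod_cast (by omega : n ≠ 0)
  have hg : Function.Injective fun s : ℕ => (s : ℝ) / n - density (prodMeasure μ) := by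
    intro a b hab
    simpa [div_left_inj' h] using hab
  have e : yAvg μ n = fun η =>
      (fun s : ℕ => (s : ℝ) / n - density (prodMeasure μ)) (siteSum id (boxPos n) η) := by
    funext η
    simp [yAvg, siteSum]
  rw [e]
  exact isCanonicalField_comap_siteSum hg

lemma isCanonicalField_boxAvg (l : ℕ) :
    IsCanonicalField μ (box l)
      (MeasurableSpace.comap (fun η : Config => (boxAvg l η, outside l η)) inferInstance) := by
  have h : (2 * (l : ℝ) + 1) ≠ 0 := by positivity
  have hg : Function.Injective fun s : ℕ => (s : ℝ) / (2 * (l : ℝ) + 1) := by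
    intro a b hab
    simpa [div_left_inj' h] using hab
  have e : (fun η : Config => (boxAvg l η, outside l η)) = fun η =>
      ((fun s : ℕ => (s : ℝ) / (2 * (l : ℝ) + 1)) (siteSum id (box l) η),
        fun x : {x : ℤ // x ∉ box l} => η x) := by
    funext η
    simp only [boxAvg, siteSum, id, Nat.cast_sum]
    rfl
  rw [e]
  exact isCanonicalField_comap_prod hg

lemma boxVar_eq (hc : AllMoments (centred μ) μ) (h0 : ∫ k, centred μ k ∂μ = 0) (l : ℕ) :
    boxVar μ l = siteVar μ := by
  have h : 0 < (2 * (l : ℝ) + 1) := by positivity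
  have e : ∀ η : Config,
      ((∑ x ∈ box l, ((η x : ℝ) - density (prodMeasure μ))) / √(2 * (l : ℝ) + 1)) ^ 2
        = centredSum μ (box l) η ^ 2 / (2 * (l : ℝ) + 1) := fun η => by
    rw [div_pow, Real.sq_sqrt h.le]; rfl
  rw [boxVar]
  simp_rw [e]
  rw [integral_div, integral_centredSum_sq hc h0, card_box]
  push_cast
  field_simp

/-- A constant that works eventually can be enlarged to one that works always, if for each index
some constant works. -/
lemma exists_uniform_constant {P : ℕ → ℝ → Prop} (hmono : ∀ n C C', C ≤ C' → P n C → P n C')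
    (heach : ∀ n, ∃ C, P n C) {N : ℕ} (hlarge : ∃ C, ∀ n, N ≤ n → P n C) :
    ∃ C, ∀ n, P n C := by
  induction N with
  | zero =>
    obtain ⟨C, h⟩ := hlarge
    exact ⟨C, fun n => h n (Nat.zero_le n)⟩
  | succ N ih =>
    refine ih ?_
    obtain ⟨C, h⟩ := hlarge
    obtain ⟨C', h'⟩ := heach N
    refine ⟨max C C', fun n hn => ?_⟩
    rcases hn.eq_or_lt with rfl | hlt
    · exact hmono _ _ _ (le_max_right _ _) h'
    · exact hmono _ _ _ (le_max_left _ _) (h n hlt)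

end Boxes

/-! ### The two expansions -/

section Main

variable {μ : Measure ℕ} [IsProbabilityMeasure μ] (hpos : 0 < μ {1}) (hlt : μ {1} < 1)
  {lamStar : ℝ} (hlam : 0 < lamStar)
  (hexp : ∀ lam : ℝ, |lam| ≤ lamStar → Integrable (fun k : ℕ => Real.exp (lam * (k : ℝ))) μ)

include hpos hlt hlam hexp

/-- The expansion of `E_ν[f | y]` for a fixed number `n` of sites, possibly smaller than the
support of `f`; the constant depends on `n`. -/
lemma exists_canonicalExp_bound_of_fixed (l n : ℕ) :
    ∃ C : ℝ, ∀ f : Config → ℝ, DependsOn f (boxPos l : Set ℤ) → MemLp f 5 (prodMeasure μ) →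
      tiltedMean μ lamStar f (density (prodMeasure μ)) = 0 → 1 ≤ n →
        (deriv (tiltedMean μ lamStar f) (density (prodMeasure μ)) = 0 →
          eLpNorm (fun η => canonicalExp μ n f η - ((yAvg μ n η) ^ 2 - siteVar μ / (n : ℝ))
              * (iteratedDeriv 2 (tiltedMean μ lamStar f) (density (prodMeasure μ)) / 2))
            4 (prodMeasure μ)
          ≤ ENNReal.ofReal (C / (n : ℝ) ^ (3 / 2 : ℝ)) * eLpNorm f 5 (prodMeasure μ)) ∧
        eLpNorm (fun η => canonicalExp μ n f η
            - yAvg μ n η * deriv (tiltedMean μ lamStar f) (density (prodMeasure μ)))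
          4 (prodMeasure μ)
        ≤ ENNReal.ofReal (C / (n : ℝ)) * eLpNorm f 5 (prodMeasure μ) := by
  obtain ⟨K, hK, hder⟩ := exists_deriv_tiltedMean_bound hpos hlt hlam hexp (boxPos l)
  have hS : AllMoments (fun η => centredSum μ (boxPos n) η / (boxPos n).card) (prodMeasure μ) := by
    simpa only [div_eq_inv_mul] using
      (allMoments_centredSum (allMoments_centred hlam hexp) (boxPos n)).const_mul _
  have hS2 : AllMoments (fun η => (centredSum μ (boxPos n) η / (boxPos n).card) ^ 2
      - siteVar μ / (n : ℝ)) (prodMeasure μ) := by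
    simpa only [sub_eq_add_neg] using (hS.pow 2).add (allMoments_const (-(siteVar μ / (n : ℝ))))
  set B1 := 1 + K * (eLpNorm (fun η => centredSum μ (boxPos n) η / (boxPos n).card) 4
    (prodMeasure μ)).toReal with hB1
  set B2 := 1 + K * (eLpNorm (fun η => (centredSum μ (boxPos n) η / (boxPos n).card) ^ 2
    - siteVar μ / (n : ℝ)) 4 (prodMeasure μ)).toReal with hB2
  refine ⟨B1 * n + B2 * (n : ℝ) ^ (3 / 2 : ℝ), fun f hf hf5 hφ hn => ?_⟩
  have hn0 : (0 : ℝ) < n := by exact_mod_cast hn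
  have hle := (isCanonicalField_yAvg (μ := μ) hn).le
  obtain ⟨hd1, hd2⟩ := hder f hf hf5 hφ
  simp_rw [yAvg_eq hn,
    mul_comm _ (deriv (tiltedMean μ lamStar f) (density (prodMeasure μ))),
    mul_comm _ (iteratedDeriv 2 (tiltedMean μ lamStar f) (density (prodMeasure μ)) / 2)]
  refine ⟨fun hcz => (eLpNorm_condExp_sub_le f _ (memLp_four hS2) hf5 hle hK (hd2 hcz)).trans ?_,
    (eLpNorm_condExp_sub_le f _ (memLp_four hS) hf5 hle hK hd1).trans ?_⟩
  · refine mul_le_mul' (ENNReal.ofReal_le_ofReal ?_) le_rfl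
    rw [le_div_iff₀ (by positivity)]
    linarith [show 0 ≤ B1 * n by positivity]
  · refine mul_le_mul' (ENNReal.ofReal_le_ofReal ?_) le_rfl
    rw [le_div_iff₀ (by positivity)]
    linarith [show 0 ≤ B2 * (n : ℝ) ^ (3 / 2 : ℝ) by positivity]

/-- The expansion of `E_ν[f | y]`, uniformly in the number of sites. -/
lemma exists_canonicalExp_bound (l : ℕ) :
    ∃ C : ℝ, ∀ n : ℕ, ∀ f : Config → ℝ, DependsOn f (boxPos l : Set ℤ) →
      MemLp f 5 (prodMeasure μ) →
      tiltedMean μ lamStar f (density (prodMeasure μ)) = 0 → 1 ≤ n →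
        (deriv (tiltedMean μ lamStar f) (density (prodMeasure μ)) = 0 →
          eLpNorm (fun η => canonicalExp μ n f η - ((yAvg μ n η) ^ 2 - siteVar μ / (n : ℝ))
              * (iteratedDeriv 2 (tiltedMean μ lamStar f) (density (prodMeasure μ)) / 2))
            4 (prodMeasure μ)
          ≤ ENNReal.ofReal (C / (n : ℝ) ^ (3 / 2 : ℝ)) * eLpNorm f 5 (prodMeasure μ)) ∧
        eLpNorm (fun η => canonicalExp μ n f η
            - yAvg μ n η * deriv (tiltedMean μ lamStar f) (density (prodMeasure μ)))
          4 (prodMeasure μ)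
        ≤ ENNReal.ofReal (C / (n : ℝ)) * eLpNorm f 5 (prodMeasure μ) := by
  refine exists_uniform_constant (fun n C C' hCC h f hf hf5 hφ hn => ?_)
    (fun n => exists_canonicalExp_bound_of_fixed hpos hlt hlam hexp l n) (N := l + 2) ?_
  · obtain ⟨h1, h2⟩ := h f hf hf5 hφ hn
    refine ⟨fun hcz => (h1 hcz).trans ?_, h2.trans ?_⟩ <;> gcongr
  · -- The box is enlarged so that it contains the two sites of the quadratic corrector.
    obtain ⟨C, hC, h⟩ := exists_canonical_expansion hpos hlt hlam hexp (Δ := boxPos (l + 2))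
      (x := 1) (y := 2) (by simp [boxPos]; omega) (by simp [boxPos]) (by norm_num)
    refine ⟨C, fun n hn f hf hf5 hφ hn1 => ?_⟩
    have h1 := h f (hf.mono (Finset.coe_subset.2 (boxPos_subset (by omega)))) hf5 hφ (boxPos n)
      (boxPos_subset hn) _ (isCanonicalField_yAvg hn1)
    simp_rw [yAvg_eq hn1,
    mul_comm _ (deriv (tiltedMean μ lamStar f) (density (prodMeasure μ))),
    mul_comm _ (iteratedDeriv 2 (tiltedMean μ lamStar f) (density (prodMeasure μ)) / 2)]
    simp only [card_boxPos] at h1 ⊢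
    exact h1

lemma equivalenceOfEnsembles : EquivalenceOfEnsembles μ lamStar 1 := by
  intro l₀
  obtain ⟨C, hC, h⟩ := exists_canonical_expansion hpos hlt hlam hexp (Δ := box (max l₀ 1))
    (x := 0) (y := 1) (by simp [box]) (by simp [box]; omega) (by norm_num)
  refine ⟨C, fun f hf hf5 hφ l hl hl₀ => ?_⟩
  have hl0 : (0 : ℝ) < l := by exact_mod_cast hl
  obtain ⟨h2, h1⟩ := h f (hf.mono (Finset.coe_subset.2 (box_subset (le_max_left _ _)))) hf5 hφ
    (box l) (box_subset (max_le hl₀ hl)) _ (isCanonicalField_boxAvg l)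
  have hcard : ((box l).card : ℝ) = 2 * (l : ℝ) + 1 := by rw [card_box]; push_cast; ring
  have hle : (l : ℝ) ≤ (box l).card := by rw [hcard]; linarith
  have hv := boxVar_eq (allMoments_centred hlam hexp)
    (integral_centred (allMoments_natCast hlam hexp)) l
  simp_rw [hv, boxAvg_sub_eq l, ← hcard]
  refine ⟨fun hcz => (h2 hcz).trans ?_, h1.trans ?_⟩
  · rw [show (1 : ℝ) + 1 / 2 = 3 / 2 by norm_num]
    gcongr
  · rw [show (1 / 2 : ℝ) + 1 / 2 = 1 by norm_num, Real.rpow_one]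
    gcongr

end Main

end EEns

theorem proposition5p1
    (μ : MeasureTheory.Measure ℕ) [MeasureTheory.IsProbabilityMeasure μ]
    (hpos : 0 < μ {1}) (hlt : μ {1} < 1)
    (lamStar : ℝ) (hlam : 0 < lamStar)
    (hexp : ∀ lam : ℝ, |lam| ≤ lamStar →
      MeasureTheory.Integrable (fun k : ℕ => Real.exp (lam * (k : ℝ))) μ) :
    (∀ l : ℕ, ∃ C : ℝ, ∀ f : EEns.Config → ℝ,
      DependsOn f (EEns.boxPos l : Set ℤ) →
      MeasureTheory.MemLp f 5 (EEns.prodMeasure μ) →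
      ContDiffAt ℝ 2 (EEns.tiltedMean μ lamStar f) (EEns.density (EEns.prodMeasure μ)) ∧
      (EEns.tiltedMean μ lamStar f (EEns.density (EEns.prodMeasure μ)) = 0 →
        ∀ n : ℕ, 1 ≤ n →
          (deriv (EEns.tiltedMean μ lamStar f) (EEns.density (EEns.prodMeasure μ)) = 0 →
            MeasureTheory.eLpNorm (fun η => EEns.canonicalExp μ n f η
                - ((EEns.yAvg μ n η) ^ 2 - EEns.siteVar μ / (n : ℝ))
                  * (iteratedDeriv 2 (EEns.tiltedMean μ lamStar f)
                      (EEns.density (EEns.prodMeasure μ)) / 2))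
              4 (EEns.prodMeasure μ)
            ≤ ENNReal.ofReal (C / (n : ℝ) ^ (3 / 2 : ℝ))
                * MeasureTheory.eLpNorm f 5 (EEns.prodMeasure μ)) ∧
          MeasureTheory.eLpNorm (fun η => EEns.canonicalExp μ n f η
              - EEns.yAvg μ n η
                * deriv (EEns.tiltedMean μ lamStar f) (EEns.density (EEns.prodMeasure μ)))
            4 (EEns.prodMeasure μ)
          ≤ ENNReal.ofReal (C / (n : ℝ))
              * MeasureTheory.eLpNorm f 5 (EEns.prodMeasure μ))) ∧
    EEns.EquivalenceOfEnsembles μ lamStar 1 := by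
  refine ⟨fun l => ?_, EEns.equivalenceOfEnsembles hpos hlt hlam hexp⟩
  obtain ⟨C, hC⟩ := EEns.exists_canonicalExp_bound hpos hlt hlam hexp l
  exact ⟨C, fun f hf hf5 => ⟨(EEns.tiltedMean_regular hlam hexp hpos hlt hf hf5).1,
    fun hφ n hn => hC n f hf hf5 hφ hn⟩⟩
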